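/- **Setting.** Let $\bar A\in\{0,1\}^{n\times n}$ be a structural dynamics matrix, and let $k\ge 0$. A co-design consists of a collection $I_B$ of dedicated actuators and a collection $I_C$ of dedicated sensors (each acts on, or measures, one state variable; several may be assigned to the same one), and a set $\mathcal K$ of communication links (sensor, actuator). Let $\bar B(I_B)$, $\bar C(I_C)$ be the corresponding patterns. For failed links $\mathcal J\subset\mathcal K$, the structural system $(\bar A,\bar B,\bar C;\mathcal K,\mathcal J)$ *has structurally resilient fixed modes* if for almost all real $A,B,C$ with patterns $\bar A,\bar B,\bar C$ one has $\bigcap_K\sigma(A+BKC)\ne\emptyset$, where $K$ runs over the real gains that vanish outside the links of $\mathcal K\setminus\mathcal J$. Problem $\mathcal P_2$ is to minimize $|I_B|+|I_C|+|\mathcal K|$ over all co-designs such that $(\bar A,\bar B(I_B\setminus J_B),\bar C(I_C\setminus J_C);\mathcal K,\mathcal J)$ has no structurally resilient fixed modes whenever $J_B\subset I_B$, $J_C\subset I_C$, $\mathcal J\subset\mathcal K$ and $|\mathcal J|+|J_B|+|J_C|\le k$. A *sparsest information pattern* for $(I_B,I_C)$ is a link set $\mathcal K$ of minimum cardinality for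 which the system, with no failures, has no structurally fixed modes. *Procedure 1* for $(I_B,I_C)$ with $|I_B|\le|I_C|$: form the bipartite graph with an edge $(a,c)$ whenever the system digraph has a path from actuator $a$ to sensor $c$; take a maximum matching $M=\{(a_1,c_1),\dots,(a_r,c_r)\}$ and the links $c_l\to a_{l+1}$ ($l=1,\dots,r$, indices mod $r$); add, for each sensor unmatched by $M$, exactly one link from it to some actuator, such that every actuator unmatched by $M$ receives one of these links. If $|I_C|\le|I_B|$, the roles in the last step are exchanged: exactly one link into each unmatched actuator, such that every unmatched sensor emits one of these links. **Theorem 4.** Assume A1: the state bipartite graph, with an edge $(x_i,x_j)$ iff $\bar A_{ji}=1$, has a perfect matching. Let $I_B^*=\{\iota_1,\dots,\iota_{(k+1)p}\}$ and $I_C^*=\{\gamma_1,\dots,\gamma_{(k+1)m}\}$ be divided into $k+1$ consecutive blocks $I_B^{(i)}$ of $p$ actuators and $I_C^{(i)}$ of $m$ sensors, such that each $I_B^{(i)}$ (each $I_C^{(i)}$) is a minimum-size collection of dedicated actuators (sensors) ensuring structural controllability (observability). Then for each $i$ Procedure 1 for $(I_B^{(i)},I_C^{(i)})$ has an outcome,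 and each of its outcomes is a sparsest information pattern for $(I_B^{(i)},I_C^{(i)})$. If $\mathcal K^{(i)}$ is an outcome of Procedure 1, or, more generally, if every $\mathcal K^{(i)}$ is a sparsest information pattern for $(I_B^{(i)},I_C^{(i)})$, $i=1,\dots,k+1$, then $(I_B^*,I_C^*,\bigcup_{i=1}^{k+1}\mathcal K^{(i)})$ is a solution of $\mathcal P_2$. Furthermore, there is a random access machine program (unit cost for each operation: addition, truncated subtraction, comparison, array access) and a constant $\kappa$ such that for all $n$, $k$ and all $\bar A$ satisfying A1, given $n$, $k$ and adjacency lists of the state digraph, the program computes such a solution $(I_B^*,I_C^*,\bigcup_i\mathcal K^{(i)})$ of $\mathcal P_2$ (made of $k+1$ minimum-size blocks and a sparsest information pattern for each) in at most $$\kappa\Bigl(1+(k+1)\max\bigl\{|\mathcal V|+|\mathcal E|,\ (|I_B^*|+|I_C^*|)^{5/2}\bigr\}\Bigr)$$ steps, where $|\mathcal V|$ and $|\mathcal E|$ are the numbers of vertices and edges of the system digraph $\mathcal D(\bar A,\bar B(I_B^*),\bar C(I_C^*))$. -/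

import Mathlib

open MeasureTheory

noncomputable section

namespace ResilientCoDesign

/-! ### Structural patterns and their realizations -/

/-- The positions of the free parameters of a binary pattern. -/
abbrev Free {I J : Type} (P : Matrix I J Bool) : Type := {e : I × J // P e.1 e.2 = true}

/-- The real matrix with pattern `P` whose free parameters are given by `x`, the other entries
being fixed zeros. -/
def realize {I J : Type} (P : Matrix I J Bool) (x : Free P → ℝ) : Matrix I J ℝ :=
  Matrix.of fun i j => if h : P i j = true then x ⟨(i, j), h⟩ else 0

/-- The pattern `B(ι)` of a collection of dedicated actuators: actuator `a` acts on the single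
state variable `ι a`. -/
def actuatorPattern {n : ℕ} {α : Type} (ι : α → Fin n) : Matrix (Fin n) α Bool :=
  Matrix.of fun i a => decide (ι a = i)

/-- The pattern `C(γ)` of a collection of dedicated sensors: sensor `c` measures the single
state variable `γ c`. -/
def sensorPattern {n : ℕ} {β : Type} (γ : β → Fin n) : Matrix β (Fin n) Bool :=
  Matrix.of fun c i => decide (γ c = i)

/-! ### Structural controllability and observability -/

/-- Controllability of `(A, B)`: the Kalman matrix `[B, AB, …, Aⁿ⁻¹B]` has rank `n`. -/
def Controllable {n : ℕ} {α : Type} [Fintype α] (A : Matrix (Fin n) (Fin n) ℝ)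
    (B : Matrix (Fin n) α ℝ) : Prop :=
  (Matrix.of fun (i : Fin n) (e : Fin n × α) => (A ^ (e.1 : ℕ) * B) i e.2).rank = n

/-- Observability of `(A, C)`: the matrix with block rows `C, CA, …, CAⁿ⁻¹` has rank `n`. -/
def Observable {n : ℕ} {β : Type} (A : Matrix (Fin n) (Fin n) ℝ)
    (C : Matrix β (Fin n) ℝ) : Prop :=
  (Matrix.of fun (e : Fin n × β) (i : Fin n) => (C * A ^ (e.1 : ℕ)) e.2 i).rank = n

/-- A structural pair is structurally controllable if some realization is controllable. -/
def StructControllable {n : ℕ} {α : Type} [Fintype α] (Abar : Matrix (Fin n) (Fin n) Bool)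
    (Bbar : Matrix (Fin n) α Bool) : Prop :=
  ∃ (a : Free Abar → ℝ) (b : Free Bbar → ℝ), Controllable (realize Abar a) (realize Bbar b)

/-- A structural pair is structurally observable if some realization is observable. -/
def StructObservable {n : ℕ} {β : Type} (Abar : Matrix (Fin n) (Fin n) Bool)
    (Cbar : Matrix β (Fin n) Bool) : Prop :=
  ∃ (a : Free Abar → ℝ) (c : Free Cbar → ℝ), Observable (realize Abar a) (realize Cbar c)

/-- `ι` is a collection of dedicated actuators of minimum size ensuring structural
controllability. -/
def IsMinActuators {n p : ℕ} (Abar : Matrix (Fin n) (Fin n) Bool) (ι : Fin p → Fin n) : Prop :=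
  StructControllable Abar (actuatorPattern ι) ∧
    ∀ (q : ℕ) (κ : Fin q → Fin n), StructControllable Abar (actuatorPattern κ) → p ≤ q

/-- `γ` is a collection of dedicated sensors of minimum size ensuring structural
observability. -/
def IsMinSensors {n m : ℕ} (Abar : Matrix (Fin n) (Fin n) Bool) (γ : Fin m → Fin n) : Prop :=
  StructObservable Abar (sensorPattern γ) ∧
    ∀ (q : ℕ) (κ : Fin q → Fin n), StructObservable Abar (sensorPattern κ) → m ≤ q

/-! ### Resilient fixed modes -/

/-- The gains compatible with the links `L` when the links in `F` have failed. A link `(c, a)`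
goes from the sensor `c` to the actuator `a`. -/
def gainSet {α β : Type} (L F : Set (β × α)) : Set (Matrix α β ℝ) :=
  {K | ∀ a c, ((c, a) ∉ L ∨ (c, a) ∈ F) → K a c = 0}

/-- The set of resilient fixed modes of `(A, B, C)` with respect to the links `L` and the
collection `Fs` of possible failures. -/
def resilientFixedModes {n : ℕ} {α β : Type} [Fintype α] [Fintype β]
    (A : Matrix (Fin n) (Fin n) ℝ) (B : Matrix (Fin n) α ℝ) (C : Matrix β (Fin n) ℝ)
    (L : Set (β × α)) (Fs : Set (Set (β × α))) : Set ℂ :=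
  ⋃ F ∈ Fs, ⋂ K ∈ gainSet L F, spectrum ℂ ((A + B * K * C).map (algebraMap ℝ ℂ))

/-- The structural system has structurally resilient fixed modes: almost all of its realizations
(with respect to Lebesgue measure on the free parameters) have a resilient fixed mode. -/
def HasStructResilientFixedModes {n : ℕ} {α β : Type} [Fintype α] [Fintype β]
    (Abar : Matrix (Fin n) (Fin n) Bool) (Bbar : Matrix (Fin n) α Bool)
    (Cbar : Matrix β (Fin n) Bool) (L : Set (β × α)) (Fs : Set (Set (β × α))) : Prop :=
  ∀ᵐ x : (Free Abar → ℝ) × (Free Bbar → ℝ) × (Free Cbar → ℝ) ∂volume,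
    (resilientFixedModes (realize Abar x.1) (realize Bbar x.2.1) (realize Cbar x.2.2)
      L Fs).Nonempty

/-- `L` is a sparsest information pattern for the dedicated actuators `ι` and sensors `γ`:
it leaves no structurally fixed modes (in the absence of failures), with as few links as
possible. -/
def IsSparsestPattern {n p m : ℕ} (Abar : Matrix (Fin n) (Fin n) Bool) (ι : Fin p → Fin n)
    (γ : Fin m → Fin n) (L : Finset (Fin m × Fin p)) : Prop :=
  ¬ HasStructResilientFixedModes Abar (actuatorPattern ι) (sensorPattern γ) (L : Set _) {∅} ∧
    ∀ L' : Finset (Fin m × Fin p),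
      ¬ HasStructResilientFixedModes Abar (actuatorPattern ι) (sensorPattern γ)
        (L' : Set _) {∅} → L.card ≤ L'.card

/-! ### The co-design problem -/

/-- A co-design: dedicated actuators, dedicated sensors (several of them may be assigned to the
same state variable), and a set of communication links `(sensor, actuator)`. -/
structure Design (n : ℕ) where
  p : ℕ
  m : ℕ
  act : Fin p → Fin n
  sen : Fin m → Fin n
  links : Finset (Fin m × Fin p)

/-- Number of actuators plus number of sensors plus number of links. -/
def Design.cost {n : ℕ} (d : Design n) : ℕ := d.p + d.m + d.links.card

/-- The constraint of the co-design problem: for any failure of links `J`, actuators `JB` and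
sensors `JC`, at most `k` in total, what is left of the closed loop has no structurally resilient
fixed modes. -/
def Tolerates {n : ℕ} (Abar : Matrix (Fin n) (Fin n) Bool) (k : ℕ) (d : Design n) : Prop :=
  ∀ (J : Finset (Fin d.m × Fin d.p)) (JB : Finset (Fin d.p)) (JC : Finset (Fin d.m)),
    J ⊆ d.links → J.card + JB.card + JC.card ≤ k →
    ¬ HasStructResilientFixedModes Abar
      (actuatorPattern fun a : {a : Fin d.p // a ∉ JB} => d.act a)
      (sensorPattern fun c : {c : Fin d.m // c ∉ JC} => d.sen c)
      {e | ((e.1 : Fin d.m), (e.2 : Fin d.p)) ∈ d.links}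
      {{e | ((e.1 : Fin d.m), (e.2 : Fin d.p)) ∈ J}}

/-- `d` is a solution of the resilient co-design problem: it is feasible and has minimum cost
among all feasible co-designs. -/
def IsOptimal {n : ℕ} (Abar : Matrix (Fin n) (Fin n) Bool) (k : ℕ) (d : Design n) : Prop :=
  Tolerates Abar k d ∧ ∀ d' : Design n, Tolerates Abar k d' → d.cost ≤ d'.cost

/-! ### Digraphs, bipartite graphs and matchings -/

/-- The edges of the system digraph on states, inputs and outputs. -/
def systemEdge {n : ℕ} {α β : Type} (Abar : Matrix (Fin n) (Fin n) Bool)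
    (Bbar : Matrix (Fin n) α Bool) (Cbar : Matrix β (Fin n) Bool) :
    Fin n ⊕ α ⊕ β → Fin n ⊕ α ⊕ β → Prop
  | .inl i, .inl j => Abar j i = true
  | .inr (.inl a), .inl i => Bbar i a = true
  | .inl i, .inr (.inr c) => Cbar c i = true
  | _, _ => False

/-- The number of vertices plus the number of edges of the system digraph of a co-design. -/
def Design.graphSize {n : ℕ} (Abar : Matrix (Fin n) (Fin n) Bool) (d : Design n) : ℕ :=
  Fintype.card (Fin n ⊕ Fin d.p ⊕ Fin d.m) +
    Set.ncard {e : (Fin n ⊕ Fin d.p ⊕ Fin d.m) × (Fin n ⊕ Fin d.p ⊕ Fin d.m) |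
      systemEdge Abar (actuatorPattern d.act) (sensorPattern d.sen) e.1 e.2}

/-- `M` is a matching of the bipartite graph with parts `S`, `T` and edge set `E`. -/
def IsMatching {S T : Type} (E : Set (S × T)) (M : Finset (S × T)) : Prop :=
  (∀ e ∈ M, e ∈ E) ∧ ∀ e ∈ M, ∀ f ∈ M, (e.1 = f.1 ∨ e.2 = f.2) → e = f

/-- A matching with the largest possible number of edges. -/
def IsMaxMatching {S T : Type} (E : Set (S × T)) (M : Finset (S × T)) : Prop :=
  IsMatching E M ∧ ∀ M' : Finset (S × T), IsMatching E M' → M'.card ≤ M.card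

def LeftMatched {S T : Type} (M : Finset (S × T)) (s : S) : Prop := ∃ t, (s, t) ∈ M

def RightMatched {S T : Type} (M : Finset (S × T)) (t : T) : Prop := ∃ s, (s, t) ∈ M

/-- The state bipartite graph has a perfect matching. -/
def StatePerfectMatching {n : ℕ} (Abar : Matrix (Fin n) (Fin n) Bool) : Prop :=
  ∃ M : Finset (Fin n × Fin n),
    IsMatching {e : Fin n × Fin n | Abar e.2 e.1 = true} M ∧
      (∀ i, LeftMatched M i) ∧ ∀ i, RightMatched M i

/-! ### The pairing procedure -/

/-- The bipartite graph of the pairs (actuator, sensor) such that the system digraph has a path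
from the actuator to the sensor. -/
def reachEdges {n p m : ℕ} (Abar : Matrix (Fin n) (Fin n) Bool) (ι : Fin p → Fin n)
    (γ : Fin m → Fin n) : Set (Fin p × Fin m) :=
  {e | Relation.TransGen (systemEdge Abar (actuatorPattern ι) (sensorPattern γ))
    (.inr (.inl e.1)) (.inr (.inr e.2))}

/-- `L` is a sequential pairing induced by the matching `M`: the edges of `M` can be listed as
`(i₀, j₀), …, (iᵣ₋₁, jᵣ₋₁)` so that `L` consists of the links from `jₗ` to `iₗ₊₁`, with indices
modulo `r`. -/
def IsSequentialPairing {p m : ℕ} (M : Finset (Fin p × Fin m)) (L : Finset (Fin m × Fin p)) :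
    Prop :=
  ∃ (r : ℕ) (e : Fin r → Fin p × Fin m), Function.Injective e ∧
    Finset.univ.image e = M ∧
    L = Finset.univ.image fun l => ((e l).2, (e (finRotate r l)).1)

/-- `L` is an outcome of the pairing procedure for the actuators `ι` and the sensors `γ`:
a sequential pairing induced by a maximum matching `M` of the reachability graph, together with
a set `L'` of links for the unmatched elements. If there are at most as many actuators as
sensors, then `L'` has one link for each unmatched sensor, and uses each unmatched actuator (there
is none if `M` saturates the actuators); the other case is symmetric. -/
def IsPairingOutcome {n p m : ℕ} (Abar : Matrix (Fin n) (Fin n) Bool) (ι : Fin p → Fin n)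
    (γ : Fin m → Fin n) (L : Finset (Fin m × Fin p)) : Prop :=
  ∃ (M : Finset (Fin p × Fin m)) (S L' : Finset (Fin m × Fin p)),
    IsMaxMatching (reachEdges Abar ι γ) M ∧ IsSequentialPairing M S ∧ L = S ∪ L' ∧
    ((p ≤ m ∧
        (∀ e ∈ L', ¬ RightMatched M e.1) ∧
        (∀ c, ¬ RightMatched M c → ∃! a, (c, a) ∈ L') ∧
        (∀ a, ¬ LeftMatched M a → ∃ c, (c, a) ∈ L')) ∨
      (m ≤ p ∧
        (∀ e ∈ L', ¬ LeftMatched M e.2) ∧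
        (∀ a, ¬ LeftMatched M a → ∃! c, (c, a) ∈ L') ∧
        (∀ c, ¬ RightMatched M c → ∃ a, (c, a) ∈ L')))

/-! ### Splitting a collection into blocks, and the union of the blocks' patterns -/

/-- The `i`-th block of `q` consecutive elements of a collection of `(k + 1) * q` elements. -/
def block {n k q : ℕ} (ι : Fin ((k + 1) * q) → Fin n) (i : Fin (k + 1)) : Fin q → Fin n :=
  fun a => ι (finProdFinEquiv (i, a))

/-- The co-design with all actuators `ι`, all sensors `γ`, and the union of the patterns `L i`,
where `L i` links the `i`-th block of sensors to the `i`-th block of actuators. -/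
def unionDesign {n k p m : ℕ} (ι : Fin ((k + 1) * p) → Fin n) (γ : Fin ((k + 1) * m) → Fin n)
    (L : Fin (k + 1) → Finset (Fin m × Fin p)) : Design n where
  p := (k + 1) * p
  m := (k + 1) * m
  act := ι
  sen := γ
  links := Finset.univ.biUnion fun i =>
    (L i).image fun e => (finProdFinEquiv (i, e.1), finProdFinEquiv (i, e.2))

/-! ### Random access machines with unit-cost steps -/

/-- The memory: registers and arrays of natural numbers. -/
structure Memory where
  reg : ℕ → ℕ
  arr : ℕ → ℕ → ℕ

/-- Expressions: constants, registers, sums, truncated differences, and array look-ups. -/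
inductive Expr where
  | const (c : ℕ)
  | reg (r : ℕ)
  | add (e f : Expr)
  | sub (e f : Expr)
  | get (a : ℕ) (e : Expr)

def Expr.eval (s : Memory) : Expr → ℕ
  | .const c => c
  | .reg r => s.reg r
  | .add e f => e.eval s + f.eval s
  | .sub e f => e.eval s - f.eval s
  | .get a e => s.arr a (e.eval s)

/-- The number of steps of an evaluation: one for each operation. -/
def Expr.cost : Expr → ℕ
  | .const _ => 1
  | .reg _ => 1
  | .add e f => e.cost + f.cost + 1
  | .sub e f => e.cost + f.cost + 1
  | .get _ e => e.cost + 1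

/-- Programs: assignment to a register, assignment to an array entry, composition, and
branching and loops on a test `e < f`. -/
inductive Program where
  | assign (r : ℕ) (e : Expr)
  | store (a : ℕ) (e f : Expr)
  | seq (P Q : Program)
  | branch (e f : Expr) (P Q : Program)
  | loop (e f : Expr) (P : Program)

/-- `Run P s t s'`: started in memory `s`, the program `P` halts after `t` steps in memory `s'`. -/
inductive Run : Program → Memory → ℕ → Memory → Prop where
  | assign (r : ℕ) (e : Expr) (s : Memory) :
      Run (.assign r e) s (e.cost + 1) ⟨Function.update s.reg r (e.eval s), s.arr⟩
  | store (a : ℕ) (e f : Expr) (s : Memory) :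
      Run (.store a e f) s (e.cost + f.cost + 1)
        ⟨s.reg, Function.update s.arr a (Function.update (s.arr a) (e.eval s) (f.eval s))⟩
  | seq {P Q : Program} {s s' s'' : Memory} {t t' : ℕ} :
      Run P s t s' → Run Q s' t' s'' → Run (.seq P Q) s (t + t') s''
  | branchTrue {e f : Expr} {P Q : Program} {s s' : Memory} {t : ℕ} :
      e.eval s < f.eval s → Run P s t s' →
        Run (.branch e f P Q) s (e.cost + f.cost + 1 + t) s'
  | branchFalse {e f : Expr} {P Q : Program} {s s' : Memory} {t : ℕ} :
      ¬ e.eval s < f.eval s → Run Q s t s' →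
        Run (.branch e f P Q) s (e.cost + f.cost + 1 + t) s'
  | loopStop {e f : Expr} {P : Program} {s : Memory} :
      ¬ e.eval s < f.eval s → Run (.loop e f P) s (e.cost + f.cost + 1) s
  | loopStep {e f : Expr} {P : Program} {s s' s'' : Memory} {t t' : ℕ} :
      e.eval s < f.eval s → Run P s t s' → Run (.loop e f P) s' t' s'' →
        Run (.loop e f P) s (e.cost + f.cost + 1 + t + t') s''

/-- The arrays `off`, `tgt` hold adjacency lists of the state digraph: the successors of vertex
`i` are listed, each exactly once and in any order, in `tgt` at the positions from `off i` up to
`off (i + 1) - 1`. -/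
def IsAdjacency {n : ℕ} (Abar : Matrix (Fin n) (Fin n) Bool) (off tgt : ℕ → ℕ) : Prop :=
  off 0 = 0 ∧ ∀ i : Fin n, off i ≤ off ((i : ℕ) + 1) ∧
    Set.BijOn tgt (Set.Ico (off i) (off ((i : ℕ) + 1))) {v | ∃ j : Fin n, Abar j i = true ∧ v = j}

/-- The input: `n` and `k` in registers `0` and `1`, adjacency lists in arrays `0` and `1`, and
zeros elsewhere. -/
def inputMemory (n k : ℕ) (off tgt : ℕ → ℕ) : Memory where
  reg := fun r => if r = 0 then n else if r = 1 then k else 0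
  arr := fun a => if a = 0 then off else if a = 1 then tgt else fun _ => 0

/-- The memory holds the co-design `d`: the numbers of actuators, sensors and links in registers
`0`, `1`, `2`; the actuated and the measured state variables in arrays `0` and `1`; and a list of
the links, without repetition, in arrays `2` (sensors) and `3` (actuators). -/
def Outputs {n : ℕ} (s : Memory) (d : Design n) : Prop :=
  s.reg 0 = d.p ∧ s.reg 1 = d.m ∧ s.reg 2 = d.links.card ∧
    (∀ a : Fin d.p, s.arr 0 a = d.act a) ∧ (∀ c : Fin d.m, s.arr 1 c = d.sen c) ∧
    (Finset.range (s.reg 2)).image (fun l => (s.arr 2 l, s.arr 3 l)) =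
      d.links.image fun e => ((e.1 : ℕ), (e.2 : ℕ))

end ResilientCoDesign

end

open ResilientCoDesign

/-!
Everything is reduced to reachability in the state digraph and in the closed-loop digraph, whose
additional edges lead from the state measured by a sensor to the state driven by an actuator linked
to it (`LoopEdge`).

*Necessity.* If no surviving link lies in the strongly connected component of a state in the closed
loop, then a diagonal block of `A + BKC` does not depend on `K`, and its eigenvalues are fixed modes
(`exists_link_of_not_hasStructResilientFixedModes`). Hence each source component of the state
digraph must receive a surviving link, each sink component must emit one, and a design that
tolerates `k` failures has at least `k + 1` actuators and links for each source component, and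
`k + 1` sensors and links for each sink component (`Tolerates.lower_bounds_sources`,
`Tolerates.lower_bounds_sinks`). The predecessors of distinct source components are disjoint, so
that these numbers add up.

*Sufficiency.* By compactness, a single realization without fixed modes excludes fixed modes on a
set of positive measure (`not_hasStructResilientFixedModes_of_exists`). If A1 holds, the cycles of a
perfect matching carry weights of distinct moduli; together with a few edges that connect the cycles
to a set `S` of vertices, they give a matrix none of whose left eigenvectors vanishes on all of `S`
(`exists_matrix_forall_eigenvector`). With the Popov–Belevitch–Hautus criterion this shows that
reachability from the actuators implies structural controllability. If the closed loop is strongly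
connected, such matrices are found for a single link, one controllable from the end of the link, and
one observable from its start; a matrix on the line through them has both properties, and then the
link moves all eigenvalues (`not_hasStructResilientFixedModes_of_strongly_connected`). A cycle
through the pairs of a maximal matching of sources and sinks, with one link for each of the other
sources and sinks, makes the closed loop strongly connected (`loopEdge_strongly_connected`). It has
`max p m` links, which meets the lower bounds, and after `k` failures one of `k + 1` such blocks is
intact (`tolerates_unionDesign`).

*Running time.* The program works in linear time. Representatives of the source components are the
roots of two successive scans by depth-first searches (`RootList.sourceList`), and sinks are found
in the reverse digraph. A maximum matching is not needed: following Eswaran and Tarjan, searches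
from the sources which are abandoned when they meet a sink give pairs such that each source reaches
a matched sink and each sink is reached from a matched source (`SearchInv.exists_reach_sink`,
`SearchInv.exists_root_reach`), and this suffices for strong connectivity. The programs are verified
with a Hoare-style predicate `Ends` for total correctness that keeps track of the number of steps.
-/

namespace ResilientCoDesign

open Relation

/-! ### Surviving links are necessary -/

/-- The edges between states of the closed loop: an edge of the state digraph, or a link `(c, a)`
of `L` read as an edge from the state measured by `c` to the state driven by `a`. -/
def LoopEdge {n : ℕ} {α β : Type} (Abar : Matrix (Fin n) (Fin n) Bool) (ι : α → Fin n)
    (γ : β → Fin n) (L : Set (β × α)) (i j : Fin n) : Prop :=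
  Abar j i = true ∨ ∃ e ∈ L, γ e.1 = i ∧ ι e.2 = j

theorem realize_eq_zero {I J : Type} {P : Matrix I J Bool} (x : Free P → ℝ) {i : I} {j : J}
    (h : ¬ P i j = true) : realize P x i j = 0 := by
  simp [realize, h]

theorem loop_entry_eq {n : ℕ} {α β : Type} [Fintype α] [Fintype β]
    {Abar : Matrix (Fin n) (Fin n) Bool} {ι : α → Fin n} {γ : β → Fin n} {L F : Set (β × α)}
    (x : (Free Abar → ℝ) × (Free (actuatorPattern ι) → ℝ) × (Free (sensorPattern γ) → ℝ))
    {K : Matrix α β ℝ} (hK : K ∈ gainSet L F) {i j : Fin n}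
    (h : ¬ ∃ e ∈ L \ F, γ e.1 = j ∧ ι e.2 = i) :
    (realize Abar x.1 + realize (actuatorPattern ι) x.2.1 * K *
      realize (sensorPattern γ) x.2.2) i j = realize Abar x.1 i j := by
  rw [Matrix.add_apply, add_eq_left, Matrix.mul_apply]
  refine Finset.sum_eq_zero fun c _ => ?_
  rw [Matrix.mul_apply]
  by_cases hc : γ c = j
  · rw [Finset.sum_eq_zero, zero_mul]
    intro a _
    by_cases ha : ι a = i
    · rw [hK a c, mul_zero]
      by_contra hcon
      push Not at hcon
      exact h ⟨(c, a), ⟨hcon.1, hcon.2⟩, hc, ha⟩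
    · rw [realize_eq_zero _ (by simpa [actuatorPattern] using ha), zero_mul]
  · rw [realize_eq_zero (P := sensorPattern γ) _ (by simpa [sensorPattern] using hc), mul_zero]

/-- If the strongly connected component of `i` in the closed loop contains no surviving link, then
the diagonal block of `A + BKC` on it does not depend on `K`, so its eigenvalues are fixed modes of
every realization. -/
theorem exists_link_of_not_hasStructResilientFixedModes {n : ℕ} {α β : Type} [Fintype α]
    [Fintype β] {Abar : Matrix (Fin n) (Fin n) Bool} {ι : α → Fin n} {γ : β → Fin n}
    {L F : Set (β × α)}
    (h : ¬ HasStructResilientFixedModes Abar (actuatorPattern ι) (sensorPattern γ) L {F})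
    (i : Fin n) : ∃ e ∈ L \ F, ReflTransGen (LoopEdge Abar ι γ (L \ F)) i (γ e.1) ∧
      ReflTransGen (LoopEdge Abar ι γ (L \ F)) (ι e.2) i := by
  classical
  by_contra hne
  push Not at hne
  apply h
  refine Filter.Eventually.of_forall fun x => ?_
  set R := ReflTransGen (LoopEdge Abar ι γ (L \ F)) with hR
  -- `b` is `0` strictly below the component of `i`, `1` on it, and `2` elsewhere.
  let b : Fin n → Fin 3 := fun j => if R i j then (if R j i then 1 else 0) else 2
  have hb1 : ∀ j, b j = 1 ↔ R i j ∧ R j i := by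
    intro j
    simp only [b]
    split_ifs <;> simp_all
  set A : Matrix (Fin n) (Fin n) ℂ := (realize Abar x.1).map (algebraMap ℝ ℂ) with hA
  have : Nonempty {j // b j = 1} := ⟨⟨i, (hb1 i).2 ⟨.refl, .refl⟩⟩⟩
  obtain ⟨lam, hlam⟩ : ∃ lam, lam ∈ spectrum ℂ (A.toSquareBlock b 1) :=
    spectrum.nonempty_of_isAlgClosed_of_finiteDimensional ℂ _
  have hdet : (algebraMap ℂ (Matrix _ _ ℂ) lam - A.toSquareBlock b 1).det = 0 := by
    rw [spectrum.mem_iff, Matrix.isUnit_iff_isUnit_det, isUnit_iff_ne_zero, not_not] at hlam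
    exact hlam
  refine ⟨lam, ?_⟩
  simp only [resilientFixedModes, Set.mem_singleton_iff, Set.iUnion_iUnion_eq_left,
    Set.mem_iInter]
  intro K hK
  set M := realize Abar x.1 + realize (actuatorPattern ι) x.2.1 * K *
      realize (sensorPattern γ) x.2.2 with hM
  have hMedge : ∀ r c, M r c ≠ 0 → LoopEdge Abar ι γ (L \ F) c r := by
    intro r c hrc
    by_contra hno
    simp only [LoopEdge, not_or] at hno
    rw [hM, loop_entry_eq x hK hno.2, realize_eq_zero _ hno.1] at hrc
    exact hrc rfl
  rw [spectrum.mem_iff, Matrix.isUnit_iff_isUnit_det, isUnit_iff_ne_zero, not_not]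
  have htri : (algebraMap ℂ (Matrix _ _ ℂ) lam - M.map (algebraMap ℝ ℂ)).BlockTriangular b := by
    intro r c hlt
    have hrc : r ≠ c := by rintro rfl; exact lt_irrefl _ hlt
    rw [Matrix.sub_apply, Matrix.algebraMap_matrix_apply, if_neg hrc, zero_sub, neg_eq_zero,
      Matrix.map_apply]
    by_contra hne0
    have hcr : R c r := .single (hMedge r c fun h0 => hne0 (by rw [h0, map_zero]))
    by_cases h1 : R i c
    · have h2 : R i r := h1.trans hcr
      by_cases h3 : R r i
      · have h4 : R c i := hcr.trans h3
        simp [b, h1, h2, h3, h4] at hlt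
      · simp [b, h2, h3] at hlt
    · simp only [b, h1, if_false] at hlt
      exact absurd hlt (by
        have : ∀ z : Fin 3, ¬ (2 < z) := by decide
        exact this _)
  rw [htri.det_fintype]
  refine Finset.prod_eq_zero (Finset.mem_univ (1 : Fin 3)) ?_
  rw [← hdet]
  congr 1
  ext r c
  have hr := (hb1 _).1 r.2
  have hc := (hb1 _).1 c.2
  have hent : M r c = realize Abar x.1 r c := by
    refine loop_entry_eq x hK ?_
    rintro ⟨e, he, h1, h2⟩
    exact hne e he (h1 ▸ hc.1) (h2 ▸ hr.2)
  simp only [Matrix.toSquareBlock_def, Matrix.of_apply, Matrix.sub_apply,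
    Matrix.algebraMap_matrix_apply, Matrix.map_apply, hent, hA, Subtype.ext_iff]

/-- A nonempty set of states that is closed under predecessors receives a surviving link. -/
theorem exists_link_into_of_pred_closed {n : ℕ} {α β : Type} [Fintype α]
    [Fintype β] {Abar : Matrix (Fin n) (Fin n) Bool} {ι : α → Fin n} {γ : β → Fin n}
    {L F : Set (β × α)}
    (h : ¬ HasStructResilientFixedModes Abar (actuatorPattern ι) (sensorPattern γ) L {F})
    {T : Set (Fin n)} (hT : ∀ i j, Abar j i = true → j ∈ T → i ∈ T) {i : Fin n} (hi : i ∈ T) :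
    ∃ e ∈ L \ F, ι e.2 ∈ T := by
  obtain ⟨e, he, -, h2⟩ := exists_link_of_not_hasStructResilientFixedModes h i
  by_contra hno
  push Not at hno
  have key : ∀ j, ReflTransGen (LoopEdge Abar ι γ (L \ F)) j i → j ∈ T := by
    intro j hj
    induction hj using ReflTransGen.head_induction_on with
    | refl => exact hi
    | head hab _ ih =>
      rcases hab with hab | ⟨e', he', -, h4⟩
      · exact hT _ _ hab ih
      · exact absurd (h4 ▸ ih) (hno e' he')
  exact hno e he (key _ h2)

/-- A nonempty set of states that is closed under successors emits a surviving link. -/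
theorem exists_link_from_of_succ_closed {n : ℕ} {α β : Type} [Fintype α]
    [Fintype β] {Abar : Matrix (Fin n) (Fin n) Bool} {ι : α → Fin n} {γ : β → Fin n}
    {L F : Set (β × α)}
    (h : ¬ HasStructResilientFixedModes Abar (actuatorPattern ι) (sensorPattern γ) L {F})
    {T : Set (Fin n)} (hT : ∀ i j, Abar j i = true → i ∈ T → j ∈ T) {i : Fin n} (hi : i ∈ T) :
    ∃ e ∈ L \ F, γ e.1 ∈ T := by
  obtain ⟨e, he, h1, -⟩ := exists_link_of_not_hasStructResilientFixedModes h i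
  by_contra hno
  push Not at hno
  have key : ∀ j, ReflTransGen (LoopEdge Abar ι γ (L \ F)) i j → j ∈ T := by
    intro j hj
    induction hj with
    | refl => exact hi
    | tail _ hab ih =>
      rcases hab with hab | ⟨e', he', h3, -⟩
      · exact hT _ _ hab ih
      · exact absurd (h3 ▸ ih) (hno e' he')
  exact hno e he (key _ h1)

/-! ### One realization without fixed modes suffices -/

theorem continuous_realize {I J : Type} (P : Matrix I J Bool) :
    Continuous (realize P) := by
  refine continuous_pi fun i => continuous_pi fun j => ?_
  simp only [realize, Matrix.of_apply]
  split_ifs with h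
  · exact continuous_apply _
  · exact continuous_const

section
attribute [local instance] Matrix.linftyOpNormedRing Matrix.linftyOpNormedAlgebra

/-- One realization without fixed modes suffices: the spectra of nearby realizations lie in a
fixed disc, and by compactness of this disc the gains that move each of its points out of the
spectrum do the same for all nearby realizations. -/
theorem not_hasStructResilientFixedModes_of_exists {n : ℕ} {α β : Type} [Fintype α]
    [Fintype β] {Abar : Matrix (Fin n) (Fin n) Bool} {Bbar : Matrix (Fin n) α Bool}
    {Cbar : Matrix β (Fin n) Bool} {L F : Set (β × α)}
    (x₀ : (Free Abar → ℝ) × (Free Bbar → ℝ) × (Free Cbar → ℝ))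
    (h : ∀ lam : ℂ, ∃ K ∈ gainSet L F, lam ∉ spectrum ℂ
      ((realize Abar x₀.1 + realize Bbar x₀.2.1 * K * realize Cbar x₀.2.2).map
        (algebraMap ℝ ℂ))) :
    ¬ HasStructResilientFixedModes Abar Bbar Cbar L {F} := by
  classical
  let X := (Free Abar → ℝ) × (Free Bbar → ℝ) × (Free Cbar → ℝ)
  let M : Matrix α β ℝ → X → Matrix (Fin n) (Fin n) ℂ := fun K x =>
    (realize Abar x.1 + realize Bbar x.2.1 * K * realize Cbar x.2.2).map (algebraMap ℝ ℂ)
  have hM : ∀ K, Continuous (M K) := by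
    intro K
    refine Continuous.matrix_map ?_ Complex.continuous_ofReal
    refine ((continuous_realize Abar).comp continuous_fst).add ?_
    refine Continuous.matrix_mul (Continuous.matrix_mul ?_ continuous_const) ?_
    · exact (continuous_realize Bbar).comp (continuous_fst.comp continuous_snd)
    · exact (continuous_realize Cbar).comp (continuous_snd.comp continuous_snd)
  -- `U` consists of the complex numbers and realizations that are separated by some gain.
  let U : Set (ℂ × X) := {q | ∃ K ∈ gainSet L F,
    (algebraMap ℂ (Matrix (Fin n) (Fin n) ℂ) q.1 - M K q.2).det ≠ 0}
  have hU : IsOpen U := by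
    have : U = ⋃ K ∈ gainSet L F, {q : ℂ × X |
        (algebraMap ℂ (Matrix (Fin n) (Fin n) ℂ) q.1 - M K q.2).det ≠ 0} := by
      ext q; simp [U]
    rw [this]
    refine isOpen_biUnion fun K _ => isOpen_ne_fun ?_ continuous_const
    refine Continuous.matrix_det ?_
    exact ((continuous_algebraMap ℂ _).comp continuous_fst).sub ((hM K).comp continuous_snd)
  set ρ : ℝ := ‖M 0 x₀‖ * ‖(1 : Matrix (Fin n) (Fin n) ℂ)‖ + 1 with hρ
  have hsub : Metric.closedBall (0 : ℂ) ρ ×ˢ ({x₀} : Set X) ⊆ U := by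
    rintro ⟨lam, x⟩ ⟨-, hx⟩
    obtain rfl : x = x₀ := hx
    obtain ⟨K, hK, hlam⟩ := h lam
    refine ⟨K, hK, ?_⟩
    rwa [spectrum.mem_iff, Matrix.isUnit_iff_isUnit_det, isUnit_iff_ne_zero, not_not] at hlam
  obtain ⟨u, v, -, hv, hu, hxv, huv⟩ :=
    generalized_tube_lemma (isCompact_closedBall _ _) isCompact_singleton hU hsub
  -- The bound on `M 0` confines the common eigenvalues, which belong in particular to `K = 0`.
  let W : Set X := v ∩ {x | ‖M 0 x‖ * ‖(1 : Matrix (Fin n) (Fin n) ℂ)‖ < ρ}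
  have hW : IsOpen W := hv.inter
    (isOpen_lt ((hM 0).norm.mul continuous_const) continuous_const)
  have hxW : x₀ ∈ W := ⟨hxv rfl, by simp [hρ]⟩
  intro hae
  have hz : volume W = 0 := by
    refine measure_mono_null ?_ (ae_iff.1 hae)
    rintro x ⟨hx1, hx2⟩ ⟨lam, hlam⟩
    simp only [resilientFixedModes, Set.mem_singleton_iff, Set.iUnion_iUnion_eq_left,
      Set.mem_iInter] at hlam
    have h0 : ‖lam‖ ≤ ‖M 0 x‖ * ‖(1 : Matrix (Fin n) (Fin n) ℂ)‖ :=
      spectrum.norm_le_norm_mul_of_mem (hlam 0 fun _ _ _ => rfl)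
    have hmem : ((lam, x) : ℂ × X) ∈ U :=
      huv ⟨hu (by simpa using h0.trans (le_of_lt hx2)), hx1⟩
    obtain ⟨K, hK, hdet⟩ := hmem
    have := hlam K hK
    rw [spectrum.mem_iff, Matrix.isUnit_iff_isUnit_det, isUnit_iff_ne_zero, not_not] at this
    exact hdet this
  exact (hW.measure_pos volume ⟨x₀, hxW⟩).ne' hz

end

theorem exists_realization_of_not_hasStructResilientFixedModes {n : ℕ} {α β : Type} [Fintype α]
    [Fintype β] {Abar : Matrix (Fin n) (Fin n) Bool} {Bbar : Matrix (Fin n) α Bool}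
    {Cbar : Matrix β (Fin n) Bool} {L F : Set (β × α)}
    (h : ¬ HasStructResilientFixedModes Abar Bbar Cbar L {F}) :
    ∃ x₀ : (Free Abar → ℝ) × (Free Bbar → ℝ) × (Free Cbar → ℝ),
      ∀ lam : ℂ, ∃ K ∈ gainSet L F, lam ∉ spectrum ℂ
        ((realize Abar x₀.1 + realize Bbar x₀.2.1 * K * realize Cbar x₀.2.2).map
          (algebraMap ℝ ℂ)) := by
  by_contra hno
  push Not at hno
  refine h (Filter.Eventually.of_forall fun x => ?_)
  obtain ⟨lam, hlam⟩ := hno x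
  refine ⟨lam, ?_⟩
  simpa only [resilientFixedModes, Set.mem_singleton_iff, Set.iUnion_iUnion_eq_left,
      Set.mem_iInter] using hlam

/-! ### Matrices without left eigenvectors that vanish on a given set -/

/-- The distance from `S`: it is `0` only on `S`, and any other vertex has a predecessor at a
smaller distance. -/
theorem exists_dist_of_reachable {V : Type*} (E : V → V → Prop) (S : Set V)
    (hS : ∀ i, ∃ b ∈ S, ReflTransGen E b i) :
    ∃ d : V → ℕ, ∀ i, (d i = 0 → i ∈ S) ∧ (d i ≠ 0 → ∃ j, E j i ∧ d j < d i) := by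
  classical
  obtain ⟨P, hP0, hPs⟩ : ∃ P : ℕ → V → Prop, (∀ i, P 0 i ↔ i ∈ S) ∧
      ∀ k i, P (k + 1) i ↔ ∃ j, E j i ∧ P k j :=
    ⟨fun k => Nat.rec (fun i => i ∈ S) (fun _ Q i => ∃ j, E j i ∧ Q j) k, fun _ => Iff.rfl,
      fun _ _ => Iff.rfl⟩
  have hP : ∀ i, ∃ k, P k i := by
    intro i
    obtain ⟨b, hb, h⟩ := hS i
    induction h with
    | refl => exact ⟨0, (hP0 _).2 hb⟩
    | tail _ hbc ih =>
      obtain ⟨k, hk⟩ := ih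
      exact ⟨k + 1, (hPs _ _).2 ⟨_, hbc, hk⟩⟩
  refine ⟨fun i => Nat.find (hP i), fun i => ⟨fun h => ?_, fun h => ?_⟩⟩
  · have := Nat.find_spec (hP i)
    exact (hP0 _).1 ((show Nat.find (hP i) = 0 from h) ▸ this)
  · obtain ⟨k, hk⟩ := Nat.exists_eq_succ_of_ne_zero h
    have := Nat.find_spec (hP i)
    rw [show Nat.find (hP i) = k + 1 from hk] at this
    obtain ⟨j, hj, hkj⟩ := (hPs _ _).1 this
    exact ⟨j, hj, lt_of_le_of_lt (Nat.find_min' (hP j) hkj) (by rw [hk]; exact k.lt_succ_self)⟩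

/-- A property that passes from `i` to `σ i` for all `i ≠ j₀` on a cycle reaches `j₀`. -/
theorem _root_.Equiv.Perm.SameCycle.propagate {V : Type*} [Finite V] {σ : Equiv.Perm V}
    {P : V → Prop} {j j₀ : V} (hj : σ.SameCycle j j₀) (hP : P j)
    (hstep : ∀ i, σ.SameCycle i j₀ → i ≠ j₀ → P i → P (σ i)) : P j₀ := by
  classical
  obtain ⟨k, hk⟩ : ∃ k : ℕ, (σ ^ k) j = j₀ := by
    obtain ⟨k, hk⟩ := hj.exists_nat_pow_eq
    exact ⟨k, hk⟩
  have key : ∀ k : ℕ, ∀ j, σ.SameCycle j j₀ → P j → (σ ^ k) j = j₀ → P j₀ := by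
    intro k
    induction k with
    | zero => intro j _ hPj h; simpa using h ▸ hPj
    | succ k ih =>
      intro j hsame hPj h
      by_cases hjj : j = j₀
      · exact hjj ▸ hPj
      · refine ih (σ j) (Equiv.Perm.sameCycle_apply_left.2 hsame) (hstep j hsame hjj hPj) ?_
        rwa [pow_succ, Equiv.Perm.mul_apply] at h
  exact key k j hj hP hk

/-- The cycles of `σ` carry weights of distinct moduli, and each cycle without a vertex of `S` has
one incoming edge from a cycle that is closer to `S`. A left eigenvector is carried by a cycle and
its ancestors in this forest, and vanishes nowhere on them, hence not on the root, which meets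
`S`. -/
theorem exists_matrix_forall_eigenvector {n : ℕ} (E : Fin n → Fin n → Prop)
    (σ : Equiv.Perm (Fin n)) (hσ : ∀ j, E j (σ j)) (S : Set (Fin n))
    (hS : ∀ i, ∃ b ∈ S, ReflTransGen E b i) :
    ∃ A : Matrix (Fin n) (Fin n) ℝ, (∀ i j, A i j ≠ 0 → E j i) ∧
      ∀ (lam : ℂ) (x : Fin n → ℂ), x ≠ 0 →
        Matrix.vecMul x (A.map (algebraMap ℝ ℂ)) = lam • x → ∃ b ∈ S, x b ≠ 0 := by
  classical
  obtain ⟨d, hd⟩ := exists_dist_of_reachable E S hS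
  let Q := Quotient (Equiv.Perm.SameCycle.setoid σ)
  have : Fintype Q := Fintype.ofFinite Q
  let cl : Fin n → Q := fun i => Quotient.mk _ i
  have hcl : ∀ i j, cl i = cl j ↔ σ.SameCycle i j := fun i j => Quotient.eq
  have hclσ : ∀ i, cl (σ i) = cl i := fun i =>
    (hcl _ _).2 (Equiv.Perm.sameCycle_apply_left.2 (Equiv.Perm.SameCycle.refl _ _))
  have hv : ∀ q : Q, ∃ v, cl v = q ∧ ∀ v', cl v' = q → d v ≤ d v' := by
    intro q
    obtain ⟨i, rfl⟩ := Quotient.exists_rep q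
    obtain ⟨v, hv1, hv2⟩ := Finset.exists_min_image
      (Finset.univ.filter fun v => cl v = cl i) d ⟨i, by simp⟩
    exact ⟨v, by simpa using hv1, fun v' hv' => hv2 v' (by simpa using hv')⟩
  -- `Q` is the set of cycles of `σ`. The cycle `q` is entered at its vertex `v q` closest to `S`,
  -- by an edge from the vertex `u q` of the cycle `par q`, unless `v q` is in `S` (`D q = 0`).
  choose v hvcl hvmin using hv
  let D : Q → ℕ := fun q => d (v q)
  have hu : ∀ q : Q, ∃ u, (D q ≠ 0 → E u (v q) ∧ D (cl u) < D q) ∧ (D q = 0 → cl u = q) := by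
    intro q
    by_cases h : D q = 0
    · exact ⟨v q, fun h' => absurd h h', fun _ => hvcl q⟩
    · obtain ⟨u, hu1, hu2⟩ := (hd (v q)).2 h
      exact ⟨u, fun _ => ⟨hu1, (hvmin _ u rfl).trans_lt hu2⟩, fun h' => absurd h' h⟩
  choose u hu1 hu2 using hu
  let par : Q → Q := fun q => cl (u q)
  let w : Q → ℝ := fun q => (Fintype.equivFin Q q : ℕ) + 1
  have hwpos : ∀ q, 0 < w q := fun q => by positivity
  have hwinj : Function.Injective w := by
    intro a b hab
    apply (Fintype.equivFin Q).injective
    apply Fin.ext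
    simpa [w] using hab
  let A : Matrix (Fin n) (Fin n) ℝ := Matrix.of fun i j =>
    (if i = σ j then w (cl j) else 0) +
      ∑ q : Q, if D q ≠ 0 ∧ i = v q ∧ j = u q then 1 else 0
  refine ⟨A, ?_, ?_⟩
  · intro i j hij
    by_contra hE
    apply hij
    have h1 : i ≠ σ j := by rintro rfl; exact hE (hσ j)
    simp only [A, Matrix.of_apply, if_neg h1, zero_add]
    refine Finset.sum_eq_zero fun q _ => if_neg ?_
    rintro ⟨h2, rfl, rfl⟩
    exact hE (hu1 q h2).1
  intro lam x hx hxA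
  have heq : ∀ j, (w (cl j) : ℂ) * x (σ j) +
      ∑ q : Q, (if D q ≠ 0 ∧ u q = j then x (v q) else 0) = lam * x j := by
    intro j
    have := congrFun hxA j
    simp only [Pi.smul_apply, smul_eq_mul] at this
    rw [← this]
    simp only [Matrix.vecMul, dotProduct, Matrix.map_apply, A, Matrix.of_apply, map_add, mul_add,
      Finset.sum_add_distrib, map_sum, Finset.mul_sum]
    congr 1
    · rw [Finset.sum_eq_single (σ j)]
      · simp [mul_comm]
      · intro i _ hi; simp [hi]
      · simp
    · rw [Finset.sum_comm]
      refine Finset.sum_congr rfl fun q _ => ?_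
      rw [Finset.sum_eq_single (v q)]
      · by_cases h : D q ≠ 0 ∧ u q = j
        · simp [h]
        · rw [if_neg h, if_neg (by rintro ⟨a, -, b⟩; exact h ⟨a, b.symm⟩)]; simp
      · intro i _ hi; simp [hi]
      · simp
  -- `NZ q`: the eigenvector does not vanish on the cycle `q`. If it vanishes on all children of
  -- `q`, then the eigenvalue has the modulus `w q`, which determines `q`.
  let NZ : Q → Prop := fun q => ∃ j, cl j = q ∧ x j ≠ 0
  have hleaf : ∀ q, NZ q → (∀ q', D q' ≠ 0 → par q' = q → ¬ NZ q') →
      ‖lam‖ = w q ∧ ∀ j, cl j = q → x j ≠ 0 := by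
    rintro q ⟨j₁, hj₁, hxj₁⟩ hch
    have h1 : ∀ j, cl j = q → (w q : ℂ) * x (σ j) = lam * x j := by
      intro j hj
      rw [← heq j, hj, Finset.sum_eq_zero, add_zero]
      intro q' _
      split_ifs with h
      · by_contra hne
        exact hch q' h.1 (by simp only [par, h.2, hj]) ⟨_, hvcl q', hne⟩
      · rfl
    have h2 : ∀ j, cl j = q → w q * ‖x (σ j)‖ = ‖lam‖ * ‖x j‖ := by
      intro j hj
      have := congrArg norm (h1 j hj)
      rwa [norm_mul, norm_mul, Complex.norm_real, Real.norm_of_nonneg (hwpos q).le] at this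
    set s := Finset.univ.filter fun j => cl j = q
    have h3 : ∑ j ∈ s, ‖x (σ j)‖ = ∑ j ∈ s, ‖x j‖ := by
      refine Finset.sum_equiv σ (fun i => ?_) fun i _ => rfl
      simp [s, hclσ]
    have h4 : 0 < ∑ j ∈ s, ‖x j‖ :=
      Finset.sum_pos' (fun _ _ => norm_nonneg _) ⟨j₁, by simp [s, hj₁], norm_pos_iff.2 hxj₁⟩
    have h5 : w q * ∑ j ∈ s, ‖x j‖ = ‖lam‖ * ∑ j ∈ s, ‖x j‖ := by
      conv_lhs => rw [← h3]
      rw [Finset.mul_sum, Finset.mul_sum]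
      exact Finset.sum_congr rfl fun j hj => h2 j (by simpa [s] using hj)
    have h6 : ‖lam‖ = w q := (mul_right_cancel₀ h4.ne' h5).symm
    refine ⟨h6, fun j hj => ?_⟩
    refine Equiv.Perm.SameCycle.propagate (σ := σ) (P := fun i => x i ≠ 0) (j := j₁) (j₀ := j)
      ((hcl _ _).1 (hj₁.trans hj.symm)) hxj₁ fun i hi _ hxi => ?_
    have hiq : cl i = q := ((hcl _ _).2 hi).trans hj
    have := h2 i hiq
    rw [h6] at this
    have := mul_left_cancel₀ (hwpos q).ne' this
    rw [← norm_pos_iff, this]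
    exact norm_pos_iff.2 hxi
  obtain ⟨j₁, hj₁⟩ := Function.ne_iff.1 hx
  obtain ⟨q₀, hq₀, hmax⟩ := Finset.exists_max_image (Finset.univ.filter NZ) D
    ⟨cl j₁, by simpa using ⟨j₁, rfl, hj₁⟩⟩
  simp only [Finset.mem_filter, Finset.mem_univ, true_and] at hq₀ hmax
  -- Let `q₀` be a cycle of maximal depth on which the eigenvector does not vanish. All others on
  -- which it does not vanish are ancestors of `q₀`, as a descent from them ends in `q₀`.
  have hparD : ∀ q, D q ≠ 0 → D (par q) < D q := fun q h => (hu1 q h).2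
  have hpar0 : ∀ q, D q = 0 → par q = q := fun q h => hu2 q h
  have hparle : ∀ q, D (par q) ≤ D q := fun q => by
    by_cases h : D q = 0
    · rw [hpar0 q h]
    · exact (hparD q h).le
  have hiterle : ∀ k q, D (par^[k] q) ≤ D q := by
    intro k
    induction k with
    | zero => intro q; exact le_rfl
    | succ k ih => intro q; exact (ih (par q)).trans (hparle q)
  obtain ⟨hlam0, hall0⟩ := hleaf q₀ hq₀ fun q' h1 h2 h3 =>
    absurd (hmax q' h3) (not_le.2 (h2 ▸ hparD q' h1))
  have hchain : ∀ m q, D q₀ - D q = m → NZ q → ∃ k, par^[k] q₀ = q := by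
    intro m
    induction m using Nat.strong_induction_on with
    | _ m ih =>
      intro q hm hq
      by_cases hqq : q = q₀
      · exact ⟨0, hqq.symm⟩
      · by_cases hch : ∀ q', D q' ≠ 0 → par q' = q → ¬ NZ q'
        · exact absurd (hwinj ((hleaf q hq hch).1.symm.trans hlam0)) hqq
        · push Not at hch
          obtain ⟨q', h1, h2, h3⟩ := hch
          have h4 := hparD q' h1
          have h5 := hmax q' h3
          rw [h2] at h4
          obtain ⟨k, hk⟩ := ih (D q₀ - D q') (by omega) q' rfl h3
          exact ⟨k + 1, by rw [Function.iterate_succ_apply', hk, h2]⟩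
  -- An ancestor of `q₀` has a single child among the ancestors of `q₀`.
  have huniq : ∀ k a q' q'', par^[k] q₀ = q' → par^[a] q₀ = q'' → D q' ≠ 0 → D q'' ≠ 0 →
      par q' = par q'' → q' = q'' := by
    have aux : ∀ k a, a < k → D (par^[k] q₀) ≠ 0 → D (par^[a] q₀) ≠ 0 →
        par (par^[k] q₀) = par (par^[a] q₀) → False := by
      intro k a hak h1 h2 h3
      have h4 : par^[k] q₀ = par^[k - a - 1] (par (par^[a] q₀)) := by
        rw [← Function.iterate_succ_apply' par a, ← Function.iterate_add_apply]
        congr 2; omega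
      have h5 := hiterle (k - a - 1) (par (par^[a] q₀))
      rw [← h4, ← h3] at h5
      exact absurd (hparD _ h1) (not_lt.2 h5)
    rintro k a q' q'' rfl rfl h1 h2 h3
    rcases lt_trichotomy a k with h | h | h
    · exact (aux k a h h1 h2 h3).elim
    · rw [h]
    · exact (aux a k h h2 h1 h3.symm).elim
  have hlamne : lam ≠ 0 := by
    rw [← norm_pos_iff, hlam0]; exact hwpos _
  -- On an ancestor, the contribution of this child enters at one vertex of the cycle. A zero of the
  -- eigenvector would propagate to this vertex, and a nonzero value from its successor as well.
  have hall : ∀ k, ∀ j, cl j = par^[k] q₀ → x j ≠ 0 := by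
    intro k
    induction k with
    | zero => exact hall0
    | succ k ih =>
      by_cases hD : D (par^[k] q₀) = 0
      · rwa [Function.iterate_succ_apply', hpar0 _ hD]
      · rw [Function.iterate_succ_apply']
        set q' := par^[k] q₀ with hq'
        have hxv : x (v q') ≠ 0 := ih _ (hvcl q')
        have heq' : ∀ j, cl j = par q' → (w (par q') : ℂ) * x (σ j) +
            (if u q' = j then x (v q') else 0) = lam * x j := by
          intro j hj
          rw [← heq j, hj]
          congr 1
          rw [Finset.sum_eq_single q']
          · simp [hD]
          · intro q'' _ hne
            split_ifs with h
            · by_contra hne0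
              have hz : NZ q'' := ⟨_, hvcl q'', hne0⟩
              obtain ⟨a, ha⟩ := hchain _ q'' rfl hz
              exact hne (huniq a k q'' q' ha hq'.symm h.1 hD
                (by rw [← hj, ← h.2]))
            · rfl
          · simp
        have hw0 : (w (par q') : ℂ) ≠ 0 := by exact_mod_cast (hwpos _).ne'
        intro j hj hxj
        have hstep : ∀ i, σ.SameCycle i (u q') → i ≠ u q' →
            (w (par q') : ℂ) * x (σ i) = lam * x i := by
          intro i hi hne
          have := heq' i ((hcl _ _).2 hi)
          rwa [if_neg hne.symm, add_zero] at this
        have hsame : σ.SameCycle j (u q') := (hcl _ _).1 hj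
        have h0 : x (u q') = 0 := hsame.propagate (P := fun i => x i = 0) hxj
          fun i hi hne h => by
            have := hstep i hi hne
            rw [h, mul_zero] at this
            exact (mul_eq_zero.1 this).resolve_left hw0
        have h1 : x (σ (u q')) ≠ 0 := by
          intro h
          have := heq' (u q') rfl
          rw [h, h0, if_pos rfl, mul_zero, mul_zero, zero_add] at this
          exact hxv this
        refine (Equiv.Perm.SameCycle.propagate (σ := σ) (P := fun i => x i ≠ 0)
          (Equiv.Perm.sameCycle_apply_left.2 (Equiv.Perm.SameCycle.refl σ (u q'))) h1
          fun i hi hne h => ?_) h0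
        intro h2
        have := hstep i hi hne
        rw [h2, mul_zero] at this
        exact mul_ne_zero hlamne h this.symm
  have hroot : ∀ m q, D q = m → ∃ k, D (par^[k] q) = 0 := by
    intro m
    induction m using Nat.strong_induction_on with
    | _ m ih =>
      intro q hm
      by_cases h : D q = 0
      · exact ⟨0, h⟩
      · obtain ⟨k, hk⟩ := ih _ (hm ▸ hparD q h) (par q) rfl
        exact ⟨k + 1, hk⟩
  obtain ⟨k, hk⟩ := hroot _ q₀ rfl
  exact ⟨v (par^[k] q₀), (hd _).1 hk, hall k _ (hvcl _)⟩

/-! ### Controllability and Krylov determinants -/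

/-- The Popov–Belevitch–Hautus criterion: a nonzero vector annihilated by all `AᵏB`, `k < n`,
yields a left eigenvector of `A` annihilated by `B`. -/
theorem eq_zero_of_forall_vecMul_eq_zero {n : ℕ} {α : Type} (A : Matrix (Fin n) (Fin n) ℝ)
    (B : Matrix (Fin n) α ℝ)
    (h : ∀ (lam : ℂ) (x : Fin n → ℂ), x ≠ 0 →
      Matrix.vecMul x (A.map (algebraMap ℝ ℂ)) = lam • x →
      Matrix.vecMul x (B.map (algebraMap ℝ ℂ)) ≠ 0)
    (y : Fin n → ℝ) (hy : ∀ k < n, Matrix.vecMul y (A ^ k * B) = 0) : y = 0 := by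
  by_contra hy0
  have hall : ∀ k, Matrix.vecMul y (A ^ k * B) = 0 := by
    intro k
    have hn : 0 < n := by
      rcases Nat.eq_zero_or_pos n with rfl | h
      · exact absurd (Subsingleton.elim y 0) hy0
      · exact h
    have : NeZero n := ⟨hn.ne'⟩
    have hdeg : (Polynomial.X ^ k %ₘ A.charpoly).natDegree < n := by
      have h1 := Polynomial.natDegree_modByMonic_lt (Polynomial.X ^ k) A.charpoly_monic
        (by
          intro h1
          have h2 := A.charpoly_natDegree_eq_dim
          rw [h1, Polynomial.natDegree_one, Fintype.card_fin] at h2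
          omega)
      rwa [A.charpoly_natDegree_eq_dim, Fintype.card_fin] at h1
    rw [Matrix.pow_eq_aeval_mod_charpoly A k, Polynomial.aeval_eq_sum_range' hdeg,
      Matrix.sum_mul]
    have : ∀ (s : Finset ℕ) (f : ℕ → Matrix (Fin n) α ℝ), (∀ k ∈ s, Matrix.vecMul y (f k) = 0) →
        Matrix.vecMul y (∑ k ∈ s, f k) = 0 := by
      intro s f hf
      classical
      induction s using Finset.induction_on with
      | empty => simp
      | insert a s ha ih =>
        rw [Finset.sum_insert ha, Matrix.vecMul_add, hf a (Finset.mem_insert_self _ _),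
          ih fun k hk => hf k (Finset.mem_insert_of_mem hk), add_zero]
    refine this _ _ fun j hj => ?_
    rw [Matrix.smul_mul, Matrix.vecMul_smul, hy j (Finset.mem_range.1 hj), smul_zero]
  let Ac := A.map (algebraMap ℝ ℂ)
  let W : Submodule ℂ (Fin n → ℂ) :=
    { carrier := {x | ∀ k, Matrix.vecMul x ((A ^ k * B).map (algebraMap ℝ ℂ)) = 0}
      add_mem' := fun {a b} ha hb k => by rw [Matrix.add_vecMul, ha k, hb k, add_zero]
      zero_mem' := fun k => Matrix.zero_vecMul _
      smul_mem' := fun c a ha k => by rw [Matrix.smul_vecMul, ha k, smul_zero] }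
  have hW : ∀ x ∈ W, Ac.vecMulLinear x ∈ W := by
    intro x hx k
    rw [Matrix.vecMulLinear_apply, Matrix.vecMul_vecMul, ← Matrix.map_mul, ← Matrix.mul_assoc,
      ← pow_succ']
    exact hx (k + 1)
  have hyW : (fun i => (y i : ℂ)) ∈ W := by
    intro k
    ext j
    have := congrFun (hall k) j
    simp only [Matrix.vecMul, dotProduct, Pi.zero_apply, Matrix.map_apply] at this ⊢
    have h2 := congrArg (algebraMap ℝ ℂ) this
    simpa using h2
  have hnt : Nontrivial W := by
    refine ⟨⟨⟨_, hyW⟩, 0, fun h0 => hy0 ?_⟩⟩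
    ext i
    have := congrFun (congrArg Subtype.val h0) i
    simpa using this
  obtain ⟨lam, hlam⟩ := Module.End.exists_eigenvalue (Ac.vecMulLinear.restrict hW)
  obtain ⟨⟨x, hxW⟩, hx⟩ := hlam.exists_hasEigenvector
  have hx1 := hx.apply_eq_smul
  have hx2 : x ≠ 0 := fun h0 => hx.2 (Subtype.ext h0)
  refine h lam x hx2 (congrArg Subtype.val hx1) ?_
  have := hxW 0
  rwa [pow_zero, Matrix.one_mul] at this

theorem controllable_of_forall_eigenvector {n : ℕ} {α : Type} [Fintype α]
    (A : Matrix (Fin n) (Fin n) ℝ) (B : Matrix (Fin n) α ℝ)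
    (h : ∀ (lam : ℂ) (x : Fin n → ℂ), x ≠ 0 →
      Matrix.vecMul x (A.map (algebraMap ℝ ℂ)) = lam • x →
      Matrix.vecMul x (B.map (algebraMap ℝ ℂ)) ≠ 0) : Controllable A B := by
  have key := eq_zero_of_forall_vecMul_eq_zero A B h
  unfold Controllable
  rw [LinearIndependent.rank_matrix, Fintype.card_fin]
  rw [← Matrix.vecMul_injective_iff]
  intro y z hyz
  rw [← sub_eq_zero]
  refine key _ fun k hk => ?_
  ext a
  have h1 := congrFun hyz (⟨k, hk⟩, a)
  simp only [Matrix.vecMul, dotProduct, Matrix.of_apply] at h1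
  simp only [Matrix.vecMul, dotProduct, Pi.sub_apply, sub_mul, Finset.sum_sub_distrib, h1,
    sub_self, Pi.zero_apply]

/-- The Krylov matrix of `A` and the `j`-th unit vector. -/
def krylov {R : Type*} [CommRing R] {n : ℕ} (A : Matrix (Fin n) (Fin n) R) (j : Fin n) :
    Matrix (Fin n) (Fin n) R :=
  Matrix.of fun i k => (A ^ (k : ℕ)) i j

theorem det_krylov_map {R S : Type*} [CommRing R] [CommRing S] (f : R →+* S) {n : ℕ}
    (A : Matrix (Fin n) (Fin n) R) (j : Fin n) :
    (krylov (A.map f) j).det = f (krylov A j).det := by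
  rw [RingHom.map_det]
  congr 1
  ext i k
  have := map_pow f.mapMatrix A (k : ℕ)
  simp only [RingHom.mapMatrix_apply] at this
  simp [krylov, ← this]

/-- The Krylov matrix is invertible iff no left eigenvector vanishes at `j`. -/
theorem det_krylov_ne_zero_iff {n : ℕ} (A : Matrix (Fin n) (Fin n) ℝ) (j : Fin n) :
    (krylov A j).det ≠ 0 ↔ ∀ (lam : ℂ) (x : Fin n → ℂ), x ≠ 0 →
      Matrix.vecMul x (A.map (algebraMap ℝ ℂ)) = lam • x → x j ≠ 0 := by
  constructor
  · intro hdet lam x hx hxA hxj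
    have h1 : (krylov (A.map (algebraMap ℝ ℂ)) j).det ≠ 0 := by
      rw [det_krylov_map]
      simpa using hdet
    apply h1
    rw [← Matrix.exists_vecMul_eq_zero_iff]
    refine ⟨x, hx, ?_⟩
    have hpow : ∀ k : ℕ, Matrix.vecMul x ((A.map (algebraMap ℝ ℂ)) ^ k) = lam ^ k • x := by
      intro k
      induction k with
      | zero => simp
      | succ k ih =>
        rw [pow_succ, ← Matrix.vecMul_vecMul, ih, Matrix.smul_vecMul, hxA, smul_smul, pow_succ]
    ext k
    have := congrFun (hpow k) j
    simp only [Pi.smul_apply, hxj, smul_zero] at this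
    exact this
  · intro h hdet
    obtain ⟨y, hy, hyA⟩ := Matrix.exists_vecMul_eq_zero_iff.2 hdet
    refine hy (eq_zero_of_forall_vecMul_eq_zero A
      (Matrix.of fun i (_ : Unit) => if i = j then 1 else 0) ?_ y ?_)
    · intro lam x hx hxA h0
      refine h lam x hx hxA ?_
      have := congrFun h0 ()
      simp only [Matrix.vecMul, dotProduct, Matrix.map_apply, Matrix.of_apply] at this
      rwa [Finset.sum_eq_single j (fun i _ hi => by simp [hi]) (by simp), if_pos rfl, map_one,
        mul_one] at this
    · intro k hk
      ext u
      have := congrFun hyA ⟨k, hk⟩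
      simpa [Matrix.vecMul, dotProduct, krylov, Matrix.mul_apply] using this

/-- A line that meets the complements of the zero sets of two Krylov determinants has a point in
both: on the line, the determinants are nonzero polynomials. -/
theorem exists_pencil_krylov {n : ℕ} (A₁ A₂ : Matrix (Fin n) (Fin n) ℝ) (i j : Fin n)
    (h₁ : (krylov A₁ i).det ≠ 0) (h₂ : (krylov A₂.transpose j).det ≠ 0) :
    ∃ t : ℝ, (krylov (A₁ + t • (A₂ - A₁)) i).det ≠ 0 ∧
      (krylov (A₁ + t • (A₂ - A₁)).transpose j).det ≠ 0 := by
  let M : Matrix (Fin n) (Fin n) (Polynomial ℝ) :=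
    A₁.map Polynomial.C + (Polynomial.X : Polynomial ℝ) • (A₂ - A₁).map Polynomial.C
  have hM : ∀ t, M.map (Polynomial.evalRingHom t) = A₁ + t • (A₂ - A₁) := by
    intro t; ext a b; simp [M]
  have hMt : ∀ t, M.transpose.map (Polynomial.evalRingHom t) =
      (A₁ + t • (A₂ - A₁)).transpose := by
    intro t; rw [← hM]; rfl
  let f := (krylov M i).det * (krylov M.transpose j).det
  have hf : f ≠ 0 := by
    refine mul_ne_zero (fun h => h₁ ?_) (fun h => h₂ ?_)
    · have := det_krylov_map (Polynomial.evalRingHom (0 : ℝ)) M i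
      rw [hM, h, map_zero] at this
      simpa using this
    · have := det_krylov_map (Polynomial.evalRingHom (1 : ℝ)) M.transpose j
      rw [hMt, h, map_zero] at this
      simpa using this
  obtain ⟨t, ht⟩ : ∃ t, f.eval t ≠ 0 := by
    by_contra hno
    push Not at hno
    exact hf (Polynomial.funext fun t => by simp [hno t])
  refine ⟨t, ?_, ?_⟩
  · rw [← hM, det_krylov_map]
    intro h
    apply ht
    simp only [Polynomial.coe_evalRingHom] at h
    simp [f, h]
  · rw [← hMt, det_krylov_map]
    intro h
    apply ht
    simp only [Polynomial.coe_evalRingHom] at h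
    simp [f, h]

/-! ### Strongly connected closed loops have no fixed modes -/

theorem StatePerfectMatching.exists_perm {n : ℕ} {Abar : Matrix (Fin n) (Fin n) Bool}
    (h : StatePerfectMatching Abar) : ∃ σ : Equiv.Perm (Fin n), ∀ j, Abar (σ j) j = true := by
  obtain ⟨M, ⟨hME, hM⟩, hl, -⟩ := h
  choose f hf using hl
  have hinj : Function.Injective f := by
    intro i j hij
    exact congrArg Prod.fst (hM _ (hf i) _ (hf j) (Or.inr hij))
  exact ⟨Equiv.ofBijective f (Finite.injective_iff_bijective.1 hinj), fun j => hME _ (hf j)⟩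

/-- The free parameters of the pattern `P` read off from a matrix. -/
def paramsOf {I J : Type} (P : Matrix I J Bool) (M : Matrix I J ℝ) : Free P → ℝ :=
  fun e => M e.1.1 e.1.2

theorem realize_paramsOf {I J : Type} {P : Matrix I J Bool} {M : Matrix I J ℝ}
    (h : ∀ i j, M i j ≠ 0 → P i j = true) : realize P (paramsOf P M) = M := by
  ext i j
  simp only [realize, Matrix.of_apply, paramsOf]
  split_ifs with hP
  · rfl
  · by_contra hne
    exact hP (h i j (Ne.symm hne))

/-- With unit input and output gains, every matrix supported on the positions of the links has the
form `B * K * C`. -/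
theorem exists_gain_eq {n : ℕ} {α β : Type} [Fintype α] [Fintype β] {ι : α → Fin n}
    {γ : β → Fin n} {L F : Set (β × α)} (M : Matrix (Fin n) (Fin n) ℝ)
    (hM : ∀ i j, M i j ≠ 0 → ∃ e ∈ L \ F, γ e.1 = j ∧ ι e.2 = i) :
    ∃ K ∈ gainSet L F, realize (actuatorPattern ι) (fun _ => 1) * K *
      realize (sensorPattern γ) (fun _ => 1) = M := by
  classical
  have h' : ∀ i j, ∃ e : β × α → Prop, M i j ≠ 0 →
      ∃ e₀ ∈ L \ F, γ e₀.1 = j ∧ ι e₀.2 = i ∧ e = (· = e₀) := by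
    intro i j
    by_cases h : M i j ≠ 0
    · obtain ⟨e, he, h1, h2⟩ := hM i j h
      exact ⟨(· = e), fun _ => ⟨e, he, h1, h2, rfl⟩⟩
    · exact ⟨fun _ => True, fun h' => absurd h' h⟩
  choose ch hch using h'
  let K : Matrix α β ℝ := Matrix.of fun a c => if ch (ι a) (γ c) (c, a) then M (ι a) (γ c) else 0
  refine ⟨K, ?_, ?_⟩
  · intro a c hac
    by_contra hne
    have h1 : ch (ι a) (γ c) (c, a) ∧ M (ι a) (γ c) ≠ 0 := by
      by_contra hno
      apply hne
      simp only [K, Matrix.of_apply]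
      split_ifs with h
      · by_contra h2; exact hno ⟨h, h2⟩
      · rfl
    obtain ⟨e, he, -, -, h4⟩ := hch _ _ h1.2
    have h5 := h1.1
    rw [h4] at h5
    rw [h5] at hac
    rcases hac with hac | hac
    · exact hac he.1
    · exact he.2 hac
  · ext i j
    have hent : (realize (actuatorPattern ι) (fun _ => 1) * K *
      realize (sensorPattern γ) (fun _ => 1)) i j =
        ∑ q : β × α, if ι q.2 = i ∧ γ q.1 = j then K q.2 q.1 else 0 := by
      rw [Matrix.mul_apply, Fintype.sum_prod_type]
      refine Finset.sum_congr rfl fun c _ => ?_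
      rw [Matrix.mul_apply, Finset.sum_mul]
      refine Finset.sum_congr rfl fun a _ => ?_
      simp only [realize, actuatorPattern, sensorPattern, Matrix.of_apply, decide_eq_true_eq]
      by_cases ha : ι a = i <;> by_cases hc : γ c = j <;> simp [ha, hc]
    rw [hent]
    by_cases h : M i j ≠ 0
    · obtain ⟨e, he, h1, h2, h3⟩ := hch i j h
      rw [Finset.sum_eq_single e]
      · simp only [K, Matrix.of_apply, h1, h2, and_self, if_true, h3, Prod.mk.eta]
      · rintro ⟨c, a⟩ - hne
        split_ifs with h4
        · simp only [K, Matrix.of_apply]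
          simp only at h4
          rw [h4.1, h4.2, h3, if_neg hne]
        · rfl
      · simp
    · rw [not_not] at h
      rw [h]
      refine Finset.sum_eq_zero fun q _ => ?_
      split_ifs with h4
      · simp only [K, Matrix.of_apply, h4.1, h4.2, h, ite_self]
      · rfl

/-- If the closed loop is strongly connected and has a link, then the gains can be chosen so that
the closed-loop matrix is controllable from the end and observable from the start of this link;
the link alone then moves every eigenvalue. -/
theorem not_hasStructResilientFixedModes_of_strongly_connected {n : ℕ} {α β : Type} [Fintype α]
    [Fintype β] {Abar : Matrix (Fin n) (Fin n) Bool} {ι : α → Fin n} {γ : β → Fin n}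
    {L F : Set (β × α)} (hA : StatePerfectMatching Abar)
    (hconn : ∀ i j, ReflTransGen (LoopEdge Abar ι γ (L \ F)) i j)
    (hlink : Nonempty (Fin n) → (L \ F).Nonempty) :
    ¬ HasStructResilientFixedModes Abar (actuatorPattern ι) (sensorPattern γ) L {F} := by
  classical
  rcases isEmpty_or_nonempty (Fin n) with hn | hn
  · apply not_hasStructResilientFixedModes_of_exists ⟨fun _ => 0, fun _ => 0, fun _ => 0⟩
    intro lam
    refine ⟨0, fun _ _ _ => rfl, ?_⟩
    rw [spectrum.of_subsingleton]
    exact Set.notMem_empty _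
  obtain ⟨e₀, he₀⟩ := hlink hn
  set i₀ := ι e₀.2
  set j₀ := γ e₀.1
  obtain ⟨σ, hσ⟩ := hA.exists_perm
  set E := LoopEdge Abar ι γ (L \ F) with hE
  obtain ⟨A₁, hA₁, hc₁⟩ := exists_matrix_forall_eigenvector E σ (fun j => Or.inl (hσ j)) {i₀}
    fun i => ⟨i₀, rfl, hconn _ _⟩
  obtain ⟨A₂, hA₂, hc₂⟩ := exists_matrix_forall_eigenvector (Function.swap E) σ.symm
    (fun j => Or.inl (by simpa using hσ (σ.symm j))) {j₀}
    fun i => ⟨j₀, rfl, reflTransGen_swap.2 (hconn _ _)⟩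
  obtain ⟨t, ht₁, ht₂⟩ := exists_pencil_krylov A₁ A₂.transpose i₀ j₀
    ((det_krylov_ne_zero_iff _ _).2 fun lam x hx hxA => by
      obtain ⟨b, hb, hxb⟩ := hc₁ lam x hx hxA
      rwa [Set.mem_singleton_iff.1 hb] at hxb)
    ((det_krylov_ne_zero_iff _ _).2 fun lam x hx hxA => by
      obtain ⟨b, hb, hxb⟩ := hc₂ lam x hx hxA
      rwa [Set.mem_singleton_iff.1 hb] at hxb)
  set A := A₁ + t • (A₂.transpose - A₁) with hAdef
  rw [det_krylov_ne_zero_iff] at ht₁ ht₂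
  have hAE : ∀ i j, A i j ≠ 0 → E j i := by
    intro i j hij
    by_contra hno
    apply hij
    have h1 : A₁ i j = 0 := by by_contra h; exact hno (hA₁ i j h)
    have h2 : A₂ j i = 0 := by by_contra h; exact hno (hA₂ j i h)
    simp [hAdef, h1, h2]
  -- The entries of `A` on state edges are free parameters, the others are realized by gains.
  let As : Matrix (Fin n) (Fin n) ℝ := Matrix.of fun i j => if Abar i j = true then A i j else 0
  let Al : Matrix (Fin n) (Fin n) ℝ := Matrix.of fun i j => if Abar i j = true then 0 else A i j
  have hsplit : As + Al = A := by
    ext i j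
    simp only [As, Al, Matrix.add_apply, Matrix.of_apply]
    split_ifs <;> simp
  have hAl : ∀ i j, Al i j ≠ 0 → ∃ e ∈ L \ F, γ e.1 = j ∧ ι e.2 = i := by
    intro i j hij
    simp only [Al, Matrix.of_apply] at hij
    split_ifs at hij with h
    · exact absurd rfl hij
    · exact (hAE i j hij).resolve_left h
  have hAs : realize Abar (paramsOf Abar As) = As := by
    refine realize_paramsOf fun i j hij => ?_
    simp only [As, Matrix.of_apply] at hij
    split_ifs at hij with h
    · exact h
    · exact absurd rfl hij
  obtain ⟨K₀, hK₀, hK₀e⟩ := exists_gain_eq Al hAl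
  obtain ⟨K₁, hK₁, hK₁e⟩ := exists_gain_eq (Al + Matrix.single i₀ j₀ 1) (L := L) (F := F) (ι := ι)
    (γ := γ) (by
      intro i j hij
      by_cases h : Al i j ≠ 0
      · exact hAl i j h
      · rw [not_not] at h
        rw [Matrix.add_apply, h, zero_add, Matrix.single_apply] at hij
        split_ifs at hij with h2
        · exact ⟨e₀, he₀, h2.2, h2.1⟩
        · exact absurd rfl hij)
  apply not_hasStructResilientFixedModes_of_exists
    ⟨paramsOf Abar As, fun _ => 1, fun _ => 1⟩
  intro lam
  by_cases hlam : lam ∈ spectrum ℂ (A.map (algebraMap ℝ ℂ))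
  swap
  · refine ⟨K₀, hK₀, ?_⟩
    simp only
    rwa [hAs, hK₀e, hsplit]
  -- At an eigenvalue `lam` of `A`, the gain `K₁` adds a matrix unit `e` at the position of the
  -- link. If `lam` were an eigenvalue of `A + e` with right eigenvector `x`, multiplication by a
  -- left eigenvector `w` of `A` would give `w i₀ * x j₀ = 0`.
  refine ⟨K₁, hK₁, ?_⟩
  simp only
  rw [hAs, hK₁e, ← add_assoc, hsplit]
  rw [spectrum.mem_iff, Matrix.isUnit_iff_isUnit_det, isUnit_iff_ne_zero, not_not] at hlam ⊢
  intro hdet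
  obtain ⟨w, hw0, hw⟩ := Matrix.exists_vecMul_eq_zero_iff.2 hlam
  obtain ⟨x, hx0, hx⟩ := Matrix.exists_mulVec_eq_zero_iff.2 hdet
  have hmap : (A + Matrix.single i₀ j₀ 1).map (algebraMap ℝ ℂ) =
      A.map (algebraMap ℝ ℂ) + Matrix.single i₀ j₀ 1 := by
    ext i j
    simp only [Matrix.map_apply, Matrix.add_apply, map_add, Matrix.single_apply]
    split_ifs <;> simp
  rw [hmap, sub_add_eq_sub_sub, Matrix.sub_mulVec, sub_eq_zero] at hx
  have hwi : w i₀ ≠ 0 := by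
    refine ht₁ lam w hw0 ?_
    rw [Matrix.vecMul_sub, sub_eq_zero] at hw
    rw [← hw, Algebra.algebraMap_eq_smul_one, Matrix.vecMul_smul, Matrix.vecMul_one]
  have hxj : x j₀ = 0 := by
    have h1 := congrArg (fun z => w ⬝ᵥ z) hx
    rw [Matrix.dotProduct_mulVec, hw, zero_dotProduct, Matrix.single_mulVec, one_mul] at h1
    have h2 : w ⬝ᵥ Function.update 0 i₀ (x j₀) = w i₀ * x j₀ := by
      rw [dotProduct, Finset.sum_eq_single i₀]
      · simp
      · intro i _ hi; simp [hi]
      · simp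
    rw [h2] at h1
    exact (mul_eq_zero.1 h1.symm).resolve_left hwi
  refine ht₂ lam x hx0 ?_ hxj
  have h1 : Matrix.mulVec (Matrix.single i₀ j₀ (1 : ℂ)) x = 0 := by
    rw [Matrix.single_mulVec]
    simp [hxj]
  rw [h1, Matrix.sub_mulVec, sub_eq_zero] at hx
  rw [Matrix.transpose_map, Matrix.vecMul_transpose, ← hx, Algebra.algebraMap_eq_smul_one,
    Matrix.smul_mulVec, Matrix.one_mulVec]

/-! ### Structural controllability and reachability -/

/-- The edge relation of the state digraph. -/
def StateEdge {n : ℕ} (Abar : Matrix (Fin n) (Fin n) Bool) (i j : Fin n) : Prop :=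
  Abar j i = true

theorem structControllable_iff {n : ℕ} {α : Type} [Fintype α] {Abar : Matrix (Fin n) (Fin n) Bool}
    {Bbar : Matrix (Fin n) α Bool} : StructControllable Abar Bbar ↔
      ∃ (A : Matrix (Fin n) (Fin n) ℝ) (B : Matrix (Fin n) α ℝ),
        (∀ i j, A i j ≠ 0 → Abar i j = true) ∧ (∀ i j, B i j ≠ 0 → Bbar i j = true) ∧
          Controllable A B := by
  constructor
  · rintro ⟨a, b, h⟩
    refine ⟨_, _, fun i j hij => ?_, fun i j hij => ?_, h⟩
    · by_contra hno; exact hij (realize_eq_zero _ hno)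
    · by_contra hno; exact hij (realize_eq_zero _ hno)
  · rintro ⟨A, B, hA, hB, h⟩
    refine ⟨paramsOf _ A, paramsOf _ B, ?_⟩
    rwa [realize_paramsOf hA, realize_paramsOf hB]

theorem structObservable_iff {n : ℕ} {β : Type} {Abar : Matrix (Fin n) (Fin n) Bool}
    {Cbar : Matrix β (Fin n) Bool} : StructObservable Abar Cbar ↔
      ∃ (A : Matrix (Fin n) (Fin n) ℝ) (C : Matrix β (Fin n) ℝ),
        (∀ i j, A i j ≠ 0 → Abar i j = true) ∧ (∀ i j, C i j ≠ 0 → Cbar i j = true) ∧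
          Observable A C := by
  constructor
  · rintro ⟨a, b, h⟩
    refine ⟨_, _, fun i j hij => ?_, fun i j hij => ?_, h⟩
    · by_contra hno; exact hij (realize_eq_zero _ hno)
    · by_contra hno; exact hij (realize_eq_zero _ hno)
  · rintro ⟨A, B, hA, hB, h⟩
    refine ⟨paramsOf _ A, paramsOf _ B, ?_⟩
    rwa [realize_paramsOf hA, realize_paramsOf hB]

theorem observable_iff_controllable_transpose {n : ℕ} {β : Type} [Fintype β]
    {A : Matrix (Fin n) (Fin n) ℝ} {C : Matrix β (Fin n) ℝ} :
    Observable A C ↔ Controllable A.transpose C.transpose := by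
  unfold Observable Controllable
  rw [← Matrix.rank_transpose]
  have : ((Matrix.of fun (e : Fin n × β) (i : Fin n) => (C * A ^ (e.1 : ℕ)) e.2 i)).transpose =
      (Matrix.of fun (i : Fin n) (e : Fin n × β) =>
        (A.transpose ^ (e.1 : ℕ) * C.transpose) i e.2) := by
    ext i e
    simp [← Matrix.transpose_pow, ← Matrix.transpose_mul]
  rw [this]

theorem structObservable_iff_structControllable_transpose {n : ℕ} {β : Type} [Fintype β]
    {Abar : Matrix (Fin n) (Fin n) Bool} {γ : β → Fin n} :
    StructObservable Abar (sensorPattern γ) ↔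
      StructControllable Abar.transpose (actuatorPattern γ) := by
  rw [structObservable_iff, structControllable_iff]
  constructor
  · rintro ⟨A, C, hA, hC, h⟩
    exact ⟨A.transpose, C.transpose, fun i j => hA j i, fun i j => hC j i,
      observable_iff_controllable_transpose.1 h⟩
  · rintro ⟨A, B, hA, hB, h⟩
    refine ⟨A.transpose, B.transpose, fun i j => hA j i, fun i j => hB j i, ?_⟩
    rw [observable_iff_controllable_transpose]
    simpa using h

theorem StatePerfectMatching.transpose {n : ℕ} {Abar : Matrix (Fin n) (Fin n) Bool}
    (h : StatePerfectMatching Abar) : StatePerfectMatching Abar.transpose := by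
  obtain ⟨M, ⟨hME, hM⟩, hl, hr⟩ := h
  refine ⟨M.map ⟨Prod.swap, Prod.swap_injective⟩, ⟨?_, ?_⟩, ?_, ?_⟩
  · simp only [Finset.mem_map, Function.Embedding.coeFn_mk]
    rintro e ⟨f, hf, rfl⟩
    exact hME f hf
  · simp only [Finset.mem_map, Function.Embedding.coeFn_mk]
    rintro _ ⟨f, hf, rfl⟩ _ ⟨g, hg, rfl⟩ h
    rw [hM f hf g hg (by simpa [or_comm] using h)]
  · intro i
    obtain ⟨j, hj⟩ := hr i
    exact ⟨j, by simpa using hj⟩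
  · intro i
    obtain ⟨j, hj⟩ := hl i
    exact ⟨j, by simpa using hj⟩

theorem structControllable_of_reachable {n : ℕ} {α : Type} [Fintype α]
    {Abar : Matrix (Fin n) (Fin n) Bool} {ι : α → Fin n} (hA : StatePerfectMatching Abar)
    (h : ∀ i, ∃ a, ReflTransGen (StateEdge Abar) (ι a) i) :
    StructControllable Abar (actuatorPattern ι) := by
  classical
  obtain ⟨σ, hσ⟩ := hA.exists_perm
  obtain ⟨A, hAE, hA⟩ := exists_matrix_forall_eigenvector (StateEdge Abar) σ hσ (Set.range ι)
    fun i => by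
      obtain ⟨a, ha⟩ := h i
      exact ⟨_, ⟨a, rfl⟩, ha⟩
  rw [structControllable_iff]
  refine ⟨A, Matrix.of fun i a => if ι a = i then 1 else 0, fun i j => hAE i j, ?_, ?_⟩
  · intro i a hia
    by_contra hno
    simp [actuatorPattern] at hno hia
    exact hno hia
  · refine controllable_of_forall_eigenvector _ _ fun lam x hx hxA hxB => ?_
    obtain ⟨b, ⟨a, rfl⟩, hxb⟩ := hA lam x hx hxA
    apply hxb
    have := congrFun hxB a
    simp only [Matrix.vecMul, dotProduct, Matrix.map_apply, Matrix.of_apply] at this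
    rwa [Finset.sum_eq_single (ι a) (fun i _ hi => by simp [Ne.symm hi]) (by simp), if_pos rfl,
      map_one, mul_one] at this

/-- Without an actuator in a predecessor-closed set, the rows of the Kalman matrix of this set
vanish. -/
theorem StructControllable.exists_mem_of_pred_closed {n : ℕ} {α : Type} [Fintype α]
    {Abar : Matrix (Fin n) (Fin n) Bool} {ι : α → Fin n}
    (h : StructControllable Abar (actuatorPattern ι)) {T : Set (Fin n)}
    (hT : ∀ i j, StateEdge Abar i j → j ∈ T → i ∈ T) {i : Fin n} (hi : i ∈ T) :
    ∃ a, ι a ∈ T := by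
  by_contra hno
  push Not at hno
  obtain ⟨A, B, hA, hB, h⟩ := structControllable_iff.1 h
  have hzero : ∀ k : ℕ, ∀ i ∈ T, ∀ a, (A ^ k * B) i a = 0 := by
    intro k
    induction k with
    | zero =>
      intro i hi a
      rw [pow_zero, Matrix.one_mul]
      by_contra hne
      have := hB i a hne
      simp only [actuatorPattern, Matrix.of_apply, decide_eq_true_eq] at this
      exact hno a (this ▸ hi)
    | succ k ih =>
      intro i hi a
      rw [pow_succ', Matrix.mul_assoc, Matrix.mul_apply]
      refine Finset.sum_eq_zero fun j _ => ?_
      by_cases hij : A i j = 0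
      · rw [hij, zero_mul]
      · rw [ih j (hT j i (hA i j hij) hi), mul_zero]
  unfold Controllable at h
  have hli := linearIndependent_iff_card_eq_finrank_span.2
    ((Fintype.card_fin n).trans (h.symm.trans (Matrix.rank_eq_finrank_span_row _)))
  refine hli.ne_zero i ?_
  ext e
  exact hzero _ i hi _

theorem StructControllable.reachable {n : ℕ} {α : Type} [Fintype α]
    {Abar : Matrix (Fin n) (Fin n) Bool} {ι : α → Fin n}
    (h : StructControllable Abar (actuatorPattern ι)) (i : Fin n) :
    ∃ a, ReflTransGen (StateEdge Abar) (ι a) i :=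
  h.exists_mem_of_pred_closed (T := {j | ReflTransGen (StateEdge Abar) j i})
    (fun _ _ he hj => ReflTransGen.head he hj) ReflTransGen.refl

/-! ### Source components and minimum collections -/

/-- `S` contains exactly one vertex of each source component of the digraph `E`, that is, of each
strongly connected component without incoming edges. -/
structure IsSourceTransversal {V : Type*} (E : V → V → Prop) (S : Finset V) : Prop where
  cover : ∀ i, ∃ s ∈ S, ReflTransGen E s i
  source : ∀ s ∈ S, ∀ i, ReflTransGen E i s → ReflTransGen E s i
  inj : ∀ s ∈ S, ∀ s' ∈ S, ReflTransGen E s s' → s = s'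

theorem exists_isSourceTransversal {V : Type*} [Fintype V] [LinearOrder V] (E : V → V → Prop) :
    ∃ S, IsSourceTransversal E S := by
  classical
  let R := ReflTransGen E
  refine ⟨Finset.univ.filter fun s => (∀ i, R i s → R s i) ∧ ∀ i, R i s → s ≤ i, ?_, ?_, ?_⟩
  · intro i
    obtain ⟨j, hj, hmin⟩ := Finset.exists_min_image (Finset.univ.filter fun j => R j i)
      (fun j => (Finset.univ.filter fun l => R l j).card) ⟨i, by simpa using ReflTransGen.refl⟩
    simp only [Finset.mem_filter, Finset.mem_univ, true_and] at hj hmin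
    have hsrc : ∀ l, R l j → R j l := by
      intro l hl
      have hsub : (Finset.univ.filter fun x => R x l) ⊆ Finset.univ.filter fun x => R x j := by
        intro x hx
        simp only [Finset.mem_filter, Finset.mem_univ, true_and] at hx ⊢
        exact hx.trans hl
      have := Finset.eq_of_subset_of_card_le hsub (hmin l (hl.trans hj))
      have hjm : j ∈ Finset.univ.filter fun x => R x j := by simpa using ReflTransGen.refl
      rw [← this] at hjm
      simpa using hjm
    obtain ⟨s, hs, hsmin⟩ := Finset.exists_min_image (Finset.univ.filter fun l => R l j) id
      ⟨j, by simpa using ReflTransGen.refl⟩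
    simp only [Finset.mem_filter, Finset.mem_univ, true_and, id] at hs hsmin
    refine ⟨s, ?_, hs.trans hj⟩
    simp only [Finset.mem_filter, Finset.mem_univ, true_and]
    exact ⟨fun l hl => hs.trans (hsrc l (hl.trans hs)), fun l hl => hsmin l (hl.trans hs)⟩
  · intro s hs
    simp only [Finset.mem_filter, Finset.mem_univ, true_and] at hs
    exact hs.1
  · intro s hs s' hs' h
    simp only [Finset.mem_filter, Finset.mem_univ, true_and] at hs hs'
    exact le_antisymm (hs.2 _ (hs'.1 _ h)) (hs'.2 _ h)

/-- The sets of predecessors of the elements of a source transversal are pairwise disjoint. -/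
theorem IsSourceTransversal.card_mul_le {V : Type*} {E : V → V → Prop} {S : Finset V}
    (hS : IsSourceTransversal E S) {X : Type*} (Y : Finset X) (f : X → V) (c : ℕ)
    (h : ∀ s ∈ S, ∃ Z ⊆ Y, (∀ x ∈ Z, ReflTransGen E (f x) s) ∧ c ≤ Z.card) :
    S.card * c ≤ Y.card := by
  classical
  choose! Z hZ1 hZ2 hZ3 using h
  calc S.card * c = S.card • c := rfl
    _ ≤ ∑ s ∈ S, (Z s).card := Finset.card_nsmul_le_sum _ _ _ hZ3
    _ = (S.biUnion Z).card := by
      rw [Finset.card_biUnion]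
      intro s hs s' hs' hne
      rw [Function.onFun, Finset.disjoint_left]
      intro x hx hx'
      exact hne (hS.inj s hs s' hs' ((hS.source s hs _ (hZ2 s hs x hx)).trans (hZ2 s' hs' x hx')))
    _ ≤ Y.card := Finset.card_le_card (Finset.biUnion_subset.2 hZ1)

theorem IsSourceTransversal.card_le_of_structControllable {n : ℕ}
    {Abar : Matrix (Fin n) (Fin n) Bool} {S : Finset (Fin n)}
    (hS : IsSourceTransversal (StateEdge Abar) S) {q : ℕ} {κ : Fin q → Fin n}
    (h : StructControllable Abar (actuatorPattern κ)) : S.card ≤ q := by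
  have := hS.card_mul_le (Finset.univ : Finset (Fin q)) κ 1 fun s _ => by
    obtain ⟨a, ha⟩ := h.reachable s
    exact ⟨{a}, Finset.subset_univ _, by simpa using ha, by simp⟩
  simpa using this

theorem IsSourceTransversal.isMinActuators {n : ℕ} {Abar : Matrix (Fin n) (Fin n) Bool}
    (hA : StatePerfectMatching Abar) {S : Finset (Fin n)}
    (hS : IsSourceTransversal (StateEdge Abar) S) {p : ℕ} {ι : Fin p → Fin n}
    (hι : ∀ s ∈ S, ∃ a, ι a = s) (hp : p ≤ S.card) : IsMinActuators Abar ι := by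
  refine ⟨structControllable_of_reachable hA fun i => ?_, fun q κ hκ =>
    hp.trans (hS.card_le_of_structControllable hκ)⟩
  obtain ⟨s, hs, hsi⟩ := hS.cover i
  obtain ⟨a, rfl⟩ := hι s hs
  exact ⟨a, hsi⟩

theorem IsMinActuators.card_eq {n : ℕ} {Abar : Matrix (Fin n) (Fin n) Bool}
    (hA : StatePerfectMatching Abar) {S : Finset (Fin n)}
    (hS : IsSourceTransversal (StateEdge Abar) S) {p : ℕ} {ι : Fin p → Fin n}
    (h : IsMinActuators Abar ι) : p = S.card := by
  refine le_antisymm (h.2 S.card (fun a => S.equivFin.symm a) ?_)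
    (hS.card_le_of_structControllable h.1)
  refine (hS.isMinActuators hA (fun s hs => ⟨S.equivFin ⟨s, hs⟩, ?_⟩) le_rfl).1
  simp

theorem isMinSensors_iff {n m : ℕ} {Abar : Matrix (Fin n) (Fin n) Bool} {γ : Fin m → Fin n} :
    IsMinSensors Abar γ ↔ IsMinActuators Abar.transpose γ := by
  simp only [IsMinSensors, IsMinActuators, structObservable_iff_structControllable_transpose]

theorem IsMinSensors.reachable {n m : ℕ} {Abar : Matrix (Fin n) (Fin n) Bool} {γ : Fin m → Fin n}
    (h : IsMinSensors Abar γ) (i : Fin n) : ∃ c, ReflTransGen (StateEdge Abar) i (γ c) := by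
  obtain ⟨c, hc⟩ := (isMinSensors_iff.1 h).1.reachable i
  exact ⟨c, reflTransGen_swap.1 hc⟩

/-! ### Additional actuators, sensors and links -/

/-- Additional actuators, sensors and links do no harm: set the additional gains to zero. -/
theorem not_hasStructResilientFixedModes_mono {n : ℕ} {α β α' β' : Type} [Fintype α] [Fintype β]
    [Fintype α'] [Fintype β'] {Abar : Matrix (Fin n) (Fin n) Bool} {ι : α → Fin n} {γ : β → Fin n}
    {ι' : α' → Fin n} {γ' : β' → Fin n} {L F : Set (β × α)} {L' F' : Set (β' × α')}
    (f : α → α') (hf : Function.Injective f) (g : β → β') (hg : Function.Injective g)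
    (hι : ∀ a, ι' (f a) = ι a) (hγ : ∀ c, γ' (g c) = γ c)
    (hL : ∀ c a, (c, a) ∈ L → (c, a) ∉ F → (g c, f a) ∈ L' ∧ (g c, f a) ∉ F')
    (h : ¬ HasStructResilientFixedModes Abar (actuatorPattern ι) (sensorPattern γ) L {F}) :
    ¬ HasStructResilientFixedModes Abar (actuatorPattern ι') (sensorPattern γ') L' {F'} := by
  classical
  obtain ⟨⟨a, b, c⟩, hx⟩ := exists_realization_of_not_hasStructResilientFixedModes h
  let P : Matrix α α' ℝ := Matrix.of fun a a' => if f a = a' then 1 else 0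
  let Q : Matrix β β' ℝ := Matrix.of fun c c' => if g c = c' then 1 else 0
  have hP : P * P.transpose = 1 := by
    ext a a₂
    simp [P, Matrix.mul_apply, Matrix.one_apply, hf.eq_iff, eq_comm]
  have hQ : Q * Q.transpose = 1 := by
    ext a a₂
    simp [Q, Matrix.mul_apply, Matrix.one_apply, hg.eq_iff, eq_comm]
  set B := realize (actuatorPattern ι) b
  set C := realize (sensorPattern γ) c
  have hB : realize (actuatorPattern ι') (paramsOf _ (B * P)) = B * P := by
    refine realize_paramsOf fun i a' hne => ?_
    obtain ⟨a, -, ha⟩ := Finset.exists_ne_zero_of_sum_ne_zero hne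
    have h1 : B i a ≠ 0 := left_ne_zero_of_mul ha
    have h2 : f a = a' := by
      by_contra hno; exact right_ne_zero_of_mul ha (by simp [P, hno])
    have h3 : actuatorPattern ι i a = true := by
      by_contra hno; exact h1 (realize_eq_zero _ hno)
    simp only [actuatorPattern, Matrix.of_apply, decide_eq_true_eq] at h3 ⊢
    rw [← h2, hι, h3]
  have hC : realize (sensorPattern γ') (paramsOf _ (Q.transpose * C)) = Q.transpose * C := by
    refine realize_paramsOf fun c' i hne => ?_
    obtain ⟨c, -, hc⟩ := Finset.exists_ne_zero_of_sum_ne_zero hne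
    have h1 : C c i ≠ 0 := right_ne_zero_of_mul hc
    have h2 : g c = c' := by
      by_contra hno; exact left_ne_zero_of_mul hc (by simp [Q, hno])
    have h3 : sensorPattern γ c i = true := by
      by_contra hno; exact h1 (realize_eq_zero _ hno)
    simp only [sensorPattern, Matrix.of_apply, decide_eq_true_eq] at h3 ⊢
    rw [← h2, hγ, h3]
  apply not_hasStructResilientFixedModes_of_exists
    ⟨a, paramsOf _ (B * P), paramsOf _ (Q.transpose * C)⟩
  intro lam
  obtain ⟨K, hK, hlam⟩ := hx lam
  refine ⟨P.transpose * K * Q, ?_, ?_⟩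
  · intro a' c' hac
    by_contra hne
    rw [Matrix.mul_apply] at hne
    obtain ⟨c, -, hc⟩ := Finset.exists_ne_zero_of_sum_ne_zero hne
    have h1 : g c = c' := by
      by_contra hno; exact right_ne_zero_of_mul hc (by simp [Q, hno])
    have hne2 := left_ne_zero_of_mul hc
    rw [Matrix.mul_apply] at hne2
    obtain ⟨a, -, ha⟩ := Finset.exists_ne_zero_of_sum_ne_zero hne2
    have h2 : f a = a' := by
      by_contra hno; exact left_ne_zero_of_mul ha (by simp [P, hno])
    apply right_ne_zero_of_mul ha
    refine hK a c ?_
    subst h1 h2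
    by_contra hcon
    push Not at hcon
    obtain ⟨h3, h4⟩ := hL c a hcon.1 hcon.2
    rcases hac with hac | hac
    · exact hac h3
    · exact h4 hac
  · have : B * P * (P.transpose * K * Q) * (Q.transpose * C) = B * K * C := by
      calc _ = B * (P * P.transpose) * K * (Q * Q.transpose) * C := by
            simp only [Matrix.mul_assoc]
        _ = _ := by rw [hP, hQ, Matrix.mul_one, Matrix.mul_one]
    simp only
    rw [hB, hC, this]
    exact hlam

/-! ### Links that make the closed loop strongly connected -/

/-- Let `e` list pairs (actuator, sensor) joined by paths, closed up to a cycle by links. If each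
actuator reaches a listed sensor and receives a link, and each sensor is reached from a listed
actuator and emits a link, then the closed loop is strongly connected. -/
theorem loopEdge_strongly_connected {n : ℕ} {α β : Type} {Abar : Matrix (Fin n) (Fin n) Bool}
    {ι : α → Fin n} {γ : β → Fin n} {L : Set (β × α)}
    (hι : ∀ i, ∃ a, ReflTransGen (StateEdge Abar) (ι a) i)
    (hγ : ∀ i, ∃ c, ReflTransGen (StateEdge Abar) i (γ c))
    {r : ℕ} (e : Fin r → α × β)
    (he : ∀ l, ReflTransGen (StateEdge Abar) (ι (e l).1) (γ (e l).2))
    (hL : ∀ l, ((e l).2, (e (finRotate r l)).1) ∈ L)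
    (hα : ∀ a, ∃ l, ReflTransGen (StateEdge Abar) (ι a) (γ (e l).2))
    (hβ : ∀ c, ∃ l, ReflTransGen (StateEdge Abar) (ι (e l).1) (γ c))
    (hα' : ∀ a, ∃ c, (c, a) ∈ L) (hβ' : ∀ c, ∃ a, (c, a) ∈ L) (i j : Fin n) :
    ReflTransGen (LoopEdge Abar ι γ L) i j := by
  have up : ∀ {i j}, ReflTransGen (StateEdge Abar) i j → ReflTransGen (LoopEdge Abar ι γ L) i j :=
    fun h => ReflTransGen.mono (fun _ _ h => Or.inl h) _ _ h
  have link : ∀ {c a}, (c, a) ∈ L → ReflTransGen (LoopEdge Abar ι γ L) (γ c) (ι a) :=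
    fun h => .single (Or.inr ⟨_, h, rfl, rfl⟩)
  have hrot : ∀ l l', ReflTransGen (LoopEdge Abar ι γ L) (ι (e l).1) (ι (e l').1) := by
    intro l l'
    have hpow : ∀ k : ℕ, ReflTransGen (LoopEdge Abar ι γ L) (ι (e l).1)
        (ι (e ((finRotate r ^ k) l)).1) := by
      intro k
      induction k with
      | zero => exact .refl
      | succ k ih =>
        rw [pow_succ', Equiv.Perm.mul_apply]
        exact ih.trans ((up (he _)).trans (link (hL _)))
    have hsame : (finRotate r).SameCycle l l' := by
      rcases Nat.lt_or_ge r 2 with hr | hr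
      · have : l = l' := by
          have := l.2; have := l'.2; ext; omega
        rw [this]
      · obtain ⟨r, rfl⟩ := Nat.exists_eq_add_of_le' hr
        refine isCycle_finRotate.sameCycle ?_ ?_ <;>
        · rw [← Equiv.Perm.mem_support, support_finRotate]; exact Finset.mem_univ _
    obtain ⟨k, hk⟩ := hsame.exists_nat_pow_eq
    rw [← hk]
    exact hpow k
  have hact : ∀ a a', ReflTransGen (LoopEdge Abar ι γ L) (ι a) (ι a') := by
    intro a a'
    obtain ⟨l, hl⟩ := hα a
    obtain ⟨c', hc'⟩ := hα' a'
    obtain ⟨l', hl'⟩ := hβ c'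
    exact (up hl).trans ((link (hL l)).trans ((hrot _ l').trans ((up hl').trans (link hc'))))
  obtain ⟨c, hc⟩ := hγ i
  obtain ⟨a, ha⟩ := hβ' c
  obtain ⟨a', ha'⟩ := hι j
  exact (up hc).trans ((link ha).trans ((hact a a').trans (up ha')))

/-! ### Lower bounds and optimality -/

theorem card_sources_le_card_links {n : ℕ} {α β : Type} [Fintype α] [Fintype β]
    {Abar : Matrix (Fin n) (Fin n) Bool} {ι : α → Fin n} {γ : β → Fin n} {S : Finset (Fin n)}
    (hS : IsSourceTransversal (StateEdge Abar) S) {L : Finset (β × α)}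
    (h : ¬ HasStructResilientFixedModes Abar (actuatorPattern ι) (sensorPattern γ)
      (L : Set (β × α)) {∅}) : S.card ≤ L.card := by
  have := hS.card_mul_le L (fun e => ι e.2) 1 fun s _ => by
    obtain ⟨e, he, hes⟩ := exists_link_into_of_pred_closed h
      (T := {j | ReflTransGen (StateEdge Abar) j s}) (fun _ _ he hj => ReflTransGen.head he hj)
      ReflTransGen.refl
    exact ⟨{e}, by simpa using he, by simpa using hes, by simp⟩
  simpa using this

theorem card_sinks_le_card_links {n : ℕ} {α β : Type} [Fintype α] [Fintype β]
    {Abar : Matrix (Fin n) (Fin n) Bool} {ι : α → Fin n} {γ : β → Fin n} {S : Finset (Fin n)}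
    (hS : IsSourceTransversal (Function.swap (StateEdge Abar)) S) {L : Finset (β × α)}
    (h : ¬ HasStructResilientFixedModes Abar (actuatorPattern ι) (sensorPattern γ)
      (L : Set (β × α)) {∅}) : S.card ≤ L.card := by
  have := hS.card_mul_le L (fun e => γ e.1) 1 fun s _ => by
    obtain ⟨e, he, hes⟩ := exists_link_from_of_succ_closed h
      (T := {j | ReflTransGen (StateEdge Abar) s j}) (fun _ _ he hj => ReflTransGen.tail hj he)
      ReflTransGen.refl
    exact ⟨{e}, by simpa using he, by simpa [reflTransGen_swap] using hes, by simp⟩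
  simpa using this

/-- Each source component is reached from at least `k + 1` actuators and links, as it would be cut
off by the failure of all of them. -/
theorem Tolerates.lower_bounds_sources {n k : ℕ} {Abar : Matrix (Fin n) (Fin n) Bool}
    {d : Design n} (h : Tolerates Abar k d) {S : Finset (Fin n)}
    (hS : IsSourceTransversal (StateEdge Abar) S) :
    S.card * (k + 1) ≤ d.p ∧ S.card * (k + 1) ≤ d.links.card := by
  classical
  have hcl : ∀ s i j, StateEdge Abar i j → j ∈ {j | ReflTransGen (StateEdge Abar) j s} →
      i ∈ {j | ReflTransGen (StateEdge Abar) j s} := fun _ _ _ he hj => ReflTransGen.head he hj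
  constructor
  · have := hS.card_mul_le (Finset.univ : Finset (Fin d.p)) d.act (k + 1) fun s _ => by
      refine ⟨Finset.univ.filter fun a => ReflTransGen (StateEdge Abar) (d.act a) s,
        Finset.subset_univ _, by simp, ?_⟩
      by_contra hlt
      have h1 := h ∅ (Finset.univ.filter fun a => ReflTransGen (StateEdge Abar) (d.act a) s) ∅
        (Finset.empty_subset _) (by simp only [Finset.card_empty]; omega)
      obtain ⟨e, -, he2⟩ := exists_link_into_of_pred_closed h1 (hcl s) ReflTransGen.refl
      exact e.2.2 (by simpa using he2)
    simpa using this
  · refine hS.card_mul_le d.links (fun e => d.act e.2) (k + 1) fun s _ => ?_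
    refine ⟨d.links.filter fun e => ReflTransGen (StateEdge Abar) (d.act e.2) s,
      Finset.filter_subset _ _, by simp, ?_⟩
    by_contra hlt
    have h1 := h (d.links.filter fun e => ReflTransGen (StateEdge Abar) (d.act e.2) s) ∅ ∅
      (Finset.filter_subset _ _) (by simp only [Finset.card_empty]; omega)
    obtain ⟨e, ⟨he1, he2⟩, he3⟩ := exists_link_into_of_pred_closed h1 (hcl s) ReflTransGen.refl
    exact he2 (Finset.mem_filter.2 ⟨he1, he3⟩)

/-- Each sink component reaches at least `k + 1` sensors and links. -/
theorem Tolerates.lower_bounds_sinks {n k : ℕ} {Abar : Matrix (Fin n) (Fin n) Bool}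
    {d : Design n} (h : Tolerates Abar k d) {S : Finset (Fin n)}
    (hS : IsSourceTransversal (Function.swap (StateEdge Abar)) S) :
    S.card * (k + 1) ≤ d.m ∧ S.card * (k + 1) ≤ d.links.card := by
  classical
  have hcl : ∀ s i j, StateEdge Abar i j → i ∈ {j | ReflTransGen (StateEdge Abar) s j} →
      j ∈ {j | ReflTransGen (StateEdge Abar) s j} := fun _ _ _ he hj => ReflTransGen.tail hj he
  constructor
  · have := hS.card_mul_le (Finset.univ : Finset (Fin d.m)) d.sen (k + 1) fun s _ => by
      refine ⟨Finset.univ.filter fun a => ReflTransGen (StateEdge Abar) s (d.sen a),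
        Finset.subset_univ _, by simp [reflTransGen_swap], ?_⟩
      by_contra hlt
      have h1 := h ∅ ∅ (Finset.univ.filter fun a => ReflTransGen (StateEdge Abar) s (d.sen a))
        (Finset.empty_subset _) (by simp only [Finset.card_empty]; omega)
      obtain ⟨e, -, he2⟩ := exists_link_from_of_succ_closed h1 (hcl s) ReflTransGen.refl
      exact e.1.2 (by simpa using he2)
    simpa using this
  · refine hS.card_mul_le d.links (fun e => d.sen e.1) (k + 1) fun s _ => ?_
    refine ⟨d.links.filter fun e => ReflTransGen (StateEdge Abar) s (d.sen e.1),
      Finset.filter_subset _ _, by simp [reflTransGen_swap], ?_⟩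
    by_contra hlt
    have h1 := h (d.links.filter fun e => ReflTransGen (StateEdge Abar) s (d.sen e.1)) ∅ ∅
      (Finset.filter_subset _ _) (by simp only [Finset.card_empty]; omega)
    obtain ⟨e, ⟨he1, he2⟩, he3⟩ := exists_link_from_of_succ_closed h1 (hcl s) ReflTransGen.refl
    exact he2 (Finset.mem_filter.2 ⟨he1, he3⟩)

/-- One of the `k + 1` blocks survives any `k` failures. -/
theorem tolerates_unionDesign {n k p m : ℕ} {Abar : Matrix (Fin n) (Fin n) Bool}
    {ι : Fin ((k + 1) * p) → Fin n} {γ : Fin ((k + 1) * m) → Fin n}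
    {L : Fin (k + 1) → Finset (Fin m × Fin p)}
    (h : ∀ i, ¬ HasStructResilientFixedModes Abar (actuatorPattern (block ι i))
      (sensorPattern (block γ i)) (L i : Set (Fin m × Fin p)) {∅}) :
    Tolerates Abar k (unionDesign ι γ L) := by
  intro J JB JC hJ hcard
  let ba : Fin ((k + 1) * p) → Fin (k + 1) := fun a => (finProdFinEquiv.symm a).1
  let bc : Fin ((k + 1) * m) → Fin (k + 1) := fun a => (finProdFinEquiv.symm a).1
  have hba : ∀ i a, ba (finProdFinEquiv (i, a)) = i := by
    intro i a; simp only [ba, Equiv.symm_apply_apply]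
  have hbc : ∀ i a, bc (finProdFinEquiv (i, a)) = i := by
    intro i a; simp only [bc, Equiv.symm_apply_apply]
  let hit : Finset (Fin (k + 1)) := J.image (fun e => ba e.2) ∪ JB.image ba ∪ JC.image bc
  have hhit : hit.card < (Finset.univ : Finset (Fin (k + 1))).card := by
    have h1 : hit.card ≤ J.card + JB.card + JC.card :=
      (Finset.card_union_le _ _).trans (add_le_add ((Finset.card_union_le _ _).trans
        (add_le_add Finset.card_image_le Finset.card_image_le)) Finset.card_image_le)
    rw [Finset.card_univ, Fintype.card_fin]
    exact Nat.lt_succ_of_le (h1.trans hcard)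
  obtain ⟨i, -, hi⟩ := Finset.exists_mem_notMem_of_card_lt_card hhit
  have hiJ : ∀ e ∈ J, ba e.2 ≠ i := fun e he h => hi (Finset.mem_union_left _
    (Finset.mem_union_left _ (Finset.mem_image.2 ⟨e, he, h⟩)))
  have hiB : ∀ a ∈ JB, ba a ≠ i := fun a ha h => hi (Finset.mem_union_left _
    (Finset.mem_union_right _ (Finset.mem_image.2 ⟨a, ha, h⟩)))
  have hiC : ∀ c ∈ JC, bc c ≠ i := fun c hc h => hi (Finset.mem_union_right _
    (Finset.mem_image.2 ⟨c, hc, h⟩))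
  refine not_hasStructResilientFixedModes_mono
    (fun a => ⟨finProdFinEquiv (i, a), fun ha => hiB _ ha (hba i a)⟩) ?_
    (fun c => ⟨finProdFinEquiv (i, c), fun hc => hiC _ hc (hbc i c)⟩) ?_
    (fun a => rfl) (fun c => rfl) ?_ (h i)
  · intro a a' haa
    have := finProdFinEquiv.injective (congrArg Subtype.val haa)
    exact congrArg Prod.snd this
  · intro a a' haa
    have := finProdFinEquiv.injective (congrArg Subtype.val haa)
    exact congrArg Prod.snd this
  · intro c a hca _
    constructor
    · exact Finset.mem_biUnion.2 ⟨i, Finset.mem_univ _, Finset.mem_image.2 ⟨(c, a), hca, rfl⟩⟩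
    · intro hmem
      exact hiJ _ hmem (hba i a)

theorem card_links_unionDesign_le {n k p m : ℕ} (ι : Fin ((k + 1) * p) → Fin n)
    (γ : Fin ((k + 1) * m) → Fin n) (L : Fin (k + 1) → Finset (Fin m × Fin p)) {q : ℕ}
    (hq : ∀ i, (L i).card ≤ q) : (unionDesign ι γ L).links.card ≤ (k + 1) * q := by
  refine (Finset.card_biUnion_le_card_mul _ _ q fun i _ =>
    Finset.card_image_le.trans (hq i)).trans ?_
  rw [Finset.card_univ, Fintype.card_fin]

theorem isOptimal_unionDesign {n k p m : ℕ} {Abar : Matrix (Fin n) (Fin n) Bool}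
    (hA : StatePerfectMatching Abar)
    {ι : Fin ((k + 1) * p) → Fin n} {γ : Fin ((k + 1) * m) → Fin n}
    {L : Fin (k + 1) → Finset (Fin m × Fin p)} (hι : ∀ i, IsMinActuators Abar (block ι i))
    (hγ : ∀ i, IsMinSensors Abar (block γ i))
    (h : ∀ i, ¬ HasStructResilientFixedModes Abar (actuatorPattern (block ι i))
      (sensorPattern (block γ i)) (L i : Set (Fin m × Fin p)) {∅})
    (hL : ∀ i, (L i).card ≤ max p m) : IsOptimal Abar k (unionDesign ι γ L) := by
  refine ⟨tolerates_unionDesign h, fun d hd => ?_⟩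
  obtain ⟨S, hS⟩ := exists_isSourceTransversal (StateEdge Abar)
  obtain ⟨S', hS'⟩ := exists_isSourceTransversal (Function.swap (StateEdge Abar))
  obtain ⟨h1, h2⟩ := hd.lower_bounds_sources hS
  obtain ⟨h3, h4⟩ := hd.lower_bounds_sinks hS'
  rw [← (hι 0).card_eq hA hS] at h1 h2
  rw [← (isMinSensors_iff.1 (hγ 0)).card_eq hA.transpose hS'] at h3 h4
  have h5 := card_links_unionDesign_le ι γ L hL
  have h6 : (k + 1) * max p m ≤ d.links.card := by
    rcases max_cases p m with ⟨h, -⟩ | ⟨h, -⟩ <;> rw [h, mul_comm] <;> assumption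
  have h7 : (unionDesign ι γ L).p = p * (k + 1) := mul_comm _ _
  have h8 : (unionDesign ι γ L).m = m * (k + 1) := mul_comm _ _
  unfold Design.cost
  omega

/-- A link set that makes the closed loop strongly connected, with at most as many links as the
larger of the numbers of actuators and sensors, is a sparsest information pattern. -/
theorem isSparsestPattern_of_strongly_connected {n p m : ℕ} {Abar : Matrix (Fin n) (Fin n) Bool}
    (hA : StatePerfectMatching Abar) {ι : Fin p → Fin n} {γ : Fin m → Fin n}
    (hι : IsMinActuators Abar ι) (hγ : IsMinSensors Abar γ) {L : Finset (Fin m × Fin p)}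
    (hconn : ∀ i j, ReflTransGen (LoopEdge Abar ι γ (L : Set (Fin m × Fin p))) i j)
    (hlink : ∀ c, ∃ a, (c, a) ∈ L) (hL : L.card ≤ max p m) : IsSparsestPattern Abar ι γ L := by
  constructor
  · refine not_hasStructResilientFixedModes_of_strongly_connected hA (by simpa using hconn) ?_
    rintro ⟨i⟩
    obtain ⟨c, -⟩ := hγ.reachable i
    obtain ⟨a, ha⟩ := hlink c
    exact ⟨(c, a), ha, Set.notMem_empty _⟩
  · intro L' hL'
    obtain ⟨S, hS⟩ := exists_isSourceTransversal (StateEdge Abar)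
    obtain ⟨S', hS'⟩ := exists_isSourceTransversal (Function.swap (StateEdge Abar))
    refine hL.trans (max_le ?_ ?_)
    · exact (hι.card_eq hA hS).trans_le (card_sources_le_card_links hS hL')
    · exact ((isMinSensors_iff.1 hγ).card_eq hA.transpose hS').trans_le
        (card_sinks_le_card_links hS' hL')

/-! ### Outcomes of the pairing procedure -/

theorem mem_reachEdges_iff {n p m : ℕ} {Abar : Matrix (Fin n) (Fin n) Bool} {ι : Fin p → Fin n}
    {γ : Fin m → Fin n} {a : Fin p} {c : Fin m} :
    (a, c) ∈ reachEdges Abar ι γ ↔ ReflTransGen (StateEdge Abar) (ι a) (γ c) := by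
  constructor
  · intro h
    let P : Fin n ⊕ Fin p ⊕ Fin m → Prop
      | .inl j => ReflTransGen (StateEdge Abar) (ι a) j
      | .inr (.inl _) => False
      | .inr (.inr c) => ReflTransGen (StateEdge Abar) (ι a) (γ c)
    suffices ∀ y, TransGen (systemEdge Abar (actuatorPattern ι) (sensorPattern γ))
        (.inr (.inl a)) y → P y from this _ h
    intro y hy
    induction hy with
    | single h =>
      rename_i y
      rcases y with j | a' | c' <;> simp only [systemEdge] at h
      simp only [actuatorPattern, Matrix.of_apply, decide_eq_true_eq] at h
      exact h ▸ ReflTransGen.refl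
    | tail _ h ih =>
      rename_i x y _
      rcases x with i | a'' | c'' <;> rcases y with j | a' | c' <;>
        simp only [systemEdge] at h
      · exact ReflTransGen.tail (r := StateEdge Abar) ih h
      · simp only [sensorPattern, Matrix.of_apply, decide_eq_true_eq] at h
        subst h
        exact ih
      · exact ih.elim
  · intro h
    have h1 : ReflTransGen (systemEdge Abar (actuatorPattern ι) (sensorPattern γ))
        (.inl (ι a)) (.inl (γ c)) := ReflTransGen.lift Sum.inl (fun _ _ h => h) _ _ h
    refine TransGen.head' (b := .inl (ι a)) ?_ (h1.tail ?_)
    · simp [systemEdge, actuatorPattern]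
    · simp [systemEdge, sensorPattern]

/-- A neighbour of an unmatched vertex is matched. -/
theorem IsMaxMatching.rightMatched {S T : Type} {E : Set (S × T)} {M : Finset (S × T)}
    (h : IsMaxMatching E M) {s : S} {t : T} (hs : ¬ LeftMatched M s) (hst : (s, t) ∈ E) :
    RightMatched M t := by
  classical
  by_contra ht
  have hnot : (s, t) ∉ M := fun hmem => hs ⟨t, hmem⟩
  have := h.2 (insert (s, t) M) ⟨?_, ?_⟩
  · rw [Finset.card_insert_of_notMem hnot] at this
    omega
  · intro e he
    rcases Finset.mem_insert.1 he with rfl | he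
    · exact hst
    · exact h.1.1 e he
  · intro e he f hf hef
    rcases Finset.mem_insert.1 he with rfl | he' <;> rcases Finset.mem_insert.1 hf with rfl | hf'
    · rfl
    · obtain ⟨f₁, f₂⟩ := f
      rcases hef with h1 | h1 <;> simp only at h1 <;> subst h1
      · exact (hs ⟨_, hf'⟩).elim
      · exact (ht ⟨_, hf'⟩).elim
    · obtain ⟨e₁, e₂⟩ := e
      rcases hef with h1 | h1 <;> simp only at h1 <;> subst h1
      · exact (hs ⟨_, he'⟩).elim
      · exact (ht ⟨_, he'⟩).elim
    · exact h.1.2 e he' f hf' hef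

theorem IsMatching.swap {S T : Type} {E : Set (S × T)} {M : Finset (S × T)}
    (h : IsMatching E M) :
    IsMatching (Prod.swap ⁻¹' E) (M.map ⟨Prod.swap, Prod.swap_injective⟩) := by
  constructor
  · simp only [Finset.mem_map, Function.Embedding.coeFn_mk]
    rintro e ⟨f, hf, rfl⟩
    exact h.1 f hf
  · simp only [Finset.mem_map, Function.Embedding.coeFn_mk]
    rintro _ ⟨f, hf, rfl⟩ _ ⟨g, hg, rfl⟩ h'
    rw [h.2 f hf g hg (by simpa [or_comm] using h')]

theorem IsMaxMatching.leftMatched {S T : Type} {E : Set (S × T)} {M : Finset (S × T)}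
    (h : IsMaxMatching E M) {s : S} {t : T} (ht : ¬ RightMatched M t) (hst : (s, t) ∈ E) :
    LeftMatched M s := by
  have h' : IsMaxMatching (Prod.swap ⁻¹' E) (M.map ⟨Prod.swap, Prod.swap_injective⟩) := by
    refine ⟨h.1.swap, fun M' hM' => ?_⟩
    simpa using h.2 _ hM'.swap
  obtain ⟨u, hu⟩ := h'.rightMatched (s := t) (t := s) (fun ⟨u, hu⟩ => ht ⟨u, by simpa using hu⟩) hst
  exact ⟨u, by simpa using hu⟩

theorem exists_isMaxMatching {S T : Type} [Fintype S] [Fintype T] (E : Set (S × T)) :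
    ∃ M, IsMaxMatching E M := by
  classical
  obtain ⟨M, hM, hmax⟩ := Finset.exists_max_image
    ((Finset.univ : Finset (Finset (S × T))).filter fun M => IsMatching E M) Finset.card
    ⟨∅, by simp [IsMatching]⟩
  simp only [Finset.mem_filter, Finset.mem_univ, true_and] at hM hmax
  exact ⟨M, hM, hmax⟩

theorem exists_fun_covering {X Y : Type} (U : Finset X) (V : Finset Y)
    (hcard : V.card ≤ U.card) (hne : X → Nonempty Y) : ∃ f : X → Y, ∀ y ∈ V, ∃ x ∈ U, f x = y := by
  classical
  obtain ⟨g⟩ : Nonempty (V ↪ U) := Function.Embedding.nonempty_of_card_le (by simpa using hcard)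
  refine ⟨fun x => if h : ∃ y : V, (g y : X) = x then h.choose else (hne x).some, fun y hy => ?_⟩
  have h : ∃ y' : V, (g y' : X) = g ⟨y, hy⟩ := ⟨⟨y, hy⟩, rfl⟩
  refine ⟨g ⟨y, hy⟩, (g _).2, ?_⟩
  refine (dif_pos h).trans ?_
  have := g.injective (Subtype.ext h.choose_spec)
  rw [this]

theorem IsMatching.card_left_add {S T : Type} [Fintype S] [DecidableEq S] {E : Set (S × T)}
    {M : Finset (S × T)} (h : IsMatching E M) [DecidablePred (LeftMatched M)] :
    M.card + (Finset.univ.filter fun s => ¬ LeftMatched M s).card = Fintype.card S := by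
  rw [← Finset.card_univ, ← Finset.card_filter_add_card_filter_not (s := Finset.univ)
    (LeftMatched M)]
  congr 1
  rw [← Finset.card_image_of_injOn (s := M) (f := Prod.fst)
    fun e he f hf hef => h.2 e he f hf (Or.inl hef)]
  congr 1
  ext s
  simp [LeftMatched]

theorem IsMatching.card_right_add {S T : Type} [Fintype T] [DecidableEq T] {E : Set (S × T)}
    {M : Finset (S × T)} (h : IsMatching E M) [DecidablePred (RightMatched M)] :
    M.card + (Finset.univ.filter fun s => ¬ RightMatched M s).card = Fintype.card T := by
  rw [← Finset.card_univ, ← Finset.card_filter_add_card_filter_not (s := Finset.univ)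
    (RightMatched M)]
  congr 1
  rw [← Finset.card_image_of_injOn (s := M) (f := Prod.snd)
    fun e he f hf hef => h.2 e he f hf (Or.inr hef)]
  congr 1
  ext s
  simp [RightMatched]

/-- Since a matching saturates equally many actuators and sensors, the side with more elements has
at least as many unmatched ones, so that its links can cover those of the other side. -/
theorem exists_isPairingOutcome {n p m : ℕ} {Abar : Matrix (Fin n) (Fin n) Bool}
    {ι : Fin p → Fin n} {γ : Fin m → Fin n}
    (hι : ∀ i, ∃ a, ReflTransGen (StateEdge Abar) (ι a) i)
    (hγ : ∀ i, ∃ c, ReflTransGen (StateEdge Abar) i (γ c)) :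
    ∃ L, IsPairingOutcome Abar ι γ L := by
  classical
  obtain ⟨M, hM⟩ := exists_isMaxMatching (reachEdges Abar ι γ)
  have h1 := hM.1.card_left_add
  have h2 := hM.1.card_right_add
  rw [Fintype.card_fin] at h1 h2
  have hS : ∃ S, IsSequentialPairing M S := by
    refine ⟨_, M.card, fun l => M.equivFin.symm l, ?_, ?_, rfl⟩
    · exact Subtype.val_injective.comp M.equivFin.symm.injective
    · ext x
      simp only [Finset.mem_image, Finset.mem_univ, true_and]
      constructor
      · rintro ⟨l, rfl⟩; exact (M.equivFin.symm l).2
      · intro hx; exact ⟨M.equivFin ⟨x, hx⟩, by simp⟩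
  obtain ⟨S, hS⟩ := hS
  rcases le_total p m with hpm | hpm
  · obtain ⟨f, hf⟩ := exists_fun_covering (Finset.univ.filter fun c => ¬ RightMatched M c)
      (Finset.univ.filter fun a => ¬ LeftMatched M a) (by omega)
      (fun c => ⟨(hι (γ c)).choose⟩)
    refine ⟨_, M, S, (Finset.univ.filter fun c => ¬ RightMatched M c).image fun c => (c, f c),
      hM, hS, rfl, Or.inl ⟨hpm, ?_, ?_, ?_⟩⟩
    · intro e he
      simp only [Finset.mem_image, Finset.mem_filter, Finset.mem_univ, true_and] at he
      obtain ⟨c, hc, rfl⟩ := he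
      exact hc
    · intro c hc
      refine ⟨f c, by simpa using hc, fun a ha => ?_⟩
      simp only [Finset.mem_image, Finset.mem_filter, Finset.mem_univ, true_and,
        Prod.mk.injEq] at ha
      obtain ⟨c', -, rfl, rfl⟩ := ha
      rfl
    · intro a ha
      obtain ⟨c, hc, hca⟩ := hf a (by simpa using ha)
      exact ⟨c, by simpa [hca] using hc⟩
  · obtain ⟨f, hf⟩ := exists_fun_covering (Finset.univ.filter fun a => ¬ LeftMatched M a)
      (Finset.univ.filter fun c => ¬ RightMatched M c) (by omega)
      (fun a => ⟨(hγ (ι a)).choose⟩)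
    refine ⟨_, M, S, (Finset.univ.filter fun a => ¬ LeftMatched M a).image fun a => (f a, a),
      hM, hS, rfl, Or.inr ⟨hpm, ?_, ?_, ?_⟩⟩
    · intro e he
      simp only [Finset.mem_image, Finset.mem_filter, Finset.mem_univ, true_and] at he
      obtain ⟨c, hc, rfl⟩ := he
      exact hc
    · intro c hc
      refine ⟨f c, by simpa using hc, fun a ha => ?_⟩
      simp only [Finset.mem_image, Finset.mem_filter, Finset.mem_univ, true_and,
        Prod.mk.injEq] at ha
      obtain ⟨c', -, rfl, rfl⟩ := ha
      rfl
    · intro a ha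
      obtain ⟨c, hc, hca⟩ := hf a (by simpa using ha)
      exact ⟨c, by simpa [hca] using hc⟩

theorem IsPairingOutcome.card_le {n p m : ℕ} {Abar : Matrix (Fin n) (Fin n) Bool}
    {ι : Fin p → Fin n} {γ : Fin m → Fin n} {L : Finset (Fin m × Fin p)}
    (h : IsPairingOutcome Abar ι γ L) : L.card ≤ max p m := by
  classical
  obtain ⟨M, S, L', hM, ⟨r, e, he, heM, rfl⟩, rfl, hL'⟩ := h
  have h1 := hM.1.card_left_add
  have h2 := hM.1.card_right_add
  rw [Fintype.card_fin] at h1 h2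
  have hr : M.card = r := by
    rw [← heM, Finset.card_image_of_injective _ he, Finset.card_univ, Fintype.card_fin]
  refine (Finset.card_union_le _ _).trans ?_
  have hS : (Finset.univ.image fun l => ((e l).2, (e (finRotate r l)).1)).card ≤ r := by
    simpa using Finset.card_image_le (s := (Finset.univ : Finset (Fin r)))
      (f := fun l => ((e l).2, (e (finRotate r l)).1))
  rcases hL' with ⟨hpm, hu, hex, -⟩ | ⟨hpm, hu, hex, -⟩
  · have : L'.card ≤ (Finset.univ.filter fun s => ¬ RightMatched M s).card := by
      refine Finset.card_le_card_of_injOn Prod.fst (fun e he => by simpa using hu e he) ?_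
      rintro ⟨c, a⟩ he ⟨c', a'⟩ hf hef
      obtain rfl : c = c' := hef
      rw [(hex c (hu _ he)).unique he hf]
    have := le_max_right p m
    omega
  · have : L'.card ≤ (Finset.univ.filter fun s => ¬ LeftMatched M s).card := by
      refine Finset.card_le_card_of_injOn Prod.snd (fun e he => by simpa using hu e he) ?_
      rintro ⟨c, a⟩ he ⟨c', a'⟩ hf hef
      obtain rfl : a = a' := hef
      rw [(hex a (hu _ he)).unique he hf]
    have := le_max_left p m
    omega

theorem IsPairingOutcome.isSparsestPattern {n p m : ℕ} {Abar : Matrix (Fin n) (Fin n) Bool}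
    (hA : StatePerfectMatching Abar) {ι : Fin p → Fin n} {γ : Fin m → Fin n}
    (hι : IsMinActuators Abar ι) (hγ : IsMinSensors Abar γ) {L : Finset (Fin m × Fin p)}
    (h : IsPairingOutcome Abar ι γ L) : IsSparsestPattern Abar ι γ L := by
  have hcard := h.card_le
  obtain ⟨M, S, L', hM, ⟨r, e, he, heM, rfl⟩, rfl, hL'⟩ := h
  have hmem : ∀ x ∈ M, ∃ l, e l = x := by
    intro x hx
    rw [← heM] at hx
    simpa using hx
  have hemem : ∀ l, e l ∈ M := fun l => heM ▸ Finset.mem_image_of_mem e (Finset.mem_univ l)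
  have hcyc : ∀ l, ((e l).2, (e (finRotate r l)).1) ∈
      (Finset.univ.image fun l => ((e l).2, (e (finRotate r l)).1)) ∪ L' := fun l =>
    Finset.mem_union_left _ (Finset.mem_image_of_mem _ (Finset.mem_univ l))
  have hL1 : ∀ a, ¬ LeftMatched M a → ∃ c, (c, a) ∈ L' := by
    rcases hL' with ⟨-, -, -, h⟩ | ⟨-, -, h, -⟩
    · exact h
    · exact fun a ha => (h a ha).exists
  have hL2 : ∀ c, ¬ RightMatched M c → ∃ a, (c, a) ∈ L' := by
    rcases hL' with ⟨-, -, h, -⟩ | ⟨-, -, -, h⟩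
    · exact fun a ha => (h a ha).exists
    · exact h
  have hlinkS : ∀ c, ∃ a, (c, a) ∈
      (Finset.univ.image fun l => ((e l).2, (e (finRotate r l)).1)) ∪ L' := by
    intro c
    by_cases hc : RightMatched M c
    · obtain ⟨a, ha⟩ := hc
      obtain ⟨l, hl⟩ := hmem _ ha
      have := hcyc l
      rw [hl] at this
      exact ⟨_, this⟩
    · obtain ⟨a, ha⟩ := hL2 c hc
      exact ⟨a, Finset.mem_union_right _ ha⟩
  refine isSparsestPattern_of_strongly_connected hA hι hγ ?_ hlinkS hcard
  refine loopEdge_strongly_connected hι.1.reachable hγ.reachable e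
    (fun l => mem_reachEdges_iff.1 (hM.1.1 _ (hemem l))) hcyc ?_ ?_ ?_ hlinkS
  · intro a
    by_cases ha : LeftMatched M a
    · obtain ⟨c, hc⟩ := ha
      obtain ⟨l, hl⟩ := hmem _ hc
      exact ⟨l, by rw [hl]; exact mem_reachEdges_iff.1 (hM.1.1 _ hc)⟩
    · obtain ⟨c, hc⟩ := hγ.reachable (ι a)
      obtain ⟨a', ha'⟩ := hM.rightMatched ha (mem_reachEdges_iff.2 hc)
      obtain ⟨l, hl⟩ := hmem _ ha'
      exact ⟨l, by rw [hl]; exact hc⟩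
  · intro c
    by_cases hc : RightMatched M c
    · obtain ⟨a, ha⟩ := hc
      obtain ⟨l, hl⟩ := hmem _ ha
      exact ⟨l, by rw [hl]; exact mem_reachEdges_iff.1 (hM.1.1 _ ha)⟩
    · obtain ⟨a, ha⟩ := hι.1.reachable (γ c)
      obtain ⟨c', hc'⟩ := hM.leftMatched hc (mem_reachEdges_iff.2 ha)
      obtain ⟨l, hl⟩ := hmem _ hc'
      exact ⟨l, by rw [hl]; exact ha⟩
  · intro a
    by_cases ha : LeftMatched M a
    · obtain ⟨c, hc⟩ := ha
      obtain ⟨l, hl⟩ := hmem _ hc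
      have := hcyc ((finRotate r).symm l)
      rw [Equiv.apply_symm_apply, hl] at this
      exact ⟨_, this⟩
    · obtain ⟨c, hc⟩ := hL1 a ha
      exact ⟨c, Finset.mem_union_right _ hc⟩

/-- A sparsest information pattern has at most `max p m` links, as an outcome of the pairing
procedure has no more. -/
theorem isOptimal_unionDesign_of_isSparsestPattern {n k p m : ℕ}
    {Abar : Matrix (Fin n) (Fin n) Bool} (hA : StatePerfectMatching Abar)
    {ι : Fin ((k + 1) * p) → Fin n} {γ : Fin ((k + 1) * m) → Fin n}
    (hι : ∀ i, IsMinActuators Abar (block ι i)) (hγ : ∀ i, IsMinSensors Abar (block γ i))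
    {L : Fin (k + 1) → Finset (Fin m × Fin p)}
    (hL : ∀ i, IsSparsestPattern Abar (block ι i) (block γ i) (L i)) :
    IsOptimal Abar k (unionDesign ι γ L) := by
  refine isOptimal_unionDesign hA hι hγ (fun i => (hL i).1) fun i => ?_
  obtain ⟨L₀, hL₀⟩ := exists_isPairingOutcome (hι i).1.reachable (hγ i).reachable
  exact ((hL i).2 L₀ (hL₀.isSparsestPattern hA (hι i) (hγ i)).1).trans hL₀.card_le

/-! ### Total correctness with running times -/

/-- Started in `s`, the program halts after some number `t` of steps in a memory `s'` such that
`Q t s'`. -/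
def Ends (P : Program) (s : Memory) (Q : ℕ → Memory → Prop) : Prop :=
  ∃ t s', Run P s t s' ∧ Q t s'

theorem Ends.mono {P : Program} {s : Memory} {Q Q' : ℕ → Memory → Prop} (h : Ends P s Q)
    (hQ : ∀ t s', Q t s' → Q' t s') : Ends P s Q' := by
  obtain ⟨t, s', h1, h2⟩ := h
  exact ⟨t, s', h1, hQ _ _ h2⟩

theorem ends_assign {r : ℕ} {e : Expr} {s : Memory} {Q : ℕ → Memory → Prop} :
    Ends (.assign r e) s Q ↔
      Q (e.cost + 1) ⟨Function.update s.reg r (e.eval s), s.arr⟩ := by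
  constructor
  · rintro ⟨t, s', h, hQ⟩
    cases h
    exact hQ
  · exact fun h => ⟨_, _, .assign _ _ _, h⟩

theorem ends_store {a : ℕ} {e f : Expr} {s : Memory} {Q : ℕ → Memory → Prop} :
    Ends (.store a e f) s Q ↔ Q (e.cost + f.cost + 1) ⟨s.reg, Function.update s.arr a
      (Function.update (s.arr a) (e.eval s) (f.eval s))⟩ := by
  constructor
  · rintro ⟨t, s', h, hQ⟩
    cases h
    exact hQ
  · exact fun h => ⟨_, _, .store _ _ _ _, h⟩

theorem ends_seq {P R : Program} {s : Memory} {Q : ℕ → Memory → Prop} :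
    Ends (.seq P R) s Q ↔ Ends P s fun t s' => Ends R s' fun t' s'' => Q (t + t') s'' := by
  constructor
  · rintro ⟨t, s', h, hQ⟩
    cases h with
    | seq h1 h2 => exact ⟨_, _, h1, _, _, h2, hQ⟩
  · rintro ⟨t, s', h1, t', s'', h2, hQ⟩
    exact ⟨_, _, .seq h1 h2, hQ⟩

theorem ends_branch {e f : Expr} {P R : Program} {s : Memory} {Q : ℕ → Memory → Prop} :
    Ends (.branch e f P R) s Q ↔
      (e.eval s < f.eval s → Ends P s fun t s' => Q (e.cost + f.cost + 1 + t) s') ∧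
      (¬ e.eval s < f.eval s → Ends R s fun t s' => Q (e.cost + f.cost + 1 + t) s') := by
  constructor
  · rintro ⟨t, s', h, hQ⟩
    cases h with
    | branchTrue h1 h2 => exact ⟨fun _ => ⟨_, _, h2, hQ⟩, fun h => absurd h1 h⟩
    | branchFalse h1 h2 => exact ⟨fun h => absurd h h1, fun _ => ⟨_, _, h2, hQ⟩⟩
  · rintro ⟨h1, h2⟩
    by_cases h : e.eval s < f.eval s
    · obtain ⟨t, s', h3, hQ⟩ := h1 h
      exact ⟨_, _, .branchTrue h h3, hQ⟩
    · obtain ⟨t, s', h3, hQ⟩ := h2 h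
      exact ⟨_, _, .branchFalse h h3, hQ⟩

/-- The rule for loops: `I φ s` is an invariant with a budget `φ` that pays for all iterations;
as the test of the loop costs at least one step, the loop terminates. -/
theorem ends_loop {e f : Expr} {P : Program} (I : ℕ → Memory → Prop)
    (hstep : ∀ φ s, I φ s → e.eval s < f.eval s →
      Ends P s fun t s' => ∃ φ', I φ' s' ∧ e.cost + f.cost + 1 + t + φ' ≤ φ)
    {φ : ℕ} {s : Memory} (h : I φ s) :
    Ends (.loop e f P) s fun t s' => ∃ φ', I φ' s' ∧ ¬ e.eval s' < f.eval s' ∧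
      t + φ' ≤ φ + (e.cost + f.cost + 1) := by
  induction φ using Nat.strong_induction_on generalizing s with
  | _ φ ih =>
    by_cases hc : e.eval s < f.eval s
    · obtain ⟨t, s', hrun, φ', hI, hle⟩ := hstep φ s h hc
      obtain ⟨t', s'', hrun', φ'', hI', hc', hle'⟩ := ih φ' (by omega) hI
      exact ⟨_, _, .loopStep hc hrun hrun', φ'', hI', hc', by omega⟩
    · exact ⟨_, _, .loopStop hc, φ, h, hc, by omega⟩

/-- The program contains a store to the array `a`. -/
def Program.StoresTo : Program → ℕ → Prop
  | .assign _ _, _ => False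
  | .store b _ _, a => a = b
  | .seq P Q, a => P.StoresTo a ∨ Q.StoresTo a
  | .branch _ _ P Q, a => P.StoresTo a ∨ Q.StoresTo a
  | .loop _ _ P, a => P.StoresTo a

/-- The program contains an assignment to the register `r`. -/
def Program.AssignsTo : Program → ℕ → Prop
  | .assign q _, r => r = q
  | .store _ _ _, _ => False
  | .seq P Q, r => P.AssignsTo r ∨ Q.AssignsTo r
  | .branch _ _ P Q, r => P.AssignsTo r ∨ Q.AssignsTo r
  | .loop _ _ P, r => P.AssignsTo r

theorem Run.arr_eq {P : Program} {s s' : Memory} {t : ℕ} (h : Run P s t s') {a : ℕ}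
    (ha : ¬ P.StoresTo a) : s'.arr a = s.arr a := by
  induction h with
  | assign => rfl
  | store b e f s => exact Function.update_of_ne ha _ _
  | seq _ _ ih1 ih2 =>
    simp only [Program.StoresTo, not_or] at ha
    rw [ih2 ha.2, ih1 ha.1]
  | branchTrue _ _ ih => exact ih fun h => ha (Or.inl h)
  | branchFalse _ _ ih => exact ih fun h => ha (Or.inr h)
  | loopStop => rfl
  | loopStep _ _ _ ih1 ih2 => rw [ih2 ha, ih1 ha]

theorem Run.reg_eq {P : Program} {s s' : Memory} {t : ℕ} (h : Run P s t s') {r : ℕ}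
    (hr : ¬ P.AssignsTo r) : s'.reg r = s.reg r := by
  induction h with
  | assign q e s => exact Function.update_of_ne hr _ _
  | store => rfl
  | seq _ _ ih1 ih2 =>
    simp only [Program.AssignsTo, not_or] at hr
    rw [ih2 hr.2, ih1 hr.1]
  | branchTrue _ _ ih => exact ih fun h => hr (Or.inl h)
  | branchFalse _ _ ih => exact ih fun h => hr (Or.inr h)
  | loopStop => rfl
  | loopStep _ _ _ ih1 ih2 => rw [ih2 hr, ih1 hr]

theorem Ends.frame {P : Program} {s : Memory} {Q : ℕ → Memory → Prop} (h : Ends P s Q) :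
    Ends P s fun t s' => Q t s' ∧ (∀ a, ¬ P.StoresTo a → s'.arr a = s.arr a) ∧
      ∀ r, ¬ P.AssignsTo r → s'.reg r = s.reg r := by
  obtain ⟨t, s', h, hQ⟩ := h
  exact ⟨t, s', h, hQ, fun _ => h.arr_eq, fun _ => h.reg_eq⟩

/-! ### Linked lists -/

/-- Following the pointers `next` from `p` one reads off the list `l` of entries of `tgt`. The
pointer `0` ends the list, and the pointer `e + 1` refers to the position `e`, all of which are
less than `E`. -/
inductive Chain (next tgt : ℕ → ℕ) (E : ℕ) : ℕ → List ℕ → Prop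
  | nil : Chain next tgt E 0 []
  | cons {e : ℕ} {l : List ℕ} : e < E → Chain next tgt E (next e) l →
      Chain next tgt E (e + 1) (tgt e :: l)

theorem Chain.eq_nil {next tgt : ℕ → ℕ} {E : ℕ} {l : List ℕ} (h : Chain next tgt E 0 l) :
    l = [] := by
  cases h; rfl

theorem Chain.exists_cons {next tgt : ℕ → ℕ} {E p : ℕ} {l : List ℕ}
    (h : Chain next tgt E p l) (hp : 0 < p) :
    ∃ l', l = tgt (p - 1) :: l' ∧ Chain next tgt E (next (p - 1)) l' := by
  cases h with
  | nil => omega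
  | cons _ h => exact ⟨_, rfl, h⟩

theorem Chain.update {next tgt : ℕ → ℕ} {E p x y : ℕ} {l : List ℕ}
    (h : Chain next tgt E p l) :
    Chain (Function.update next E x) (Function.update tgt E y) (E + 1) p l := by
  induction h with
  | nil => exact .nil
  | @cons e l he _ ih =>
    have h1 : tgt e = Function.update tgt E y e := (Function.update_of_ne he.ne _ _).symm
    rw [h1]
    refine .cons (he.trans E.lt_succ_self) ?_
    rwa [Function.update_of_ne he.ne]

/-- The adjacency lists `adj` are stored as linked lists. -/
def Linked (head next tgt : ℕ → ℕ) (E : ℕ) (adj : ℕ → List ℕ) : Prop :=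
  ∀ u, Chain next tgt E (head u) (adj u)

theorem Linked.push {head next tgt : ℕ → ℕ} {E : ℕ} {adj : ℕ → List ℕ}
    (h : Linked head next tgt E adj) (u v : ℕ) :
    Linked (Function.update head u (E + 1)) (Function.update next E (head u))
      (Function.update tgt E v) (E + 1) (Function.update adj u (v :: adj u)) := by
  intro w
  by_cases hw : w = u
  · subst hw
    rw [Function.update_self, Function.update_self]
    have := Chain.cons (next := Function.update next E (head w))
      (tgt := Function.update tgt E v) E.lt_succ_self (l := adj w)
      (by rw [Function.update_self]; exact (h w).update)
    rwa [Function.update_self] at this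
  · rw [Function.update_of_ne hw, Function.update_of_ne hw]
    exact (h w).update

/-! ### Depth-first search -/

/-- Reachability in the digraph with adjacency lists `adj`. -/
abbrev Reach (adj : ℕ → List ℕ) : ℕ → ℕ → Prop := ReflTransGen fun u w => w ∈ adj u

/-- The invariant of a depth-first search that is abandoned as soon as it meets a flagged vertex.
`Proc` are the candidates from which a search has been started, `root` is the last of them. The
search has marked the vertices `v` with `mark v ≠ 0`, its stack is `stk 0, …, stk (sp - 1)`, and
`rem v` is the part of the adjacency list of `v` that has not been read yet, at which `cur v`
points. The `r` successful searches have led from `ma j` to the flagged vertex `ms j`; the arrays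
`ua` and `us` indicate these vertices. The vertices of `pend` have been read from a list, but not
been treated yet. -/
structure SearchInv (n : ℕ) (adj : ℕ → List ℕ) (next tgt : ℕ → ℕ) (E : ℕ) (fl : ℕ → ℕ)
    (Proc : ℕ → Prop) (root : ℕ) (pend : ℕ → Prop) (mark cur stk : ℕ → ℕ) (sp r : ℕ)
    (ma ms ua us : ℕ → ℕ) (rem : ℕ → List ℕ) : Prop where
  mark_lt : ∀ v, mark v ≠ 0 → v < n
  stk_mark : ∀ a < sp, mark (stk a) ≠ 0
  stk_zero : 0 < sp → stk 0 = root
  stk_step : ∀ a, a + 1 < sp → Reach adj (stk a) (stk (a + 1))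
  chain : ∀ v, mark v ≠ 0 → Chain next tgt E (cur v) (rem v)
  rem_new : ∀ v, mark v = 0 → rem v = adj v
  rem_sub : ∀ v, ∀ w ∈ rem v, w ∈ adj v
  rem_done : ∀ v, mark v ≠ 0 → ∀ w ∈ adj v, w ∈ rem v ∨ mark w ≠ 0 ∨ pend w
  status : ∀ v, mark v ≠ 0 → (∃ a < sp, stk a = v) ∨ (∀ w ∈ adj v, mark w ≠ 0) ∨
    ∃ j < r, Reach adj (ma j) v ∧ Reach adj v (ms j)
  flag_done : ∀ v, mark v ≠ 0 → fl v ≠ 0 → ∃ j < r, ms j = v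
  pair : ∀ j < r, Proc (ma j) ∧ mark (ma j) ≠ 0 ∧ mark (ms j) ≠ 0 ∧ fl (ms j) ≠ 0 ∧
    Reach adj (ma j) (ms j)
  ma_inj : ∀ i j, i < j → j < r → ma i ≠ ma j
  ms_inj : ∀ i j, i < j → j < r → ms i ≠ ms j
  root_new : 0 < sp → ∀ j < r, ma j ≠ root
  ua_iff : ∀ v, ua v ≠ 0 ↔ ∃ j < r, ma j = v
  us_iff : ∀ v, us v ≠ 0 ↔ ∃ j < r, ms j = v
  reached : ∀ v, mark v ≠ 0 → ∃ c, Proc c ∧ Reach adj c v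

section SearchInv

variable {n : ℕ} {adj : ℕ → List ℕ} {next tgt : ℕ → ℕ} {E : ℕ} {fl : ℕ → ℕ}
    {Proc : ℕ → Prop} {root : ℕ} {pend : ℕ → Prop} {mark cur stk : ℕ → ℕ} {sp r : ℕ}
    {ma ms ua us : ℕ → ℕ} {rem : ℕ → List ℕ}

theorem SearchInv.init (n : ℕ) (adj : ℕ → List ℕ) (next tgt : ℕ → ℕ) (E : ℕ)
    (fl cur stk ma ms : ℕ → ℕ) (root : ℕ) :
    SearchInv n adj next tgt E fl (fun _ => False) root (fun _ => False) (fun _ => 0)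
      cur stk 0 0 ma ms (fun _ => 0) (fun _ => 0) adj := by
  constructor <;> simp

theorem SearchInv.weaken (h : SearchInv n adj next tgt E fl Proc root pend mark cur stk sp r
    ma ms ua us rem) {Proc' pend' : ℕ → Prop} (hProc : ∀ c, Proc c → Proc' c)
    (hpend : ∀ w, pend w → mark w ≠ 0 ∨ pend' w) :
    SearchInv n adj next tgt E fl Proc' root pend' mark cur stk sp r ma ms ua us rem :=
  { h with
    rem_done := fun v hv w hw => (h.rem_done v hv w hw).imp_right fun h1 =>
      h1.elim Or.inl (hpend w)
    pair := fun j hj => (h.pair j hj).imp_left (hProc _)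
    reached := fun v hv => (h.reached v hv).imp fun _ hc => hc.imp_left (hProc _) }

/-- With an empty stack the name of the current root is irrelevant. -/
theorem SearchInv.change_root (h : SearchInv n adj next tgt E fl Proc root pend mark cur stk 0 r
    ma ms ua us rem) (root' : ℕ) :
    SearchInv n adj next tgt E fl Proc root' pend mark cur stk 0 r ma ms ua us rem :=
  { h with
    stk_zero := fun h0 => absurd h0 (lt_irrefl 0)
    root_new := fun h0 => absurd h0 (lt_irrefl 0) }

theorem SearchInv.reach_stk (h : SearchInv n adj next tgt E fl Proc root pend mark cur stk sp r
    ma ms ua us rem) {a b : ℕ} (hab : a ≤ b) (hb : b < sp) : Reach adj (stk a) (stk b) := by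
  induction b, hab using Nat.le_induction with
  | base => exact .refl
  | succ b _ ih => exact (ih (by omega)).trans (h.stk_step b hb)

theorem SearchInv.root_reach_stk (h : SearchInv n adj next tgt E fl Proc root pend mark cur stk sp
    r ma ms ua us rem) {a : ℕ} (ha : a < sp) : Reach adj root (stk a) := by
  rw [← h.stk_zero (by omega)]
  exact h.reach_stk (Nat.zero_le a) ha

/-- Marking and pushing an unflagged vertex. -/
theorem SearchInv.visit (h : SearchInv n adj next tgt E fl Proc root pend mark cur stk sp r
    ma ms ua us rem) {v p : ℕ} (hv : v < n) (hmv : mark v = 0) (hpend : ∀ w, pend w → w = v)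
    (hProc : Proc root) (hroot : Reach adj root v) (htop : 0 < sp → Reach adj (stk (sp - 1)) v)
    (hbot : sp = 0 → v = root) (hnew : ∀ j < r, ma j ≠ root)
    (hp : Chain next tgt E p (adj v)) (hfl : fl v = 0) :
    SearchInv n adj next tgt E fl Proc root (fun _ => False) (Function.update mark v 1)
      (Function.update cur v p) (Function.update stk sp v) (sp + 1) r ma ms ua us rem := by
  have hne : ∀ w, mark w ≠ 0 → w ≠ v := by rintro w hw rfl; exact hw hmv
  have hm : ∀ w, Function.update mark v 1 w ≠ 0 ↔ w = v ∨ mark w ≠ 0 := by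
    intro w
    by_cases hw : w = v
    · simp [hw]
    · simp [hw]
  have hs : ∀ a < sp, Function.update stk sp v a = stk a := fun a ha =>
    Function.update_of_ne ha.ne _ _
  constructor
  · intro w hw
    rcases (hm w).1 hw with rfl | hw
    · exact hv
    · exact h.mark_lt w hw
  · intro a ha
    rw [hm]
    rcases Nat.lt_succ_iff_lt_or_eq.1 ha with ha | rfl
    · rw [hs a ha]; exact Or.inr (h.stk_mark a ha)
    · rw [Function.update_self]; exact Or.inl rfl
  · intro _
    rcases Nat.eq_zero_or_pos sp with h0 | h0
    · subst h0; rw [Function.update_self]; exact hbot rfl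
    · rw [hs 0 h0]; exact h.stk_zero h0
  · intro a ha
    rcases Nat.lt_succ_iff_lt_or_eq.1 ha with ha | rfl
    · rw [hs a (by omega), hs _ ha]; exact h.stk_step a ha
    · rw [hs a (by omega), Function.update_self]; exact htop (by omega)
  · intro w hw
    rcases (hm w).1 hw with rfl | hw
    · rw [Function.update_self, h.rem_new _ hmv]; exact hp
    · rw [Function.update_of_ne (hne w hw)]; exact h.chain w hw
  · intro w hw
    refine h.rem_new w ?_
    by_contra hno
    exact (hm w).2 (Or.inr hno) hw
  · exact h.rem_sub
  · intro w hw x hx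
    rw [hm]
    rcases (hm w).1 hw with rfl | hw
    · rw [h.rem_new _ hmv]; exact Or.inl hx
    · rcases h.rem_done w hw x hx with h1 | h1 | h1
      · exact Or.inl h1
      · exact Or.inr (Or.inl (Or.inr h1))
      · exact Or.inr (Or.inl (Or.inl (hpend x h1)))
  · intro w hw
    rcases (hm w).1 hw with rfl | hw
    · exact Or.inl ⟨sp, sp.lt_succ_self, Function.update_self ..⟩
    · rcases h.status w hw with ⟨a, ha, h1⟩ | h1 | h1
      · exact Or.inl ⟨a, by omega, by rw [hs a ha, h1]⟩
      · exact Or.inr (Or.inl fun x hx => (hm x).2 (Or.inr (h1 x hx)))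
      · exact Or.inr (Or.inr h1)
  · intro w hw hfw
    rcases (hm w).1 hw with rfl | hw
    · exact absurd hfl hfw
    · exact h.flag_done w hw hfw
  · intro j hj
    obtain ⟨h1, h2, h3, h4⟩ := h.pair j hj
    exact ⟨h1, (hm _).2 (Or.inr h2), (hm _).2 (Or.inr h3), h4⟩
  · exact h.ma_inj
  · exact h.ms_inj
  · exact fun _ => hnew
  · exact h.ua_iff
  · exact h.us_iff
  · intro w hw
    rcases (hm w).1 hw with rfl | hw
    · exact ⟨root, hProc, hroot⟩
    · exact h.reached w hw

/-- Marking a flagged vertex ends the search: all vertices of the stack lie on a path from the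
root to this vertex. -/
theorem SearchInv.visit_flagged (h : SearchInv n adj next tgt E fl Proc root pend mark cur stk sp r
    ma ms ua us rem) {v p : ℕ} (hv : v < n) (hmv : mark v = 0) (hpend : ∀ w, pend w → w = v)
    (hProc : Proc root) (hroot : Reach adj root v) (htop : 0 < sp → Reach adj (stk (sp - 1)) v)
    (hmroot : sp = 0 → v = root) (hnew : ∀ j < r, ma j ≠ root)
    (hp : Chain next tgt E p (adj v)) (hfl : fl v ≠ 0) (stk' : ℕ → ℕ) :
    SearchInv n adj next tgt E fl Proc root (fun _ => False) (Function.update mark v 1)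
      (Function.update cur v p) stk' 0 (r + 1) (Function.update ma r root)
      (Function.update ms r v) (Function.update ua root 1) (Function.update us v 1) rem := by
  have hne : ∀ w, mark w ≠ 0 → w ≠ v := by rintro w hw rfl; exact hw hmv
  have hm : ∀ w, Function.update mark v 1 w ≠ 0 ↔ w = v ∨ mark w ≠ 0 := by
    intro w
    by_cases hw : w = v
    · simp [hw]
    · simp [hw]
  have hA : ∀ j < r, Function.update ma r root j = ma j := fun a ha =>
    Function.update_of_ne ha.ne _ _
  have hB : ∀ j < r, Function.update ms r v j = ms j := fun a ha =>
    Function.update_of_ne ha.ne _ _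
  have hex : ∀ {P : ℕ → ℕ → Prop}, (∃ j < r, P (ma j) (ms j)) →
      ∃ j < r + 1, P (Function.update ma r root j) (Function.update ms r v j) := by
    rintro P ⟨j, hj, h1⟩
    exact ⟨j, by omega, by rwa [hA j hj, hB j hj]⟩
  constructor
  · intro w hw
    rcases (hm w).1 hw with rfl | hw
    · exact hv
    · exact h.mark_lt w hw
  · intro a ha; omega
  · intro h0; omega
  · intro a ha; omega
  · intro w hw
    rcases (hm w).1 hw with rfl | hw
    · rw [Function.update_self, h.rem_new _ hmv]; exact hp
    · rw [Function.update_of_ne (hne w hw)]; exact h.chain w hw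
  · intro w hw
    refine h.rem_new w ?_
    by_contra hno
    exact (hm w).2 (Or.inr hno) hw
  · exact h.rem_sub
  · intro w hw x hx
    rw [hm]
    rcases (hm w).1 hw with rfl | hw
    · rw [h.rem_new _ hmv]; exact Or.inl hx
    · rcases h.rem_done w hw x hx with h1 | h1 | h1
      · exact Or.inl h1
      · exact Or.inr (Or.inl (Or.inr h1))
      · exact Or.inr (Or.inl (Or.inl (hpend x h1)))
  · intro w hw
    rcases (hm w).1 hw with rfl | hw
    · refine Or.inr (Or.inr ⟨r, r.lt_succ_self, ?_⟩)
      rw [Function.update_self, Function.update_self]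
      exact ⟨hroot, .refl⟩
    · rcases h.status w hw with ⟨a, ha, rfl⟩ | h1 | h1
      · refine Or.inr (Or.inr ⟨r, r.lt_succ_self, ?_⟩)
        rw [Function.update_self, Function.update_self]
        exact ⟨h.root_reach_stk ha,
          (h.reach_stk (b := sp - 1) (by omega) (by omega)).trans (htop (by omega))⟩
      · exact Or.inr (Or.inl fun x hx => (hm x).2 (Or.inr (h1 x hx)))
      · exact Or.inr (Or.inr (hex (P := fun a b => Reach adj a w ∧ Reach adj w b) h1))
  · intro w hw hfw
    rcases (hm w).1 hw with rfl | hw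
    · exact ⟨r, r.lt_succ_self, Function.update_self ..⟩
    · exact hex (P := fun _ b => b = w) (h.flag_done w hw hfw)
  · intro j hj
    rcases Nat.lt_succ_iff_lt_or_eq.1 hj with hj | rfl
    · rw [hA j hj, hB j hj]
      obtain ⟨h1, h2, h3, h4⟩ := h.pair j hj
      exact ⟨h1, (hm _).2 (Or.inr h2), (hm _).2 (Or.inr h3), h4⟩
    · rw [Function.update_self, Function.update_self]
      refine ⟨hProc, ?_, (hm _).2 (Or.inl rfl), hfl, hroot⟩
      rw [hm]
      rcases Nat.eq_zero_or_pos sp with h0 | h0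
      · exact Or.inl (hmroot h0).symm
      · rw [← h.stk_zero h0]; exact Or.inr (h.stk_mark 0 h0)
  · intro i j hij hj
    rcases Nat.lt_succ_iff_lt_or_eq.1 hj with hj | rfl
    · rw [hA i (by omega), hA j hj]; exact h.ma_inj i j hij hj
    · rw [hA i hij, Function.update_self]; exact hnew i hij
  · intro i j hij hj
    rcases Nat.lt_succ_iff_lt_or_eq.1 hj with hj | rfl
    · rw [hB i (by omega), hB j hj]; exact h.ms_inj i j hij hj
    · rw [hB i hij, Function.update_self]; exact hne _ (h.pair i hij).2.2.1
  · intro h0; omega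
  · intro w
    by_cases hw : w = root
    · subst hw
      rw [Function.update_self]
      simp only [ne_eq, one_ne_zero, not_false_eq_true, true_iff]
      exact ⟨r, r.lt_succ_self, Function.update_self ..⟩
    · rw [Function.update_of_ne hw, h.ua_iff]
      constructor
      · exact hex (P := fun a _ => a = w)
      · rintro ⟨j, hj, h1⟩
        rcases Nat.lt_succ_iff_lt_or_eq.1 hj with hj | rfl
        · exact ⟨j, hj, by rwa [hA j hj] at h1⟩
        · rw [Function.update_self] at h1; exact absurd h1.symm hw
  · intro w
    by_cases hw : w = v
    · subst hw
      rw [Function.update_self]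
      simp only [ne_eq, one_ne_zero, not_false_eq_true, true_iff]
      exact ⟨r, r.lt_succ_self, Function.update_self ..⟩
    · rw [Function.update_of_ne hw, h.us_iff]
      constructor
      · exact hex (P := fun _ a => a = w)
      · rintro ⟨j, hj, h1⟩
        rcases Nat.lt_succ_iff_lt_or_eq.1 hj with hj | rfl
        · exact ⟨j, hj, by rwa [hB j hj] at h1⟩
        · rw [Function.update_self] at h1; exact absurd h1.symm hw
  · intro w hw
    rcases (hm w).1 hw with rfl | hw
    · exact ⟨root, hProc, hroot⟩
    · exact h.reached w hw

/-- Reading the next entry of the adjacency list of the top of the stack. -/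
theorem SearchInv.advance (h : SearchInv n adj next tgt E fl Proc root (fun _ => False) mark cur
    stk sp r ma ms ua us rem) {u : ℕ} (hu : mark u ≠ 0) (hp : 0 < cur u) :
    ∃ l, rem u = tgt (cur u - 1) :: l ∧
      SearchInv n adj next tgt E fl Proc root (· = tgt (cur u - 1)) mark
        (Function.update cur u (next (cur u - 1))) stk sp r ma ms ua us
        (Function.update rem u l) := by
  obtain ⟨l, hl, hch⟩ := (h.chain u hu).exists_cons hp
  refine ⟨l, hl, { h with chain := ?_, rem_new := ?_, rem_sub := ?_, rem_done := ?_ }⟩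
  · intro w hw
    by_cases hwu : w = u
    · subst hwu; rw [Function.update_self, Function.update_self]; exact hch
    · rw [Function.update_of_ne hwu, Function.update_of_ne hwu]; exact h.chain w hw
  · intro w hw
    rw [Function.update_of_ne (by rintro rfl; exact hu hw)]
    exact h.rem_new w hw
  · intro w x hx
    by_cases hwu : w = u
    · subst hwu
      rw [Function.update_self] at hx
      exact h.rem_sub w x (by rw [hl]; exact List.mem_cons_of_mem _ hx)
    · rw [Function.update_of_ne hwu] at hx; exact h.rem_sub w x hx
  · intro w hw x hx
    rcases h.rem_done w hw x hx with h1 | h1 | h1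
    · by_cases hwu : w = u
      · subst hwu
        rw [Function.update_self]
        rw [hl] at h1
        rcases List.mem_cons.1 h1 with h1 | h1
        · exact Or.inr (Or.inr h1)
        · exact Or.inl h1
      · rw [Function.update_of_ne hwu]; exact Or.inl h1
    · exact Or.inr (Or.inl h1)
    · exact h1.elim

/-- Removing a vertex from the stack when its adjacency list is exhausted. -/
theorem SearchInv.pop (h : SearchInv n adj next tgt E fl Proc root (fun _ => False) mark cur
    stk sp r ma ms ua us rem) (hsp : 0 < sp) (hp : cur (stk (sp - 1)) = 0) :
    SearchInv n adj next tgt E fl Proc root (fun _ => False) mark cur stk (sp - 1) r ma ms ua us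
      rem := by
  have hu : mark (stk (sp - 1)) ≠ 0 := h.stk_mark _ (by omega)
  refine { h with stk_mark := ?_, stk_zero := ?_, stk_step := ?_, status := ?_, root_new := ?_ }
  · exact fun a ha => h.stk_mark a (by omega)
  · exact fun h0 => h.stk_zero hsp
  · exact fun a ha => h.stk_step a (by omega)
  · intro w hw
    rcases h.status w hw with ⟨a, ha, rfl⟩ | h1 | h1
    · by_cases hat : a = sp - 1
      · subst hat
        refine Or.inr (Or.inl fun x hx => ?_)
        rcases h.rem_done _ hu x hx with h1 | h1 | h1
        · have := h.chain _ hu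
          rw [hp] at this
          rw [this.eq_nil] at h1
          exact absurd h1 List.not_mem_nil
        · exact h1
        · exact h1.elim
      · exact Or.inl ⟨a, by omega, rfl⟩
    · exact Or.inr (Or.inl h1)
    · exact Or.inr (Or.inr h1)
  · exact fun _ => h.root_new hsp

end SearchInv

/-- The number of steps that the search has still to make: unread entries of adjacency lists, and
two steps for each unmarked vertex. -/
def weight (n : ℕ) (mark : ℕ → ℕ) (rem : ℕ → List ℕ) : ℕ :=
  ∑ v ∈ Finset.range n, ((rem v).length + if mark v = 0 then 2 else 0)

theorem weight_update_mark {n : ℕ} {mark : ℕ → ℕ} {v : ℕ} (hv : v < n)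
    (hm : mark v = 0) (rem : ℕ → List ℕ) :
    weight n (Function.update mark v 1) rem + 2 = weight n mark rem := by
  have hv' : v ∈ Finset.range n := Finset.mem_range.2 hv
  unfold weight
  rw [← Finset.add_sum_erase _ _ hv', ← Finset.add_sum_erase _ _ hv', Function.update_self, hm]
  have : ∑ x ∈ (Finset.range n).erase v,
        ((rem x).length + if Function.update mark v 1 x = 0 then 2 else 0) =
      ∑ x ∈ (Finset.range n).erase v, ((rem x).length + if mark x = 0 then 2 else 0) :=
    Finset.sum_congr rfl fun x hx => by
      rw [Function.update_of_ne (Finset.ne_of_mem_erase hx)]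
  rw [this]
  simp only [one_ne_zero, if_false, if_true]
  omega

theorem weight_update_rem {n : ℕ} (mark : ℕ → ℕ) {u w : ℕ} (hu : u < n)
    {rem : ℕ → List ℕ} {l : List ℕ} (hl : rem u = w :: l) :
    weight n mark (Function.update rem u l) + 1 = weight n mark rem := by
  have hu' : u ∈ Finset.range n := Finset.mem_range.2 hu
  unfold weight
  rw [← Finset.add_sum_erase _ _ hu', ← Finset.add_sum_erase _ _ hu', Function.update_self, hl]
  have : ∑ x ∈ (Finset.range n).erase u,
        ((Function.update rem u l x).length + if mark x = 0 then 2 else 0) =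
      ∑ x ∈ (Finset.range n).erase u, ((rem x).length + if mark x = 0 then 2 else 0) :=
    Finset.sum_congr rfl fun x hx => by
      rw [Function.update_of_ne (Finset.ne_of_mem_erase hx)]
  rw [this]
  simp only [List.length_cons]
  omega

/-! ### The search program -/

/-- Mark the vertex in register `8` in the array `M`, and push it on the stack. If it is flagged
in the array `Fl`, record it together with the root in register `9`, and empty the stack. -/
def visitProgram (H M Fl : ℕ) : Program :=
  .seq (.store M (.reg 8) (.const 1)) <|
  .seq (.store 9 (.reg 8) (.get H (.reg 8))) <|
  .seq (.store 10 (.reg 5) (.reg 8)) <|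
  .seq (.assign 5 (.add (.reg 5) (.const 1))) <|
  .branch (.const 0) (.get Fl (.reg 8))
    (.seq (.store 11 (.reg 4) (.reg 9)) <|
     .seq (.store 12 (.reg 4) (.reg 8)) <|
     .seq (.store 13 (.reg 9) (.const 1)) <|
     .seq (.store 14 (.reg 8) (.const 1)) <|
     .seq (.assign 4 (.add (.reg 4) (.const 1))) <|
     .assign 5 (.const 0))
    (.assign 5 (.reg 5))

/-- One step of the search: read the next entry of the adjacency list of the top of the stack, or
remove the top if there is none. -/
def searchStep (H N T M Fl : ℕ) : Program :=
  .seq (.assign 6 (.get 10 (.sub (.reg 5) (.const 1)))) <|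
  .seq (.assign 7 (.get 9 (.reg 6))) <|
  .branch (.const 0) (.reg 7)
    (.seq (.store 9 (.reg 6) (.get N (.sub (.reg 7) (.const 1)))) <|
     .seq (.assign 8 (.get T (.sub (.reg 7) (.const 1)))) <|
     .branch (.get M (.reg 8)) (.const 1) (visitProgram H M Fl) (.assign 7 (.const 0)))
    (.assign 5 (.sub (.reg 5) (.const 1)))

/-- Search from the next candidate of the array `C`, and record it in the array `M + 1` of roots,
unless it has been marked. -/
def scanStep (H N T C M Fl : ℕ) : Program :=
  .seq (.assign 2 (.sub (.reg 2) (.const 1))) <|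
  .seq (.assign 8 (.get C (.reg 2))) <|
  .branch (.get M (.reg 8)) (.const 1)
    (.seq (.assign 9 (.reg 8)) <|
     .seq (.store (M + 1) (.reg 3) (.reg 8)) <|
     .seq (.assign 3 (.add (.reg 3) (.const 1))) <|
     .seq (visitProgram H M Fl) <|
     .loop (.const 0) (.reg 5) (searchStep H N T M Fl))
    (.assign 7 (.const 0))

/-- Search from the candidates in the array `C`, whose number is in register `2`, in reverse
order. -/
def scanProgram (H N T C M Fl : ℕ) : Program :=
  .seq (.assign 3 (.const 0)) <|
  .seq (.assign 5 (.const 0)) <|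
  .loop (.const 0) (.reg 2) (scanStep H N T C M Fl)

/-- The arrays of a search do not overlap: those of the digraph (`H`, `N`, `T`), the candidates
(`C`), the marks (`M`), the roots (`M + 1`), the flags (`Fl`), and the arrays `9` to `14`. -/
structure ScanArrays (H N T C M Fl : ℕ) : Prop where
  hH : H < 9
  hN : N < 9
  hT : T < 9
  hC : C < 9 ∨ 16 < C ∧ C < M
  hM : 16 < M
  hFl : 14 < Fl
  hFl' : Fl < 17

/-- The search invariant for the data in a memory. -/
def MemInv (H N T M Fl n E : ℕ) (adj : ℕ → List ℕ) (Proc pend : ℕ → Prop) (rem : ℕ → List ℕ)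
    (s : Memory) : Prop :=
  Linked (s.arr H) (s.arr N) (s.arr T) E adj ∧
  SearchInv n adj (s.arr N) (s.arr T) E (s.arr Fl) Proc (s.reg 9) pend (s.arr M) (s.arr 9)
    (s.arr 10) (s.reg 5) (s.reg 4) (s.arr 11) (s.arr 12) (s.arr 13) (s.arr 14) rem

theorem visitProgram_spec {H N T C M Fl n E : ℕ} {adj : ℕ → List ℕ} {Proc pend : ℕ → Prop}
    {rem : ℕ → List ℕ} {s : Memory} (ha : ScanArrays H N T C M Fl)
    (h : MemInv H N T M Fl n E adj Proc pend rem s) (hv : s.reg 8 < n)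
    (hmv : s.arr M (s.reg 8) = 0) (hpend : ∀ w, pend w → w = s.reg 8)
    (hProc : Proc (s.reg 9)) (hroot : Reach adj (s.reg 9) (s.reg 8))
    (htop : 0 < s.reg 5 → Reach adj (s.arr 10 (s.reg 5 - 1)) (s.reg 8))
    (hbot : s.reg 5 = 0 → s.reg 8 = s.reg 9) (hnew : ∀ j < s.reg 4, s.arr 11 j ≠ s.reg 9) :
    Ends (visitProgram H M Fl) s fun t s' => t ≤ 40 ∧
      MemInv H N T M Fl n E adj Proc (fun _ => False) rem s' ∧ s'.reg 5 ≤ s.reg 5 + 1 ∧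
      weight n (s'.arr M) rem + 2 = weight n (s.arr M) rem ∧
      (∀ v, s.arr M v ≠ 0 ∨ v = s.reg 8 → s'.arr M v ≠ 0) := by
  obtain ⟨hH, hN, hT, hC, hM, hFl, hFl'⟩ := ha
  obtain ⟨hl, h⟩ := h
  have hw := weight_update_mark hv hmv rem
  have hmono : ∀ v, s.arr M v ≠ 0 ∨ v = s.reg 8 →
      Function.update (s.arr M) (s.reg 8) 1 v ≠ 0 := by
    intro v hv
    by_cases h : v = s.reg 8
    · rw [h, Function.update_self]; exact one_ne_zero
    · rw [Function.update_of_ne h]; exact hv.resolve_right h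
  simp only [visitProgram, ends_seq, ends_assign, ends_store, ends_branch, Expr.eval, Expr.cost,
    MemInv]
  simp (disch := omega) only [Function.update_of_ne, Function.update_self]
  constructor
  · intro hf
    refine ⟨by omega, ⟨hl, ?_⟩, by omega, hw, hmono⟩
    exact h.visit_flagged hv hmv hpend hProc hroot htop hbot hnew (hl _) hf.ne' _
  · intro hf
    refine ⟨by omega, ⟨hl, ?_⟩, by omega, hw, hmono⟩
    exact h.visit hv hmv hpend hProc hroot htop hbot hnew (hl _) (by omega)

theorem searchStep_spec {H N T C M Fl n E : ℕ} {adj : ℕ → List ℕ} {Proc : ℕ → Prop}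
    {rem : ℕ → List ℕ} {s : Memory} (ha : ScanArrays H N T C M Fl)
    (hadj : ∀ u, ∀ w ∈ adj u, w < n)
    (h : MemInv H N T M Fl n E adj Proc (fun _ => False) rem s)
    (hProc : Proc (s.reg 9)) (hsp : 0 < s.reg 5) :
    Ends (searchStep H N T M Fl) s fun t s' => t ≤ 70 ∧
      (∀ v, s.arr M v ≠ 0 → s'.arr M v ≠ 0) ∧ ∃ rem',
      MemInv H N T M Fl n E adj Proc (fun _ => False) rem' s' ∧
      weight n (s'.arr M) rem' + s'.reg 5 + 1 ≤ weight n (s.arr M) rem + s.reg 5 := by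
  have ha' := ha
  obtain ⟨hH, hN, hT, hC, hM, hFl, hFl'⟩ := ha
  obtain ⟨hl, h⟩ := h
  have hu : s.arr M (s.arr 10 (s.reg 5 - 1)) ≠ 0 := h.stk_mark _ (by omega)
  simp only [searchStep, ends_seq, ends_assign, ends_store, ends_branch, Expr.eval, Expr.cost]
  simp (disch := omega) only [Function.update_of_ne, Function.update_self]
  refine ⟨fun hp => ⟨fun hm => ?_, fun hm => ?_⟩, fun hp => ?_⟩
  · obtain ⟨l, hrem, h'⟩ := h.advance hu hp
    have hw := weight_update_rem (s.arr M) (h.mark_lt _ hu) hrem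
    have hmem := h.rem_sub _ _ (hrem ▸ List.mem_cons_self)
    refine (visitProgram_spec (n := n) (E := E) (adj := adj) (Proc := Proc)
      (rem := Function.update rem (s.arr 10 (s.reg 5 - 1)) l)
      (pend := (· = s.arr T (s.arr 9 (s.arr 10 (s.reg 5 - 1)) - 1))) ha' ⟨?_, ?_⟩ ?_ ?_ ?_ ?_ ?_ ?_
      ?_ ?_).mono ?_
    all_goals (simp (disch := omega) only [Function.update_of_ne, Function.update_self])
    · exact hl
    · exact h'
    · exact hadj _ _ hmem
    · omega
    · exact fun _ h => h
    · exact hProc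
    · exact (h.root_reach_stk (a := s.reg 5 - 1) (by omega)).tail hmem
    · exact fun _ => .single hmem
    · omega
    · exact h.root_new hsp
    · rintro t s' ⟨h1, h2, h3, h4, h5⟩
      exact ⟨by omega, fun v hv => h5 v (Or.inl hv), _, h2, by omega⟩
  · obtain ⟨l, hrem, h'⟩ := h.advance hu hp
    have hw := weight_update_rem (s.arr M) (h.mark_lt _ hu) hrem
    refine ⟨by omega, fun _ h => h, Function.update rem (s.arr 10 (s.reg 5 - 1)) l, ⟨?_, ?_⟩, ?_⟩
    · simp (disch := omega) only [Function.update_of_ne]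
      exact hl
    · simp (disch := omega) only [Function.update_of_ne, Function.update_self]
      refine h'.weaken (fun _ h => h) ?_
      rintro w rfl
      exact Or.inl (by omega)
    · omega
  · refine ⟨by omega, fun _ h => h, rem, ⟨hl, ?_⟩, ?_⟩
    · simp (disch := omega) only [Function.update_of_ne, Function.update_self]
      exact h.pop hsp (by omega)
    · omega

/-! ### Scanning a list of candidates -/

/-- The list `ρ 0, …, ρ (cnt - 1)` of the roots of the searches from the candidates
`c (num - 1), …, c i`, in this order: those that are not reachable from an earlier candidate. -/
structure RootList (adj : ℕ → List ℕ) (c : ℕ → ℕ) (num i : ℕ) (ρ : ℕ → ℕ) (cnt : ℕ) : Prop where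
  mem : ∀ a < cnt, ∃ j, i ≤ j ∧ j < num ∧ ρ a = c j ∧
    ∀ j', j < j' → j' < num → ¬ Reach adj (c j') (c j)
  cover : ∀ j, i ≤ j → j < num → ∃ a < cnt, Reach adj (ρ a) (c j)
  later : ∀ a b, a < b → b < cnt → ¬ Reach adj (ρ a) (ρ b)

theorem RootList.push {adj : ℕ → List ℕ} {c : ℕ → ℕ} {num i : ℕ} {ρ : ℕ → ℕ} {cnt : ℕ}
    (h : RootList adj c num (i + 1) ρ cnt) (hi : i < num)
    (hnew : ∀ j, i < j → j < num → ¬ Reach adj (c j) (c i)) :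
    RootList adj c num i (Function.update ρ cnt (c i)) (cnt + 1) := by
  have hρ : ∀ a < cnt, Function.update ρ cnt (c i) a = ρ a := fun a ha =>
    Function.update_of_ne ha.ne _ _
  constructor
  · intro a ha
    rcases Nat.lt_succ_iff_lt_or_eq.1 ha with ha | rfl
    · obtain ⟨j, h1, h2, h3, h4⟩ := h.mem a ha
      exact ⟨j, by omega, h2, by rw [hρ a ha, h3], h4⟩
    · exact ⟨i, le_rfl, hi, Function.update_self .., hnew⟩
  · intro j hj hj'
    rcases Nat.eq_or_lt_of_le hj with rfl | hj
    · exact ⟨cnt, cnt.lt_succ_self, by rw [Function.update_self]⟩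
    · obtain ⟨a, ha, h1⟩ := h.cover j hj hj'
      exact ⟨a, by omega, by rwa [hρ a ha]⟩
  · intro a b hab hb
    rcases Nat.lt_succ_iff_lt_or_eq.1 hb with hb | rfl
    · rw [hρ a (by omega), hρ b hb]; exact h.later a b hab hb
    · rw [hρ a hab, Function.update_self]
      obtain ⟨j, h1, h2, h3, -⟩ := h.mem a hab
      rw [h3]
      exact hnew j h1 h2

theorem RootList.skip {adj : ℕ → List ℕ} {c : ℕ → ℕ} {num i : ℕ} {ρ : ℕ → ℕ} {cnt : ℕ}
    (h : RootList adj c num (i + 1) ρ cnt)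
    (hold : ∃ j, i < j ∧ j < num ∧ Reach adj (c j) (c i)) :
    RootList adj c num i ρ cnt := by
  refine ⟨fun a ha => ?_, fun j hj hj' => ?_, h.later⟩
  · obtain ⟨j, h1, h2⟩ := h.mem a ha
    exact ⟨j, by omega, h2⟩
  · rcases Nat.eq_or_lt_of_le hj with rfl | hj
    · obtain ⟨j, h1, h2, h3⟩ := hold
      obtain ⟨a, ha, h4⟩ := h.cover j h1 h2
      exact ⟨a, ha, h4.trans h3⟩
    · exact h.cover j hj hj'

/-- The candidates with an index in `[i, num)`. -/
def Processed (c : ℕ → ℕ) (num i : ℕ) (x : ℕ) : Prop := ∃ j, i ≤ j ∧ j < num ∧ c j = x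

theorem SearchInv.r_eq_zero {n : ℕ} {adj : ℕ → List ℕ} {next tgt : ℕ → ℕ} {E : ℕ} {fl : ℕ → ℕ}
    {Proc : ℕ → Prop} {root : ℕ} {pend : ℕ → Prop} {mark cur stk : ℕ → ℕ} {sp r : ℕ}
    {ma ms ua us : ℕ → ℕ} {rem : ℕ → List ℕ}
    (h : SearchInv n adj next tgt E fl Proc root pend mark cur stk sp r ma ms ua us rem)
    (hfl : ∀ v, fl v = 0) : r = 0 := by
  by_contra hr
  exact (h.pair 0 (by omega)).2.2.2.1 (hfl _)

/-- Without flags the marked vertices are closed under successors when the stack is empty. -/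
theorem SearchInv.mark_of_reach {n : ℕ} {adj : ℕ → List ℕ} {next tgt : ℕ → ℕ} {E : ℕ}
    {fl : ℕ → ℕ} {Proc : ℕ → Prop} {root : ℕ} {pend : ℕ → Prop} {mark cur stk : ℕ → ℕ} {r : ℕ}
    {ma ms ua us : ℕ → ℕ} {rem : ℕ → List ℕ}
    (h : SearchInv n adj next tgt E fl Proc root pend mark cur stk 0 r ma ms ua us rem)
    (hfl : ∀ v, fl v = 0) {u v : ℕ} (hu : mark u ≠ 0) (huv : Reach adj u v) : mark v ≠ 0 := by
  induction huv with
  | refl => exact hu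
  | tail _ hbc ih =>
    rcases h.status _ ih with ⟨a, ha, -⟩ | h1 | ⟨j, hj, -⟩
    · omega
    · exact h1 _ hbc
    · rw [h.r_eq_zero hfl] at hj; omega

/-- The loop invariant of a scan. -/
structure ScanInv (H N T C M Fl n E : ℕ) (adj : ℕ → List ℕ) (c fl : ℕ → ℕ) (num : ℕ)
    (rem : ℕ → List ℕ) (s : Memory) : Prop where
  inv : MemInv H N T M Fl n E adj (Processed c num (s.reg 2)) (fun _ => False) rem s
  sp : s.reg 5 = 0
  le : s.reg 2 ≤ num
  cand : s.arr C = c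
  flag : s.arr Fl = fl
  marked : ∀ j, s.reg 2 ≤ j → j < num → s.arr M (c j) ≠ 0
  roots : (∀ v, fl v = 0) → RootList adj c num (s.reg 2) (s.arr (M + 1)) (s.reg 3)

theorem scanStep_spec {H N T C M Fl n E : ℕ} {adj : ℕ → List ℕ} {c fl : ℕ → ℕ} {num : ℕ}
    {rem : ℕ → List ℕ} {s : Memory} (ha : ScanArrays H N T C M Fl)
    (hadj : ∀ u, ∀ w ∈ adj u, w < n) (hc : ∀ j < num, c j < n)
    (h : ScanInv H N T C M Fl n E adj c fl num rem s) (hi : 0 < s.reg 2) :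
    Ends (scanStep H N T C M Fl) s fun t s' => ∃ rem',
      ScanInv H N T C M Fl n E adj c fl num rem' s' ∧
      t + (80 * weight n (s'.arr M) rem' + 150 * s'.reg 2) + 3 ≤
        80 * weight n (s.arr M) rem + 150 * s.reg 2 := by
  have ha' := ha
  obtain ⟨hH, hN, hT, hC, hM, hFl, hFl'⟩ := ha
  obtain ⟨⟨hl, h⟩, hsp, hle, rfl, rfl, hmk, hroots⟩ := h
  obtain ⟨i, hi⟩ : ∃ i, s.reg 2 = i + 1 := ⟨s.reg 2 - 1, by omega⟩
  rw [hi] at hmk hroots h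
  rw [hsp] at h
  simp only [scanStep, ends_seq, ends_assign, ends_store, ends_branch, Expr.eval, Expr.cost]
  simp (disch := omega) only [Function.update_of_ne, Function.update_self, hi,
    Nat.add_sub_cancel]
  have hci : s.arr C i < n := hc i (by omega)
  have hProc : ∀ x, Processed (s.arr C) num (i + 1) x → Processed (s.arr C) num i x :=
    fun x ⟨j, h1, h2⟩ => ⟨j, by omega, h2⟩
  have hProci : Processed (s.arr C) num i (s.arr C i) := ⟨i, le_rfl, by omega, rfl⟩
  refine ⟨fun hm => ?_, fun hm => ?_⟩
  · have hvis := visitProgram_spec (n := n) (E := E) (adj := adj)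
      (Proc := Processed (s.arr C) num i) (rem := rem) (pend := fun _ => False)
      (s := ⟨Function.update (Function.update (Function.update (Function.update s.reg 2 i) 8
          (s.arr C i)) 9 (s.arr C i)) 3 (s.reg 3 + 1),
        Function.update s.arr (M + 1) (Function.update (s.arr (M + 1)) (s.reg 3) (s.arr C i))⟩)
      ha' ⟨?_, ?_⟩ ?_ ?_ ?_ ?_ ?_ ?_ ?_ ?_
    rotate_left
    all_goals try (simp (disch := omega) only [Function.update_of_ne, Function.update_self])
    · exact hl
    · rw [hsp]
      exact (h.change_root _).weaken hProc fun w h => Or.inr h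
    · exact hci
    · omega
    · exact fun _ h => h.elim
    · exact hProci
    · exact .refl
    · omega
    · exact fun _ => trivial
    · rintro j hj hjc
      have := (h.pair j hj).2.1
      rw [hjc] at this
      omega
    refine hvis.frame.mono ?_
    rintro t₁ s₁ ⟨⟨ht₁, hI₁, hsp₁, hw₁, hmono₁⟩, hfa₁, hfr₁⟩
    simp (disch := omega) only [Function.update_of_ne, Function.update_self] at hsp₁ hw₁ hmono₁
    have hloop := ends_loop (e := .const 0) (f := .reg 5) (P := searchStep H N T M Fl)
      (fun φ s' => Processed (s.arr C) num i (s'.reg 9) ∧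
        (∀ v, s₁.arr M v ≠ 0 → s'.arr M v ≠ 0) ∧ ∃ rem',
          MemInv H N T M Fl n E adj (Processed (s.arr C) num i) (fun _ => False) rem' s' ∧
          φ = 80 * (weight n (s'.arr M) rem' + s'.reg 5))
      (by
        rintro φ s' ⟨hP, hmono, rem', hI, rfl⟩ hc'
        refine (searchStep_spec ha' hadj hI hP hc').frame.mono ?_
        rintro t s'' ⟨⟨ht, hmono', rem'', hI', hw⟩, hfa, hfr⟩
        refine ⟨_, ⟨?_, fun v hv => hmono' v (hmono v hv), rem'', hI', rfl⟩, ?_⟩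
        · rw [hfr 9 (by simp [searchStep, visitProgram, Program.AssignsTo])]; exact hP
        · simp only [Expr.cost]; omega)
      (s := s₁) ⟨by
        rw [hfr₁ 9 (by simp [visitProgram, Program.AssignsTo])]
        simp (disch := omega) only [Function.update_of_ne, Function.update_self]
        exact hProci, fun _ h => h, rem, hI₁, rfl⟩
    refine hloop.frame.mono ?_
    rintro t₂ s₂ ⟨⟨φ, ⟨hP₂, hmono₂, rem₂, hI₂, rfl⟩, hexit, ht₂⟩, hfa₂, hfr₂⟩
    have e2 : s₂.reg 2 = i := by
      rw [hfr₂ 2 (by simp [searchStep, visitProgram, Program.AssignsTo]),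
        hfr₁ 2 (by simp [visitProgram, Program.AssignsTo])]
      simp (disch := omega) only [Function.update_of_ne, Function.update_self]
    have e3 : s₂.reg 3 = s.reg 3 + 1 := by
      rw [hfr₂ 3 (by simp [searchStep, visitProgram, Program.AssignsTo]),
        hfr₁ 3 (by simp [visitProgram, Program.AssignsTo])]
      simp (disch := omega) only [Function.update_self]
    have hst : ∀ b, b ≠ 9 → b ≠ 10 → b ≠ 11 → b ≠ 12 → b ≠ 13 → b ≠ 14 → b ≠ M →
        s₂.arr b = Function.update s.arr (M + 1)
          (Function.update (s.arr (M + 1)) (s.reg 3) (s.arr C i)) b := by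
      intro b h9 h10 h11 h12 h13 h14 hbM
      rw [hfa₂ b (by simp [searchStep, visitProgram, Program.StoresTo, *]),
        hfa₁ b (by simp [visitProgram, Program.StoresTo, *])]
    have eC : s₂.arr C = s.arr C := by
      rw [hst C (by omega) (by omega) (by omega) (by omega) (by omega) (by omega) (by omega),
        Function.update_of_ne (by omega)]
    have eF : s₂.arr Fl = s.arr Fl := by
      rw [hst Fl (by omega) (by omega) (by omega) (by omega) (by omega) (by omega) (by omega),
        Function.update_of_ne (by omega)]
    have eR : s₂.arr (M + 1) = Function.update (s.arr (M + 1)) (s.reg 3) (s.arr C i) := by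
      rw [hst (M + 1) (by omega) (by omega) (by omega) (by omega) (by omega) (by omega) (by omega),
        Function.update_self]
    simp only [Expr.eval] at hexit
    refine ⟨rem₂, ⟨by rw [e2]; exact hI₂, by omega, by omega, eC, eF, ?_, ?_⟩, ?_⟩
    · rw [e2]
      intro j hj hj'
      apply hmono₂
      apply hmono₁
      rcases Nat.eq_or_lt_of_le hj with rfl | hj
      · exact Or.inr rfl
      · exact Or.inl (hmk j hj hj')
    · intro hfl
      rw [e2, e3, eR]
      refine (hroots hfl).push (by omega) fun j hj hj' hreach => ?_
      exact h.mark_of_reach hfl (hmk j hj hj') hreach (by omega)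
    · simp only [Expr.cost] at ht₂
      omega
  · refine ⟨rem, ⟨⟨?_, ?_⟩, ?_, ?_, ?_, ?_, ?_, ?_⟩, ?_⟩
    all_goals try (simp (disch := omega) only [Function.update_of_ne, Function.update_self])
    · exact hl
    · rw [hsp]; exact h.weaken hProc fun w h => Or.inr h
    · exact hsp
    · omega
    · intro j hj hj'
      rcases Nat.eq_or_lt_of_le hj with rfl | hj
      · omega
      · exact hmk j hj hj'
    · intro hfl
      refine (hroots hfl).skip ?_
      obtain ⟨x, ⟨j, h1, h2, rfl⟩, h3⟩ := h.reached (s.arr C i) (by omega)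
      exact ⟨j, h1, h2, h3⟩
    · omega

/-- The arrays `11` and `12` receive the pairs found, whose number is in register `4`. Without
flags, the array `M + 1` receives the roots of the searches, whose number is in register `3`. -/
theorem scanProgram_spec {H N T C M Fl n E : ℕ} {adj : ℕ → List ℕ} {s : Memory}
    (ha : ScanArrays H N T C M Fl) (hadj : ∀ u, ∀ w ∈ adj u, w < n)
    (hc : ∀ j < s.reg 2, s.arr C j < n) (hl : Linked (s.arr H) (s.arr N) (s.arr T) E adj)
    (hM : s.arr M = fun _ => 0) (h13 : s.arr 13 = fun _ => 0) (h14 : s.arr 14 = fun _ => 0)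
    (hr : s.reg 4 = 0) :
    Ends (scanProgram H N T C M Fl) s fun t s' => ∃ rem,
      t ≤ 80 * weight n (fun _ => 0) adj + 150 * s.reg 2 + 10 ∧ s'.reg 2 = 0 ∧
      ScanInv H N T C M Fl n E adj (s.arr C) (s.arr Fl) (s.reg 2) rem s' := by
  have ha' := ha
  obtain ⟨hH, hN, hT, hC, hM', hFl, hFl'⟩ := ha
  simp only [scanProgram, ends_seq, ends_assign, Expr.eval, Expr.cost]
  have hloop := ends_loop (e := .const 0) (f := .reg 2) (P := scanStep H N T C M Fl)
    (fun φ s' => ∃ rem, ScanInv H N T C M Fl n E adj (s.arr C) (s.arr Fl) (s.reg 2) rem s' ∧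
      φ = 80 * weight n (s'.arr M) rem + 150 * s'.reg 2)
    (by
      rintro φ s' ⟨rem, hI, rfl⟩ hc'
      refine (scanStep_spec ha' hadj hc hI hc').mono ?_
      rintro t s'' ⟨rem', hI', hle⟩
      refine ⟨_, ⟨rem', hI', rfl⟩, ?_⟩
      simp only [Expr.cost]
      omega)
    (s := ⟨Function.update (Function.update s.reg 3 0) 5 0, s.arr⟩)
    (φ := 80 * weight n (fun _ => 0) adj + 150 * s.reg 2)
    ⟨adj, ⟨⟨hl, ?_⟩, ?_, ?_, rfl, rfl, ?_, ?_⟩, ?_⟩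
  rotate_left
  all_goals try (simp (disch := omega) only [Function.update_of_ne, Function.update_self])
  · rw [hM, h13, h14, hr]
    exact (SearchInv.init ..).weaken (fun _ h => h.elim) fun _ h => h.elim
  · exact le_rfl
  · intro j h1 h2; omega
  · intro _
    exact ⟨fun a ha => by omega, fun j h1 h2 => by omega, fun a b h1 h2 => by omega⟩
  · rw [hM]
  refine hloop.mono ?_
  rintro t s' ⟨φ, ⟨rem, hI, rfl⟩, hexit, hle⟩
  simp only [Expr.cost, Expr.eval] at hle hexit
  exact ⟨rem, by omega, by omega, hI⟩

/-! ### Source components and the matching found by the searches -/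

/-- The list `ρ 0, …, ρ (cnt - 1)` has exactly one vertex of each source component of the digraph
on the vertices less than `n`. -/
structure SourceList (n : ℕ) (adj : ℕ → List ℕ) (ρ : ℕ → ℕ) (cnt : ℕ) : Prop where
  lt : ∀ a < cnt, ρ a < n
  cover : ∀ v < n, ∃ a < cnt, Reach adj (ρ a) v
  source : ∀ a < cnt, ∀ x < n, Reach adj x (ρ a) → Reach adj (ρ a) x
  indep : ∀ a < cnt, ∀ b < cnt, Reach adj (ρ a) (ρ b) → a = b

theorem RootList.le {adj : ℕ → List ℕ} {c : ℕ → ℕ} {num : ℕ} {ρ : ℕ → ℕ} {cnt : ℕ}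
    (h : RootList adj c num 0 ρ cnt) : cnt ≤ num := by
  have : ∀ a : Fin cnt, ∃ j : Fin num, ρ a = c j := fun a => by
    obtain ⟨j, -, h1, h2, -⟩ := h.mem a a.2
    exact ⟨⟨j, h1⟩, h2⟩
  choose f hf using this
  have hinj : Function.Injective f := by
    intro a b hab
    have hρ : ρ a = ρ b := by rw [hf, hf, hab]
    rcases lt_trichotomy (a : ℕ) b with h1 | h1 | h1
    · exact absurd (hρ ▸ .refl) (h.later a b h1 b.2)
    · exact Fin.ext h1
    · exact absurd (hρ ▸ .refl) (h.later b a h1 a.2)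
  simpa using Fintype.card_le_of_injective f hinj

/-- The roots of a second scan, which treats the roots of the first one in reverse order,
represent the source components: a root of the first scan can only be reached from later roots,
and those of the second scan cannot be reached from later roots of the first. -/
theorem RootList.sourceList {n : ℕ} {adj : ℕ → List ℕ} {c ρ₁ ρ₂ : ℕ → ℕ} {cnt₁ cnt₂ : ℕ}
    (hc : ∀ v < n, c v = v) (h₁ : RootList adj c n 0 ρ₁ cnt₁)
    (h₂ : RootList adj ρ₁ cnt₁ 0 ρ₂ cnt₂) : SourceList n adj ρ₂ cnt₂ := by
  have hcover : ∀ v < n, ∃ a < cnt₁, Reach adj (ρ₁ a) v := fun v hv => by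
    obtain ⟨a, ha, h⟩ := h₁.cover v (Nat.zero_le v) hv
    exact ⟨a, ha, by rwa [hc v hv] at h⟩
  have hsource : ∀ a < cnt₂, ∀ x < n, Reach adj x (ρ₂ a) → Reach adj (ρ₂ a) x := by
    intro a ha x hx hxa
    obtain ⟨j, -, hj, hρ, hlate⟩ := h₂.mem a ha
    rw [hρ] at hxa ⊢
    obtain ⟨b, hb, hbx⟩ := hcover x hx
    rcases lt_trichotomy b j with h | rfl | h
    · exact absurd (hbx.trans hxa) (h₁.later b j h hj)
    · exact hbx
    · exact absurd (hbx.trans hxa) (hlate b h hb)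
  have hlt : ∀ a < cnt₂, ρ₂ a < n := by
    intro a ha
    obtain ⟨j, -, hj, hρ, -⟩ := h₂.mem a ha
    obtain ⟨v, -, hv, hρ', -⟩ := h₁.mem j hj
    rw [hρ, hρ', hc v hv]
    exact hv
  refine ⟨hlt, fun v hv => ?_, hsource, fun a ha b hb hab => ?_⟩
  · obtain ⟨b, hb, hbv⟩ := hcover v hv
    obtain ⟨a, ha, hab⟩ := h₂.cover b (Nat.zero_le b) hb
    exact ⟨a, ha, hab.trans hbv⟩
  · rcases lt_trichotomy a b with h | h | h
    · exact absurd hab (h₂.later a b h hb)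
    · exact h
    · exact absurd (hsource b hb _ (hlt a ha) hab) (h₂.later b a h ha)

theorem SourceList.le {n : ℕ} {adj : ℕ → List ℕ} {ρ : ℕ → ℕ} {cnt : ℕ}
    (h : SourceList n adj ρ cnt) : cnt ≤ n := by
  have hinj : Function.Injective fun a : Fin cnt => (⟨ρ a, h.lt a a.2⟩ : Fin n) := by
    intro a b hab
    have hρ : ρ a = ρ b := congrArg Fin.val hab
    exact Fin.ext (h.indep a a.2 b b.2 (hρ ▸ .refl))
  simpa using Fintype.card_le_of_injective _ hinj

theorem SourceList.reorder {n : ℕ} {adj : ℕ → List ℕ} {ρ ρ' : ℕ → ℕ} {cnt cnt' : ℕ}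
    (h : SourceList n adj ρ cnt) (hsub : ∀ a < cnt', ∃ b < cnt, ρ b = ρ' a)
    (hsup : ∀ b < cnt, ∃ a < cnt', ρ' a = ρ b)
    (hinj : ∀ a b, a < b → b < cnt' → ρ' a ≠ ρ' b) : SourceList n adj ρ' cnt' := by
  refine ⟨fun a ha => ?_, fun v hv => ?_, fun a ha => ?_, fun a ha b hb hab => ?_⟩
  · obtain ⟨b, hb, hba⟩ := hsub a ha
    exact hba ▸ h.lt b hb
  · obtain ⟨b, hb, hbv⟩ := h.cover v hv
    obtain ⟨a, ha, hab⟩ := hsup b hb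
    exact ⟨a, ha, hab ▸ hbv⟩
  · obtain ⟨b, hb, hba⟩ := hsub a ha
    exact hba ▸ h.source b hb
  · obtain ⟨a', ha', haa'⟩ := hsub a ha
    obtain ⟨b', hb', hbb'⟩ := hsub b hb
    rw [← haa', ← hbb'] at hab
    have heq : ρ' a = ρ' b := by rw [← haa', ← hbb', h.indep a' ha' b' hb' hab]
    rcases lt_trichotomy a b with hlt | h1 | hlt
    · exact absurd heq (hinj a b hlt hb)
    · exact h1
    · exact absurd heq.symm (hinj b a hlt ha)

/-- The lists `radj` are the adjacency lists of the reverse digraph. -/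
def IsReverse (adj radj : ℕ → List ℕ) : Prop := ∀ u w, u ∈ radj w ↔ w ∈ adj u

theorem IsReverse.reach_iff {adj radj : ℕ → List ℕ} (h : IsReverse adj radj) {u v : ℕ} :
    Reach radj u v ↔ Reach adj v u := by
  rw [Reach, ← reflTransGen_swap]
  have : (Function.swap fun u w => w ∈ radj u) = fun u w => w ∈ adj u := by
    funext u w
    exact propext (h u w)
  rw [this]

section Matching

variable {n : ℕ} {adj radj : ℕ → List ℕ} {next tgt : ℕ → ℕ} {E : ℕ} {fl : ℕ → ℕ}
    {Proc : ℕ → Prop} {root : ℕ} {pend : ℕ → Prop} {mark cur stk : ℕ → ℕ} {r : ℕ}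
    {ma ms ua us : ℕ → ℕ} {rem : ℕ → List ℕ} {σ : ℕ → ℕ} {m : ℕ}

/-- Suppose that the flagged vertices represent the sink components. Then each marked vertex
reaches a flagged vertex that has been found: otherwise, the search has not been abandoned at any
vertex that can be reached from it, so that all of these are marked. -/
theorem SearchInv.exists_reach_sink
    (h : SearchInv n adj next tgt E fl Proc root pend mark cur stk 0 r ma ms ua us rem)
    (hrev : IsReverse adj radj) (hσ : SourceList n radj σ m) (hfl : ∀ l < m, fl (σ l) ≠ 0)
    {v : ℕ} (hv : mark v ≠ 0) : ∃ j < r, Reach adj v (ms j) := by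
  by_contra hno
  have hmark : ∀ w, Reach adj v w → mark w ≠ 0 := by
    intro w hw
    induction hw with
    | refl => exact hv
    | @tail b c hvb hbc ih =>
      rcases h.status b ih with ⟨a, ha, -⟩ | h1 | ⟨j, hj, -, h1⟩
      · omega
      · exact h1 c hbc
      · exact absurd ⟨j, hj, hvb.trans h1⟩ hno
  obtain ⟨l, hl, hlv⟩ := hσ.cover v (h.mark_lt v hv)
  rw [hrev.reach_iff] at hlv
  obtain ⟨j, hj, hjl⟩ := h.flag_done _ (hmark _ hlv) (hfl l hl)
  exact hno ⟨j, hj, by rwa [hjl]⟩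

/-- Each vertex that is reachable from a marked one, and is found if it is marked, is reachable
from the root of a successful search: on a path to it, the search has been abandoned at the last
marked vertex. -/
theorem SearchInv.exists_root_reach
    (h : SearchInv n adj next tgt E fl Proc root pend mark cur stk 0 r ma ms ua us rem)
    {u v : ℕ} (hu : mark u ≠ 0) (huv : Reach adj u v) (hv : fl v ≠ 0) :
    ∃ j < r, Reach adj (ma j) v := by
  have key : mark v ≠ 0 ∨ ∃ j < r, Reach adj (ma j) v := by
    clear hv
    induction huv with
    | refl => exact Or.inl hu
    | @tail b c _ hbc ih =>
      rcases ih with ih | ⟨j, hj, ih⟩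
      · rcases h.status b ih with ⟨a, ha, -⟩ | h1 | ⟨j, hj, h1, -⟩
        · omega
        · exact Or.inl (h1 c hbc)
        · exact Or.inr ⟨j, hj, h1.tail hbc⟩
      · exact Or.inr ⟨j, hj, ih.tail hbc⟩
  rcases key with h1 | h1
  · obtain ⟨j, hj, rfl⟩ := h.flag_done v h1 hv
    exact ⟨j, hj, (h.pair j hj).2.2.2.2⟩
  · exact h1

end Matching

/-- The arrays `A` and `S` list representatives of the source and the sink components, and the
first `r` entries of `A` are matched along paths with those of `S`, in such a way that each source
reaches a matched sink, and each sink is reached from a matched source. -/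
structure PairedLists (n : ℕ) (adj radj : ℕ → List ℕ) (A S : ℕ → ℕ) (p m r : ℕ) : Prop where
  sources : SourceList n adj A p
  sinks : SourceList n radj S m
  le_p : r ≤ p
  le_m : r ≤ m
  pair : ∀ l < r, Reach adj (A l) (S l)
  up : ∀ a < p, ∃ l < r, Reach adj (A a) (S l)
  down : ∀ c < m, ∃ l < r, Reach adj (A l) (S c)

/-! ### The co-design given by paired lists of sources and sinks -/

/-- The lists `adj` are adjacency lists of the state digraph. -/
def IsAdjLists {n : ℕ} (Abar : Matrix (Fin n) (Fin n) Bool) (adj : ℕ → List ℕ) : Prop :=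
  ∀ u w, w ∈ adj u ↔ ∃ i j : Fin n, Abar j i = true ∧ i = u ∧ j = w

theorem IsAdjLists.lt {n : ℕ} {Abar : Matrix (Fin n) (Fin n) Bool} {adj : ℕ → List ℕ}
    (h : IsAdjLists Abar adj) (u : ℕ) : ∀ w ∈ adj u, w < n := by
  intro w hw
  obtain ⟨i, j, -, -, rfl⟩ := (h u w).1 hw
  exact j.2

theorem IsAdjLists.reverse {n : ℕ} {Abar : Matrix (Fin n) (Fin n) Bool} {adj radj : ℕ → List ℕ}
    (h : IsAdjLists Abar adj) (hrev : IsReverse adj radj) : IsAdjLists Abar.transpose radj := by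
  intro u w
  rw [hrev, h]
  constructor
  · rintro ⟨i, j, h1, h2, h3⟩
    exact ⟨j, i, h1, h3, h2⟩
  · rintro ⟨i, j, h1, h2, h3⟩
    exact ⟨j, i, h1, h3, h2⟩

theorem IsAdjLists.reach_iff {n : ℕ} {Abar : Matrix (Fin n) (Fin n) Bool} {adj : ℕ → List ℕ}
    (h : IsAdjLists Abar adj) {i j : Fin n} :
    Reach adj i j ↔ ReflTransGen (StateEdge Abar) i j := by
  constructor
  · intro hij
    have key : ∀ v, Reach adj i v → ∃ j : Fin n, j = v ∧ ReflTransGen (StateEdge Abar) i j := by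
      intro v hv
      induction hv with
      | refl => exact ⟨i, rfl, .refl⟩
      | @tail b c _ hbc ih =>
        obtain ⟨j', h1, h2⟩ := ih
        obtain ⟨i', j, h3, h4, h5⟩ := (h b c).1 hbc
        obtain rfl : i' = j' := Fin.ext (h4.trans h1.symm)
        exact ⟨j, h5, h2.tail h3⟩
    obtain ⟨j', h1, h2⟩ := key j hij
    rwa [← Fin.ext h1]
  · intro hij
    induction hij with
    | refl => exact .refl
    | tail _ hbc ih => exact ih.tail ((h _ _).2 ⟨_, _, hbc, rfl, rfl⟩)

theorem SourceList.isMinActuators {n : ℕ} {Abar : Matrix (Fin n) (Fin n) Bool}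
    (hA : StatePerfectMatching Abar) {adj : ℕ → List ℕ} (hadj : IsAdjLists Abar adj) {ρ : ℕ → ℕ}
    {p : ℕ} (h : SourceList n adj ρ p) {ι : Fin p → Fin n} (hι : ∀ a, (ι a : ℕ) = ρ a) :
    IsMinActuators Abar ι := by
  have hinj : Function.Injective ι := by
    intro a b hab
    have hρ : ρ a = ρ b := by rw [← hι, ← hι, hab]
    exact Fin.ext (h.indep a a.2 b b.2 (hρ ▸ .refl))
  have hS : IsSourceTransversal (StateEdge Abar) (Finset.univ.image ι) := by
    constructor
    · intro i
      obtain ⟨a, ha, hai⟩ := h.cover i i.2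
      refine ⟨ι ⟨a, ha⟩, Finset.mem_image_of_mem _ (Finset.mem_univ _), ?_⟩
      rw [← hadj.reach_iff, hι]
      exact hai
    · intro s hs i his
      obtain ⟨a, -, rfl⟩ := Finset.mem_image.1 hs
      rw [← hadj.reach_iff, hι] at his ⊢
      exact h.source a a.2 i i.2 his
    · intro s hs s' hs' hss'
      obtain ⟨a, -, rfl⟩ := Finset.mem_image.1 hs
      obtain ⟨b, -, rfl⟩ := Finset.mem_image.1 hs'
      rw [← hadj.reach_iff, hι, hι] at hss'
      rw [Fin.ext (h.indep a a.2 b b.2 hss')]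
  refine hS.isMinActuators hA (fun s hs => ?_) ?_
  · obtain ⟨a, -, rfl⟩ := Finset.mem_image.1 hs
    exact ⟨a, rfl⟩
  · rw [Finset.card_image_of_injective _ hinj, Finset.card_univ, Fintype.card_fin]

/-- The sensor of the `l`-th link of a block with `m` sensors. -/
def linkSensor (m l : ℕ) : ℕ := if l < m then l else 0

/-- The actuator of the `l`-th link of a block with `p` actuators, of which the first `r` are
matched. -/
def linkActuator (r p l : ℕ) : ℕ :=
  if l + 1 < r then l + 1 else if l < r then 0 else if l < p then l else 0

/-- The links of a block: a cycle through the matched pairs, and a link for each of the other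
sensors and actuators. -/
def blockLinks (p m r : ℕ) : Finset (Fin m × Fin p) :=
  Finset.univ.filter fun e => ∃ l < max p m, linkSensor m l = e.1 ∧ linkActuator r p l = e.2

theorem mem_blockLinks {p m r : ℕ} {e : Fin m × Fin p} :
    e ∈ blockLinks p m r ↔ ∃ l < max p m, linkSensor m l = e.1 ∧ linkActuator r p l = e.2 := by
  simp [blockLinks]

theorem linkSensor_lt {m : ℕ} (hm : 0 < m) (l : ℕ) : linkSensor m l < m := by
  unfold linkSensor; split_ifs <;> omega

theorem linkActuator_lt {r p : ℕ} (hp : 0 < p) (hr : r ≤ p) (l : ℕ) : linkActuator r p l < p := by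
  unfold linkActuator; split_ifs <;> omega

theorem link_injOn {p m r : ℕ} (hr : 0 < r) (hm : r ≤ m) {l l' : ℕ}
    (hl : l < max p m) (hl' : l' < max p m) (h1 : linkSensor m l = linkSensor m l')
    (h2 : linkActuator r p l = linkActuator r p l') : l = l' := by
  unfold linkSensor at h1
  unfold linkActuator at h2
  split_ifs at h1 h2 <;> omega

theorem card_blockLinks {p m r : ℕ} (hr : 0 < r) (hp : r ≤ p) (hm : r ≤ m) :
    (blockLinks p m r).card = max p m := by
  have hinj : Function.Injective fun l : Fin (max p m) =>
      ((⟨linkSensor m l, linkSensor_lt (by omega) l⟩, ⟨linkActuator r p l,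
        linkActuator_lt (by omega) hp l⟩) : Fin m × Fin p) := by
    intro l l' h
    simp only [Prod.mk.injEq, Fin.mk.injEq] at h
    exact Fin.ext (link_injOn hr hm l.2 l'.2 h.1 h.2)
  have : blockLinks p m r = Finset.univ.image fun l : Fin (max p m) =>
      ((⟨linkSensor m l, linkSensor_lt (by omega) l⟩, ⟨linkActuator r p l,
        linkActuator_lt (by omega) hp l⟩) : Fin m × Fin p) := by
    ext e
    simp only [mem_blockLinks, Finset.mem_image, Finset.mem_univ, true_and, Prod.ext_iff,
      Fin.ext_iff]
    constructor
    · rintro ⟨l, hl, h⟩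
      exact ⟨⟨l, hl⟩, h⟩
    · rintro ⟨l, h⟩
      exact ⟨l, l.2, h⟩
  rw [this, Finset.card_image_of_injective _ hinj, Finset.card_univ, Fintype.card_fin]

theorem PairedLists.pos {n : ℕ} {adj radj : ℕ → List ℕ} {A S : ℕ → ℕ} {p m r : ℕ}
    (h : PairedLists n adj radj A S p m r) (hn : 0 < n) : 0 < r := by
  obtain ⟨a, ha, -⟩ := h.sources.cover 0 hn
  obtain ⟨l, hl, -⟩ := h.up a ha
  omega

theorem PairedLists.isSparsestPattern {n : ℕ} {Abar : Matrix (Fin n) (Fin n) Bool}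
    (hA : StatePerfectMatching Abar) {adj radj : ℕ → List ℕ} (hadj : IsAdjLists Abar adj)
    (hrev : IsReverse adj radj) {A S : ℕ → ℕ} {p m r : ℕ}
    (h : PairedLists n adj radj A S p m r) (hr : 0 < r) {ι : Fin p → Fin n} {γ : Fin m → Fin n}
    (hι : ∀ a, (ι a : ℕ) = A a) (hγ : ∀ c, (γ c : ℕ) = S c) :
    IsSparsestPattern Abar ι γ (blockLinks p m r) := by
  have hιmin := h.sources.isMinActuators hA hadj hι
  have hγmin : IsMinSensors Abar γ := isMinSensors_iff.2
    (h.sinks.isMinActuators hA.transpose (hadj.reverse hrev) hγ)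
  have hrp := h.le_p
  have hrm := h.le_m
  have hsensor : ∀ c, ∃ a, (c, a) ∈ blockLinks p m r := fun c =>
    ⟨⟨linkActuator r p c, linkActuator_lt (by omega) hrp c⟩, mem_blockLinks.2
      ⟨c, lt_max_of_lt_right c.2, if_pos c.2, rfl⟩⟩
  refine isSparsestPattern_of_strongly_connected hA hιmin hγmin ?_ hsensor
    (card_blockLinks hr hrp hrm).le
  refine loopEdge_strongly_connected hιmin.1.reachable hγmin.reachable
    (fun l : Fin r => (⟨l, by omega⟩, ⟨l, by omega⟩)) ?_ ?_ ?_ ?_ ?_ hsensor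
  · intro l
    rw [← hadj.reach_iff, hι, hγ]
    exact h.pair l l.2
  · intro l
    refine mem_blockLinks.2 ⟨l, lt_max_of_lt_left (by omega), if_pos (by omega), ?_⟩
    obtain ⟨r, rfl⟩ : ∃ r', r = r' + 1 := ⟨r - 1, by omega⟩
    simp only [finRotate_apply, Fin.val_add_one, linkActuator, Fin.ext_iff, Fin.val_last]
    have := l.2
    split_ifs <;> omega
  · intro a
    obtain ⟨l, hl, h1⟩ := h.up a a.2
    refine ⟨⟨l, hl⟩, ?_⟩
    rw [← hadj.reach_iff, hι, hγ]
    exact h1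
  · intro c
    obtain ⟨l, hl, h1⟩ := h.down c c.2
    refine ⟨⟨l, hl⟩, ?_⟩
    rw [← hadj.reach_iff, hι, hγ]
    exact h1
  · intro a
    obtain ⟨l, hl, hla⟩ : ∃ l < max p m, linkActuator r p l = a := by
      have := a.2
      by_cases ha : (a : ℕ) < r
      · rcases Nat.eq_zero_or_pos (a : ℕ) with h0 | h0
        · refine ⟨r - 1, lt_max_of_lt_left (by omega), ?_⟩
          rw [linkActuator, if_neg (by omega), if_pos (by omega), h0]
        · refine ⟨a - 1, lt_max_of_lt_left (by omega), ?_⟩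
          rw [linkActuator, if_pos (by omega)]
          omega
      · refine ⟨a, lt_max_of_lt_left this, ?_⟩
        rw [linkActuator, if_neg (by omega), if_neg ha, if_pos this]
    exact ⟨⟨linkSensor m l, linkSensor_lt (by omega) l⟩, mem_blockLinks.2 ⟨l, hl, rfl, hla⟩⟩

theorem card_links_unionDesign {n k p m q : ℕ} (ι : Fin ((k + 1) * p) → Fin n)
    (γ : Fin ((k + 1) * m) → Fin n) {L : Fin (k + 1) → Finset (Fin m × Fin p)}
    (hL : ∀ i, (L i).card = q) : (unionDesign ι γ L).links.card = (k + 1) * q := by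
  suffices h : (Finset.univ.biUnion fun i => (L i).image fun e =>
      ((finProdFinEquiv (i, e.1), finProdFinEquiv (i, e.2)) :
        Fin ((k + 1) * m) × Fin ((k + 1) * p))).card = (k + 1) * q from h
  rw [Finset.card_biUnion]
  · rw [Finset.sum_congr rfl fun i _ => (Finset.card_image_of_injective (L i) ?_).trans (hL i)]
    · simp
    · rintro ⟨c, a⟩ ⟨c', a'⟩ h
      simp only [Prod.mk.injEq, EmbeddingLike.apply_eq_iff_eq, true_and] at h
      rw [h.1, h.2]
  · intro i _ j _ hij
    rw [Function.onFun, Finset.disjoint_left]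
    intro e he he'
    obtain ⟨x, -, rfl⟩ := Finset.mem_image.1 he
    obtain ⟨y, -, hxy⟩ := Finset.mem_image.1 he'
    simp only [Prod.mk.injEq, EmbeddingLike.apply_eq_iff_eq] at hxy
    exact hij hxy.1.1.symm

/-- The copies of a block of links, in the order in which they are output. -/
theorem image_links_unionDesign {n k p m r : ℕ} (ι : Fin ((k + 1) * p) → Fin n)
    (γ : Fin ((k + 1) * m) → Fin n) (hr : 0 < r) (hp : r ≤ p) (hm : r ≤ m) :
    ((Finset.range ((k + 1) * max p m)).image fun o =>
      (linkSensor m (o % max p m) + m * (o / max p m),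
        linkActuator r p (o % max p m) + p * (o / max p m))) =
      (unionDesign ι γ fun _ => blockLinks p m r).links.image fun e => ((e.1 : ℕ), (e.2 : ℕ)) := by
  have hq : 0 < max p m := lt_max_of_lt_left (by omega)
  ext ⟨x, y⟩
  simp only [Finset.mem_image, Finset.mem_range, Prod.mk.injEq]
  constructor
  · rintro ⟨o, ho, rfl, rfl⟩
    refine ⟨(finProdFinEquiv (⟨o / max p m, (Nat.div_lt_iff_lt_mul hq).2 ho⟩,
      ⟨linkSensor m (o % max p m), linkSensor_lt (by omega) _⟩),
      finProdFinEquiv (⟨o / max p m, (Nat.div_lt_iff_lt_mul hq).2 ho⟩,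
        ⟨linkActuator r p (o % max p m), linkActuator_lt (by omega) hp _⟩)), ?_, ?_⟩
    · exact Finset.mem_biUnion.2 ⟨_, Finset.mem_univ _, Finset.mem_image.2
        ⟨(_, _), mem_blockLinks.2 ⟨o % max p m, Nat.mod_lt _ hq, rfl, rfl⟩, rfl⟩⟩
    · exact ⟨rfl, rfl⟩
  · rintro ⟨e, he, rfl, rfl⟩
    obtain ⟨i, -, he⟩ := Finset.mem_biUnion.1 he
    obtain ⟨x, hx, rfl⟩ := Finset.mem_image.1 he
    obtain ⟨l, hl, h1, h2⟩ := mem_blockLinks.1 hx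
    refine ⟨l + max p m * i, ?_, ?_⟩
    · calc l + max p m * i < max p m + max p m * i := by omega
        _ = max p m * (i + 1) := by ring
        _ ≤ max p m * (k + 1) := Nat.mul_le_mul_left _ i.2
        _ = _ := mul_comm _ _
    · rw [Nat.add_mul_mod_self_left, Nat.mod_eq_of_lt hl, Nat.add_mul_div_left _ _ hq,
        Nat.div_eq_of_lt hl, Nat.zero_add, h1, h2]
      exact ⟨rfl, rfl⟩

/-! ### Counting loops -/

/-- Repeat `P` for the values of register `2` from `0` up to, but not including, the value of
register `N`. -/
def forProgram (N : ℕ) (P : Program) : Program :=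
  .seq (.assign 2 (.const 0))
    (.loop (.reg 2) (.reg N) (.seq P (.assign 2 (.add (.reg 2) (.const 1)))))

/-- The rule for counting loops. The body may take `T (i + 1) - T i` steps in the iteration with
index `i`. -/
theorem ends_forProgram {N num : ℕ} {P : Program} {s : Memory} (I : ℕ → Memory → Prop) (T : ℕ → ℕ)
    (hT : ∀ i < num, T i ≤ T (i + 1))
    (hN : N ≠ 2) (hPN : ¬ P.AssignsTo N) (hP2 : ¬ P.AssignsTo 2) (hnum : s.reg N = num)
    (hreg : ∀ i s x, I i s → I i ⟨Function.update s.reg 2 x, s.arr⟩) (h0 : I 0 s)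
    (hstep : ∀ i s, i < num → s.reg 2 = i → I i s →
      Ends P s fun t s' => t + T i ≤ T (i + 1) ∧ I (i + 1) s') :
    Ends (forProgram N P) s fun t s' => t + T 0 ≤ T num + 7 * num + 5 ∧ I num s' := by
  have hTle : ∀ i ≤ num, T i ≤ T num := by
    intro i hi
    induction hi using Nat.decreasingInduction with
    | self => exact le_rfl
    | of_succ i hi ih => exact (hT i hi).trans ih
  simp only [forProgram, ends_seq, ends_assign, Expr.eval, Expr.cost]
  have hloop := ends_loop (e := .reg 2) (f := .reg N)
    (P := .seq P (.assign 2 (.add (.reg 2) (.const 1))))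
    (fun φ s' => s'.reg N = num ∧ s'.reg 2 ≤ num ∧ I (s'.reg 2) s' ∧
      φ + T (s'.reg 2) + 7 * s'.reg 2 = T num + 7 * num)
    (by
      rintro φ s' ⟨h1, h2, h3, h4⟩ hc
      simp only [Expr.eval] at hc
      rw [ends_seq]
      refine (hstep _ s' (by omega) rfl h3).frame.mono ?_
      rintro t s'' ⟨⟨h5, h6⟩, -, h7⟩
      have h8 := h7 2 hP2
      have h9 := h7 N hPN
      simp only [ends_assign, Expr.eval, Expr.cost, Function.update_self,
        Function.update_of_ne hN, h8]
      have h10 := hTle (s'.reg 2 + 1) (by omega)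
      exact ⟨T num + 7 * num - T (s'.reg 2 + 1) - 7 * (s'.reg 2 + 1),
        ⟨by omega, by omega, hreg _ _ _ h6, by omega⟩, by omega⟩)
    (φ := T num + 7 * num - T 0) (s := ⟨Function.update s.reg 2 0, s.arr⟩)
    ⟨by simpa only [Function.update_of_ne hN] using hnum, by simp, by simpa using hreg 0 s 0 h0, by
      have := hTle 0 (Nat.zero_le _)
      simp only [Function.update_self]
      omega⟩
  refine hloop.mono ?_
  rintro t s' ⟨φ, ⟨h1, h2, h3, h4⟩, h5, h6⟩
  simp only [Expr.eval, Expr.cost] at h5 h6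
  obtain rfl : s'.reg 2 = num := by omega
  have := hTle 0 (Nat.zero_le _)
  exact ⟨by omega, h3⟩

/-- Fill the array `a` by repeating the array `X`, whose number of entries is in register `per`,
with the value of register `add` added from each repetition to the next one. -/
def fillProgram (a X per inc total : ℕ) : Program :=
  forProgram total <| .branch (.reg 2) (.reg per)
    (.store a (.reg 2) (.get X (.reg 2)))
    (.store a (.reg 2) (.add (.get a (.sub (.reg 2) (.reg per))) (.reg inc)))

theorem fillProgram_spec {a X per inc total : ℕ} {s : Memory} (hX : X ≠ a) (h1 : per ≠ 2)
    (h2 : inc ≠ 2) (h3 : total ≠ 2) (hper : 0 < s.reg per) :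
    Ends (fillProgram a X per inc total) s fun t s' => t ≤ 20 * s.reg total + 5 ∧
      (∀ b, b ≠ a → s'.arr b = s.arr b) ∧ (∀ q, q ≠ 2 → s'.reg q = s.reg q) ∧
      ∀ l < s.reg total, s'.arr a l =
        s.arr X (l % s.reg per) + s.reg inc * (l / s.reg per) := by
  refine (ends_forProgram (num := s.reg total) (fun i s' => (∀ b, b ≠ a → s'.arr b = s.arr b) ∧
    (∀ q, q ≠ 2 → s'.reg q = s.reg q) ∧ ∀ l < i, s'.arr a l =
        s.arr X (l % s.reg per) + s.reg inc * (l / s.reg per)) (fun i => 12 * i)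
    (fun i _ => by omega) h3 (by simp [Program.AssignsTo]) (by simp [Program.AssignsTo]) rfl ?_ ?_
    ?_).mono ?_
  · rintro i s' x ⟨h4, h5, h6⟩
    exact ⟨h4, fun q hq => (Function.update_of_ne hq _ _).trans (h5 q hq), h6⟩
  · exact ⟨fun _ _ => rfl, fun _ _ => rfl, fun l hl => absurd hl (Nat.not_lt_zero l)⟩
  · rintro i s' hi hs ⟨h4, h5, h6⟩
    simp only [ends_branch, ends_store, Expr.eval, Expr.cost, hs, h5 per h1, h5 inc h2, h4 X hX]
    refine ⟨fun hlt => ⟨by omega, ?_, h5, ?_⟩, fun hlt => ⟨by omega, ?_, h5, ?_⟩⟩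
    · intro b hb
      rw [Function.update_of_ne hb, h4 b hb]
    · intro l hl
      rw [Function.update_self]
      rcases Nat.lt_succ_iff_lt_or_eq.1 hl with hl | rfl
      · rw [Function.update_of_ne hl.ne, h6 l hl]
      · rw [Function.update_self, Nat.mod_eq_of_lt hlt, Nat.div_eq_of_lt hlt, Nat.mul_zero,
          Nat.add_zero]
    · intro b hb
      rw [Function.update_of_ne hb, h4 b hb]
    · intro l hl
      rw [Function.update_self]
      rcases Nat.lt_succ_iff_lt_or_eq.1 hl with hl | rfl
      · rw [Function.update_of_ne hl.ne, h6 l hl]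
      · obtain ⟨j, rfl⟩ : ∃ j, l = j + s.reg per := ⟨l - s.reg per, by omega⟩
        rw [Function.update_self, Nat.add_sub_cancel, h6 j (by omega), Nat.add_mod_right,
          Nat.add_div_right _ hper]
        ring
  · rintro t s' ⟨h4, h5⟩
    exact ⟨by omega, h5⟩

/-- Append to the array `D`, whose number of entries is in register `pos`, the entries `v` of the
array `X` for which `v` is not marked in the array `U`. -/
def appendProgram (X U D N pos : ℕ) : Program :=
  forProgram N <| .branch (.get U (.get X (.reg 2))) (.const 1)
    (.seq (.store D (.reg pos) (.get X (.reg 2))) (.assign pos (.add (.reg pos) (.const 1))))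
    (.assign pos (.reg pos))

theorem appendProgram_spec {X U D N pos n : ℕ} {adj : ℕ → List ℕ} {s : Memory} (hX : X ≠ D)
    (hU : U ≠ D) (hN : N ≠ 2) (hpos : pos ≠ 2) (hNpos : N ≠ pos)
    (hsrc : SourceList n adj (s.arr X) (s.reg N))
    (hD : ∀ a < s.reg pos, ∃ b < s.reg N, s.arr X b = s.arr D a)
    (hU' : ∀ v, s.arr U v ≠ 0 ↔ ∃ a < s.reg pos, s.arr D a = v)
    (hinj : ∀ a b, a < b → b < s.reg pos → s.arr D a ≠ s.arr D b) :
    Ends (appendProgram X U D N pos) s fun t s' => t ≤ 30 * s.reg N + 5 ∧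
      (∀ b, b ≠ D → s'.arr b = s.arr b) ∧ (∀ q, q ≠ 2 → q ≠ pos → s'.reg q = s.reg q) ∧
      SourceList n adj (s'.arr D) (s'.reg pos) ∧ s.reg pos ≤ s'.reg pos ∧
      ∀ a < s.reg pos, s'.arr D a = s.arr D a := by
  refine (ends_forProgram (num := s.reg N) (fun i s' => (∀ b, b ≠ D → s'.arr b = s.arr b) ∧
    (∀ q, q ≠ 2 → q ≠ pos → s'.reg q = s.reg q) ∧ s.reg pos ≤ s'.reg pos ∧
    (∀ a < s.reg pos, s'.arr D a = s.arr D a) ∧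
    (∀ a, s.reg pos ≤ a → a < s'.reg pos → s.arr U (s'.arr D a) = 0 ∧
      ∃ b < i, s.arr X b = s'.arr D a) ∧
    (∀ b < i, b < s.reg N → ∃ a < s'.reg pos, s'.arr D a = s.arr X b) ∧
    (∀ a b, a < b → b < s'.reg pos → s'.arr D a ≠ s'.arr D b)) (fun i => 16 * i)
    (fun i _ => by omega) hN (by simp [Program.AssignsTo, hNpos])
    (by simp [Program.AssignsTo, hpos.symm]) rfl ?_ ?_ ?_).mono ?_
  · rintro i s' x ⟨h4, h5, h6⟩
    simp only [Function.update_of_ne hpos]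
    exact ⟨h4, fun q hq hq' => by rw [Function.update_of_ne hq, h5 q hq hq'], h6⟩
  · exact ⟨fun _ _ => rfl, fun _ _ _ => rfl, le_rfl, fun _ _ => rfl, fun a h h' => by omega,
      fun b h => absurd h (Nat.not_lt_zero b), hinj⟩
  · rintro i s' hi hs ⟨h4, h5, h6, h7, h8, h9, h10⟩
    simp only [ends_branch, ends_seq, ends_assign, ends_store, Expr.eval, Expr.cost, hs, h4 X hX,
      h4 U hU]
    refine ⟨fun hlt => ⟨by omega, ?_⟩, fun hlt => ⟨by omega, h4, ?_⟩⟩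
    · simp only [Function.update_self]
      have hD' : ∀ a < s'.reg pos,
          Function.update (s'.arr D) (s'.reg pos) (s.arr X i) a = s'.arr D a := fun a ha =>
        Function.update_of_ne ha.ne _ _
      have hself : Function.update (s'.arr D) (s'.reg pos) (s.arr X i) (s'.reg pos) = s.arr X i :=
        Function.update_self ..
      refine ⟨?_, ?_, by omega, ?_, ?_, ?_, ?_⟩
      · intro b hb
        rw [Function.update_of_ne hb, h4 b hb]
      · intro q hq hq'
        rw [Function.update_of_ne hq', h5 q hq hq']
      · intro a ha
        rw [hD' a (by omega), h7 a ha]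
      · intro a ha ha'
        rcases Nat.lt_succ_iff_lt_or_eq.1 ha' with ha' | rfl
        · rw [hD' a ha']
          obtain ⟨h11, b, hb, h12⟩ := h8 a ha ha'
          exact ⟨h11, b, by omega, h12⟩
        · rw [hself]
          exact ⟨by omega, i, by omega, rfl⟩
      · intro b hb hb'
        rcases Nat.lt_succ_iff_lt_or_eq.1 hb with hb | rfl
        · obtain ⟨a, ha, h11⟩ := h9 b hb hb'
          exact ⟨a, by omega, by rw [hD' a ha, h11]⟩
        · exact ⟨s'.reg pos, by omega, hself⟩
      · intro a b hab hb
        rcases Nat.lt_succ_iff_lt_or_eq.1 hb with hb | rfl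
        · rw [hD' a (by omega), hD' b hb]
          exact h10 a b hab hb
        · rw [hD' a hab, hself]
          intro heq
          by_cases ha : a < s.reg pos
          · rw [h7 a ha] at heq
            exact (hU' _).2 ⟨a, ha, heq⟩ (by omega)
          · obtain ⟨-, b, hb, h11⟩ := h8 a (by omega) hab
            rw [heq] at h11
            have := hsrc.indep b (by omega) i hi (h11 ▸ .refl)
            omega
    · have hreg : ∀ q, Function.update s'.reg pos (s'.reg pos) q = s'.reg q := by
        intro q; rw [Function.update_eq_self]
      simp only [hreg]
      refine ⟨h5, h6, h7, ?_, ?_, h10⟩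
      · intro a ha ha'
        obtain ⟨h11, b, hb, h12⟩ := h8 a ha ha'
        exact ⟨h11, b, by omega, h12⟩
      · intro b hb hb'
        rcases Nat.lt_succ_iff_lt_or_eq.1 hb with hb | rfl
        · exact h9 b hb hb'
        · obtain ⟨a, ha, h11⟩ := (hU' (s.arr X b)).1 (by omega)
          exact ⟨a, by omega, by rw [h7 a ha, h11]⟩
  · rintro t s' ⟨h4, h5, h6, h7, h8, h9, h10, h11⟩
    refine ⟨by omega, h5, h6, hsrc.reorder ?_ (fun b hb => h10 b hb hb) h11, h7, h8⟩
    intro a ha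
    by_cases ha' : a < s.reg pos
    · rw [h8 a ha']
      exact hD a ha'
    · exact (h9 a (by omega) ha).2

/-- Set the flags in the array `F` of the vertices listed in the array `X`. -/
def flagProgram (X F N : ℕ) : Program :=
  forProgram N (.store F (.get X (.reg 2)) (.const 1))

theorem flagProgram_spec {X F N : ℕ} {s : Memory} (hX : X ≠ F) (hN : N ≠ 2)
    (hF : s.arr F = fun _ => 0) :
    Ends (flagProgram X F N) s fun t s' => t ≤ 20 * s.reg N + 5 ∧
      (∀ b, b ≠ F → s'.arr b = s.arr b) ∧ (∀ q, q ≠ 2 → s'.reg q = s.reg q) ∧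
      ∀ v, s'.arr F v ≠ 0 ↔ ∃ l < s.reg N, s.arr X l = v := by
  refine (ends_forProgram (num := s.reg N) (fun i s' => (∀ b, b ≠ F → s'.arr b = s.arr b) ∧
    (∀ q, q ≠ 2 → s'.reg q = s.reg q) ∧ ∀ v, s'.arr F v ≠ 0 ↔ ∃ l < i, s.arr X l = v)
    (fun i => 6 * i) (fun i _ => by omega) hN (by simp [Program.AssignsTo])
    (by simp [Program.AssignsTo]) rfl ?_ ?_ ?_).mono ?_
  · rintro i s' x ⟨h4, h5, h6⟩
    exact ⟨h4, fun q hq => (Function.update_of_ne hq _ _).trans (h5 q hq), h6⟩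
  · exact ⟨fun _ _ => rfl, fun _ _ => rfl, by simp [hF]⟩
  · rintro i s' hi hs ⟨h4, h5, h6⟩
    simp only [ends_store, Expr.eval, Expr.cost, hs, h4 X hX]
    refine ⟨by omega, ?_, h5, ?_⟩
    · intro b hb
      rw [Function.update_of_ne hb, h4 b hb]
    · intro v
      rw [Function.update_self]
      by_cases hv : s.arr X i = v
      · rw [hv, Function.update_self]
        exact ⟨fun _ => ⟨i, by omega, hv⟩, fun _ => one_ne_zero⟩
      · rw [Function.update_of_ne (Ne.symm hv), h6]
        constructor
        · rintro ⟨l, hl, h⟩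
          exact ⟨l, by omega, h⟩
        · rintro ⟨l, hl, h⟩
          rcases Nat.lt_succ_iff_lt_or_eq.1 hl with hl | rfl
          · exact ⟨l, hl, h⟩
          · exact absurd h hv
  · rintro t s' ⟨h4, h5⟩
    exact ⟨by omega, h5⟩

/-- Compute the links of a block in the arrays `17` and `18`, with `r`, `p`, `m` and `max p m` in
the registers `4`, `10`, `11` and `12`. -/
def linkProgram : Program :=
  forProgram 12 <| .seq
    (.branch (.reg 2) (.reg 11) (.store 17 (.reg 2) (.reg 2)) (.store 17 (.reg 2) (.const 0)))
    (.branch (.add (.reg 2) (.const 1)) (.reg 4)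
      (.store 18 (.reg 2) (.add (.reg 2) (.const 1)))
      (.branch (.reg 2) (.reg 4) (.store 18 (.reg 2) (.const 0))
        (.branch (.reg 2) (.reg 10) (.store 18 (.reg 2) (.reg 2)) (.store 18 (.reg 2) (.const 0)))))

theorem linkProgram_spec (s : Memory) :
    Ends linkProgram s fun t s' => t ≤ 50 * s.reg 12 + 5 ∧
      (∀ b, b ≠ 17 → b ≠ 18 → s'.arr b = s.arr b) ∧ (∀ q, q ≠ 2 → s'.reg q = s.reg q) ∧
      ∀ l < s.reg 12, s'.arr 17 l = linkSensor (s.reg 11) l ∧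
        s'.arr 18 l = linkActuator (s.reg 4) (s.reg 10) l := by
  refine (ends_forProgram (num := s.reg 12) (fun i s' =>
    (∀ b, b ≠ 17 → b ≠ 18 → s'.arr b = s.arr b) ∧
    (∀ q, q ≠ 2 → s'.reg q = s.reg q) ∧ ∀ l < i, s'.arr 17 l = linkSensor (s.reg 11) l ∧
        s'.arr 18 l = linkActuator (s.reg 4) (s.reg 10) l)
    (fun i => 40 * i) (fun i _ => by omega) (by simp) (by simp [Program.AssignsTo])
    (by simp [Program.AssignsTo]) rfl ?_ ?_ ?_).mono ?_
  · rintro i s' x ⟨h4, h5, h6⟩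
    exact ⟨h4, fun q hq => (Function.update_of_ne hq _ _).trans (h5 q hq), h6⟩
  · exact ⟨fun _ _ _ => rfl, fun _ _ => rfl, fun l hl => absurd hl (Nat.not_lt_zero l)⟩
  · rintro i s' hi hs ⟨h4, h5, h6⟩
    have hstore : ∀ x y t, x = linkSensor (s.reg 11) i → y = linkActuator (s.reg 4) (s.reg 10) i →
        t ≤ 40 → t + 40 * i ≤ 40 * (i + 1) ∧
        (∀ b, b ≠ 17 → b ≠ 18 → Function.update (Function.update s'.arr 17
          (Function.update (s'.arr 17) i x)) 18 (Function.update (s'.arr 18) i y) b = s.arr b) ∧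
        (∀ q, q ≠ 2 → s'.reg q = s.reg q) ∧ ∀ l < i + 1,
          Function.update (Function.update s'.arr 17 (Function.update (s'.arr 17) i x)) 18
            (Function.update (s'.arr 18) i y) 17 l = linkSensor (s.reg 11) l ∧
          Function.update (Function.update s'.arr 17 (Function.update (s'.arr 17) i x)) 18
            (Function.update (s'.arr 18) i y) 18 l = linkActuator (s.reg 4) (s.reg 10) l := by
      intro x y t hx hy ht
      refine ⟨by omega, fun b h17 h18 => ?_, h5, fun l hl => ?_⟩
      · rw [Function.update_of_ne h18, Function.update_of_ne h17, h4 b h17 h18]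
      · rw [Function.update_of_ne (by simp), Function.update_self, Function.update_self]
        rcases Nat.lt_succ_iff_lt_or_eq.1 hl with hl | rfl
        · rw [Function.update_of_ne hl.ne, Function.update_of_ne hl.ne]
          exact h6 l hl
        · rw [Function.update_self, Function.update_self]
          exact ⟨hx, hy⟩
    have h18 : (18 : ℕ) ≠ 17 := by simp
    simp only [ends_seq, ends_branch, ends_store, Expr.eval, Expr.cost, hs, h5 11 (by simp),
      h5 4 (by simp), h5 10 (by simp), Function.update_of_ne h18]
    refine ⟨fun c1 => ⟨fun c2 => ?_, fun c2 => ⟨fun c3 => ?_, fun c3 => ⟨fun c4 => ?_,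
      fun c4 => ?_⟩⟩⟩, fun c1 => ⟨fun c2 => ?_, fun c2 => ⟨fun c3 => ?_, fun c3 => ⟨fun c4 => ?_,
      fun c4 => ?_⟩⟩⟩⟩
    all_goals
      refine hstore _ _ _ ?_ ?_ (by simp)
      · simp only [linkSensor, c1, if_true, if_false]
      · simp only [linkActuator, *, if_true, if_false]
  · rintro t s' ⟨h4, h5⟩
    exact ⟨by omega, h5⟩

/-- Multiply the registers `10`, `11` and `12` by `k + 1`. The results are stored in the registers
`14`, `15` and `16`. -/
def multiplyProgram : Program :=
  .seq (.assign 13 (.add (.reg 1) (.const 1))) <| forProgram 13 <|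
    .seq (.assign 14 (.add (.reg 14) (.reg 10))) <|
    .seq (.assign 15 (.add (.reg 15) (.reg 11))) <|
    .assign 16 (.add (.reg 16) (.reg 12))

theorem multiplyProgram_spec {s : Memory} (h14 : s.reg 14 = 0) (h15 : s.reg 15 = 0)
    (h16 : s.reg 16 = 0) :
    Ends multiplyProgram s fun t s' => t ≤ 30 * (s.reg 1 + 1) + 20 ∧
      (∀ b, s'.arr b = s.arr b) ∧
      (∀ q, q ≠ 2 → q ≠ 13 → q ≠ 14 → q ≠ 15 → q ≠ 16 → s'.reg q = s.reg q) ∧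
      s'.reg 14 = (s.reg 1 + 1) * s.reg 10 ∧ s'.reg 15 = (s.reg 1 + 1) * s.reg 11 ∧
      s'.reg 16 = (s.reg 1 + 1) * s.reg 12 := by
  simp only [multiplyProgram, ends_seq, ends_assign, Expr.eval, Expr.cost]
  refine (ends_forProgram (num := s.reg 1 + 1) (fun i s' => (∀ b, s'.arr b = s.arr b) ∧
      (∀ q, q ≠ 2 → q ≠ 13 → q ≠ 14 → q ≠ 15 → q ≠ 16 → s'.reg q = s.reg q) ∧
      s'.reg 14 = i * s.reg 10 ∧ s'.reg 15 = i * s.reg 11 ∧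
      s'.reg 16 = i * s.reg 12) (fun i => 20 * i) (fun i _ => by omega) (by simp)
    (by simp [Program.AssignsTo]) (by simp [Program.AssignsTo]) (by simp) ?_ ?_ ?_).mono ?_
  · rintro i s' x ⟨h4, h5, h6⟩
    refine ⟨h4, fun q hq h13 h14 h15 h16 =>
      (Function.update_of_ne hq _ _).trans (h5 q hq h13 h14 h15 h16), ?_⟩
    simpa using h6
  · refine ⟨fun _ => rfl, fun q _ hq _ _ _ => Function.update_of_ne hq _ _, ?_⟩
    simp [h14, h15, h16]
  · rintro i s' hi hs ⟨h4, h5, h6, h7, h8⟩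
    simp only [ends_seq, ends_assign, Expr.eval, Expr.cost]
    refine ⟨by omega, h4, fun q h1 h2 h3 h9 h10 => ?_, ?_⟩
    · rw [Function.update_of_ne h10, Function.update_of_ne h9, Function.update_of_ne h3]
      exact h5 q h1 h2 h3 h9 h10
    · have e10 := h5 10 (by simp) (by simp) (by simp) (by simp) (by simp)
      have e11 := h5 11 (by simp) (by simp) (by simp) (by simp) (by simp)
      have e12 := h5 12 (by simp) (by simp) (by simp) (by simp) (by simp)
      simp [h6, h7, h8, e10, e11, e12, Nat.add_mul]
  · rintro t s' ⟨h4, h5⟩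
    exact ⟨by omega, h5⟩

/-! ### Linked lists of the state digraph and of its reverse -/

/-- Add the edge at the position in register `5`, which starts at the vertex in register `2`, to
the linked lists of successors (arrays `2`, `3`, `4`) and of predecessors (arrays `5`, `6`, `7`). -/
def pushProgram : Program :=
  .seq (.assign 6 (.get 1 (.reg 5))) <|
  .seq (.store 3 (.reg 5) (.get 2 (.reg 2))) <|
  .seq (.store 4 (.reg 5) (.reg 6)) <|
  .seq (.store 6 (.reg 5) (.get 5 (.reg 6))) <|
  .seq (.store 7 (.reg 5) (.reg 2)) <|
  .seq (.assign 5 (.add (.reg 5) (.const 1))) <|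
  .seq (.store 2 (.reg 2) (.reg 5)) <|
  .store 5 (.reg 6) (.reg 5)

/-- Build the linked lists of successors and predecessors, and the list of all vertices in the
array `8`. -/
def buildProgram : Program :=
  forProgram 0 <| .seq (.store 8 (.reg 2) (.reg 2)) <|
    .loop (.reg 5) (.get 0 (.add (.reg 2) (.const 1))) pushProgram

/-- After reading the positions up to `e`, in the adjacency list of `u`, the lists contain the
edges that start before `u`, and those of `u` that have been read. -/
structure BuildInv {n : ℕ} (Abar : Matrix (Fin n) (Fin n) Bool) (off tgt : ℕ → ℕ) (u e : ℕ)
    (f r : ℕ → List ℕ) (s : Memory) : Prop where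
  arr_off : s.arr 0 = off
  arr_tgt : s.arr 1 = tgt
  pos : s.reg 5 = e
  succ : Linked (s.arr 2) (s.arr 3) (s.arr 4) e f
  pred : Linked (s.arr 5) (s.arr 6) (s.arr 7) e r
  mem : ∀ x w, w ∈ f x ↔ (x < u ∧ ∃ i j : Fin n, Abar j i = true ∧ i = x ∧ j = w) ∨
    (x = u ∧ ∃ e', off u ≤ e' ∧ e' < e ∧ tgt e' = w)
  rev : IsReverse f r
  weight_succ : weight n (fun _ => 0) f = 2 * n + e
  weight_pred : weight n (fun _ => 0) r = 2 * n + e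

theorem weight_push {n u v : ℕ} (hu : u < n) (f : ℕ → List ℕ) :
    weight n (fun _ => 0) (Function.update f u (v :: f u)) = weight n (fun _ => 0) f + 1 := by
  have h := weight_update_rem (n := n) (fun _ => 0) (rem := Function.update f u (v :: f u)) hu
    (Function.update_self ..)
  rw [Function.update_idem, Function.update_eq_self] at h
  exact h.symm

theorem pushProgram_spec {n : ℕ} {Abar : Matrix (Fin n) (Fin n) Bool} {off tgt : ℕ → ℕ} {u e : ℕ}
    {f r : ℕ → List ℕ} {s : Memory} (h : BuildInv Abar off tgt u e f r s) (hs : s.reg 2 = u)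
    (hu : u < n) (hv : tgt e < n) (hoff : off u ≤ e) :
    Ends pushProgram s fun t s' => t ≤ 50 ∧ ∃ f' r', BuildInv Abar off tgt u (e + 1) f' r' s' := by
  obtain ⟨rfl, rfl, rfl, h1, h2, h3, h4, h5, h6⟩ := h
  subst hs
  simp only [pushProgram, ends_seq, ends_assign, ends_store, Expr.eval, Expr.cost]
  refine ⟨by omega, Function.update f (s.reg 2) (s.arr 1 (s.reg 5) :: f (s.reg 2)),
    Function.update r (s.arr 1 (s.reg 5)) (s.reg 2 :: r (s.arr 1 (s.reg 5))),
    ⟨rfl, rfl, rfl, ?_, ?_, ?_, ?_, ?_, ?_⟩⟩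
  all_goals try (simp (disch := omega) only [Function.update_of_ne, Function.update_self])
  · exact h1.push (s.reg 2) (s.arr 1 (s.reg 5))
  · exact h2.push (s.arr 1 (s.reg 5)) (s.reg 2)
  · intro x w
    by_cases hx : x = s.reg 2
    · subst hx
      rw [Function.update_self, List.mem_cons, h3]
      constructor
      · rintro (rfl | ⟨h, -⟩ | ⟨-, e', h7, h8, h9⟩)
        · exact Or.inr ⟨rfl, _, hoff, Nat.lt_succ_self _, rfl⟩
        · exact absurd h (lt_irrefl _)
        · exact Or.inr ⟨rfl, e', h7, by omega, h9⟩
      · rintro (⟨h, -⟩ | ⟨-, e', h7, h8, h9⟩)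
        · exact absurd h (lt_irrefl _)
        · rcases Nat.lt_succ_iff_lt_or_eq.1 h8 with h8 | rfl
          · exact Or.inr (Or.inr ⟨rfl, e', h7, h8, h9⟩)
          · exact Or.inl h9.symm
    · rw [Function.update_of_ne hx, h3]
      simp only [hx, false_and, or_false]
  · intro x w
    have := h4 x w
    by_cases hx : x = s.reg 2
    · subst hx
      by_cases hw : w = s.arr 1 (s.reg 5)
      · subst hw; simp
      · simp [hw, this]
    · by_cases hw : w = s.arr 1 (s.reg 5)
      · subst hw; simp [hx, this]
      · simp [hw, hx, this]
  · rw [weight_push hu, h5]; ring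
  · rw [weight_push hv, h6]; ring

theorem buildProgram_spec {n : ℕ} {Abar : Matrix (Fin n) (Fin n) Bool} {off tgt : ℕ → ℕ}
    (hadj : IsAdjacency Abar off tgt) {s : Memory} (h0 : s.reg 0 = n) (h5 : s.reg 5 = 0)
    (a0 : s.arr 0 = off) (a1 : s.arr 1 = tgt) (a2 : s.arr 2 = fun _ => 0)
    (a5 : s.arr 5 = fun _ => 0) :
    Ends buildProgram s fun t s' => t ≤ 100 * (n + off n) + 10 ∧ ∃ adj radj,
      IsAdjLists Abar adj ∧ IsReverse adj radj ∧
      Linked (s'.arr 2) (s'.arr 3) (s'.arr 4) (off n) adj ∧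
      Linked (s'.arr 5) (s'.arr 6) (s'.arr 7) (off n) radj ∧
      weight n (fun _ => 0) adj = 2 * n + off n ∧ weight n (fun _ => 0) radj = 2 * n + off n ∧
      ∀ v < n, s'.arr 8 v = v := by
  obtain ⟨hoff0, hoff⟩ := hadj
  refine (ends_forProgram (num := n)
    (fun i s' => (∃ f r, BuildInv Abar off tgt i (off i) f r s') ∧ ∀ v < i, s'.arr 8 v = v)
    (fun i => 60 * off i + 20 * i) (fun i hi => ?_) (by simp)
    (by simp [pushProgram, Program.AssignsTo])
    (by simp [pushProgram, Program.AssignsTo]) h0 ?_ ?_ ?_).mono ?_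
  · have := (hoff ⟨i, hi⟩).1
    simp only at this
    omega
  · rintro i s' x ⟨⟨f, r, h⟩, h'⟩
    exact ⟨⟨f, r, { h with pos := by simpa using h.pos }⟩, h'⟩
  · refine ⟨⟨fun _ => [], fun _ => [], a0, a1, ?_, ?_, ?_, ?_, ?_, ?_, ?_⟩, ?_⟩
    · rw [h5, hoff0]
    · rw [a2, hoff0]; exact fun _ => .nil
    · rw [a5, hoff0]; exact fun _ => .nil
    · simp [hoff0]
    · simp [IsReverse]
    · simp [weight, hoff0, mul_comm]
    · simp [weight, hoff0, mul_comm]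
    · simp
  · rintro u s' hu hs ⟨⟨f, r, h⟩, h8⟩
    obtain ⟨hle, hbij⟩ := hoff ⟨u, hu⟩
    simp only at hle hbij
    rw [ends_seq, ends_store]
    simp only [Expr.eval, Expr.cost, hs]
    have hloop := ends_loop (e := .reg 5) (f := .get 0 (.add (.reg 2) (.const 1)))
      (P := pushProgram)
      (fun φ s' => ∃ e f r, s'.reg 2 = u ∧ off u ≤ e ∧ e ≤ off (u + 1) ∧
        BuildInv Abar off tgt u e f r s' ∧ φ + 60 * e = 60 * off (u + 1))
      (by
        rintro φ s₁ ⟨e, f, r, h1, h2, h3, h4, h5⟩ hc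
        simp only [Expr.eval, h1, h4.arr_off, h4.pos] at hc
        have hv : tgt e < n := by
          obtain ⟨j, -, hj⟩ := hbij.mapsTo ⟨h2, hc⟩
          rw [hj]
          exact j.2
        refine (pushProgram_spec h4 h1 hu hv h2).frame.mono ?_
        rintro t s₂ ⟨⟨ht, f', r', h'⟩, -, hf⟩
        refine ⟨60 * off (u + 1) - 60 * (e + 1), ⟨e + 1, f', r', ?_, by omega, by omega, h',
          by omega⟩, ?_⟩
        · rw [hf 2 (by simp [pushProgram, Program.AssignsTo]), h1]
        · simp only [Expr.cost]
          omega)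
      (φ := 60 * off (u + 1) - 60 * off u)
      (s := ⟨s'.reg, Function.update s'.arr 8 (Function.update (s'.arr 8) u u)⟩)
      ⟨off u, f, r, hs, le_rfl, hle, by
        obtain ⟨b1, b2, b3, b4, b5, b6⟩ := h
        exact ⟨b1, b2, b3, b4, b5, b6, by assumption, by assumption, by assumption⟩, by omega⟩
    refine hloop.frame.mono ?_
    rintro t s₁ ⟨⟨φ, ⟨e, f', r', h1, h2, h3, h4, h5⟩, hc, ht⟩, hfa, -⟩
    simp only [Expr.eval, Expr.cost, h1, h4.arr_off, h4.pos] at hc ht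
    obtain rfl : e = off (u + 1) := by omega
    refine ⟨by omega, ⟨f', r', { h4 with mem := ?_ }⟩, ?_⟩
    · intro x w
      rw [h4.mem]
      have hvac : ¬ (x = u + 1 ∧ ∃ e', off (u + 1) ≤ e' ∧ e' < off (u + 1) ∧ tgt e' = w) := by
        rintro ⟨-, e', h6, h7, -⟩
        omega
      rw [or_iff_left hvac, Nat.lt_succ_iff_lt_or_eq, or_and_right]
      refine or_congr_right (and_congr_right ?_)
      rintro rfl
      constructor
      · rintro ⟨e', h6, h7, rfl⟩
        obtain ⟨j, h8, h9⟩ := hbij.mapsTo ⟨h6, h7⟩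
        exact ⟨⟨x, hu⟩, j, h8, rfl, h9.symm⟩
      · rintro ⟨i, j, h6, rfl, rfl⟩
        obtain ⟨e', h7, h8⟩ := hbij.surjOn ⟨j, h6, rfl⟩
        exact ⟨e', h7.1, h7.2, h8⟩
    · intro v hv
      rw [hfa 8 (by simp [pushProgram, Program.StoresTo])]
      simp only [Function.update_self]
      rcases Nat.lt_succ_iff_lt_or_eq.1 hv with hv | rfl
      · rw [Function.update_of_ne hv.ne, h8 v hv]
      · rw [Function.update_self]
  · rintro t s' ⟨ht, ⟨adj, radj, h⟩, h8⟩
    refine ⟨by simp only [hoff0] at ht; omega, adj, radj, ?_, h.rev, h.succ, h.pred, h.weight_succ,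
      h.weight_pred, h8⟩
    intro u w
    rw [h.mem]
    constructor
    · rintro (⟨-, h1⟩ | ⟨-, e', h1, h2, -⟩)
      · exact h1
      · omega
    · rintro ⟨i, j, h1, rfl, rfl⟩
      exact Or.inl ⟨i.2, i, j, h1, rfl, rfl⟩

theorem IsAdjacency.off_eq {n : ℕ} {Abar : Matrix (Fin n) (Fin n) Bool} {off tgt : ℕ → ℕ}
    (h : IsAdjacency Abar off tgt) :
    off n = (Finset.univ.filter fun e : Fin n × Fin n => Abar e.2 e.1 = true).card := by
  have hdeg : ∀ i : Fin n, off ((i : ℕ) + 1) =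
      off i + (Finset.univ.filter fun j => Abar j i = true).card := by
    intro i
    obtain ⟨hle, hbij⟩ := h.2 i
    have h1 : Set.ncard {v : ℕ | ∃ j : Fin n, Abar j i = true ∧ v = j} =
        off ((i : ℕ) + 1) - off i := by
      rw [← hbij.image_eq, hbij.injOn.ncard_image, ← Nat.card_coe_set_eq]
      simp
    have h2 : {v : ℕ | ∃ j : Fin n, Abar j i = true ∧ v = j} =
        (((Finset.univ.filter fun j => Abar j i = true).map Fin.valEmbedding : Finset ℕ) :
          Set ℕ) := by
      ext v
      rw [Finset.mem_coe, Finset.mem_map]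
      constructor
      · rintro ⟨j, hj, rfl⟩
        exact ⟨j, by simpa using hj, rfl⟩
      · rintro ⟨j, hj, rfl⟩
        exact ⟨j, by simpa using hj, rfl⟩
    rw [h2, Set.ncard_coe_finset, Finset.card_map] at h1
    omega
  have hsum : ∀ u ≤ n, off u = (Finset.univ.filter fun e : Fin n × Fin n =>
      Abar e.2 e.1 = true ∧ (e.1 : ℕ) < u).card := by
    intro u hu
    induction u with
    | zero => simp [h.1]
    | succ u ih =>
      rw [hdeg ⟨u, hu⟩, ih (by omega)]
      have hmap : (Finset.univ.filter fun j => Abar j ⟨u, hu⟩ = true).card =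
          (Finset.univ.filter fun e : Fin n × Fin n =>
            Abar e.2 e.1 = true ∧ (e.1 : ℕ) = u).card := by
        refine Finset.card_bij (fun j _ => (⟨u, hu⟩, j)) ?_ ?_ ?_
        · intro j hj
          simpa using hj
        · intro j _ j' _ hjj'
          exact (Prod.ext_iff.1 hjj').2
        · rintro ⟨i, j⟩ hij
          simp only [Finset.mem_filter, Finset.mem_univ, true_and] at hij
          obtain rfl : i = ⟨u, hu⟩ := Fin.ext hij.2
          exact ⟨j, by simpa using hij.1, rfl⟩
      rw [hmap, ← Finset.card_union_of_disjoint, ← Finset.filter_or]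
      · congr 1
        refine Finset.filter_congr fun e _ => ?_
        rw [← and_or_left, ← Nat.lt_succ_iff_lt_or_eq]
      · rw [Finset.disjoint_filter]
        omega
  rw [hsum n le_rfl]
  congr 1
  refine Finset.filter_congr fun e _ => ?_
  simp

theorem IsAdjacency.le_graphSize {n : ℕ} {Abar : Matrix (Fin n) (Fin n) Bool} {off tgt : ℕ → ℕ}
    (h : IsAdjacency Abar off tgt) (d : Design n) :
    n + d.p + d.m + off n ≤ d.graphSize Abar := by
  have hinj : Function.Injective fun e : Fin n × Fin n =>
      ((Sum.inl e.1, Sum.inl e.2) :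
        (Fin n ⊕ Fin d.p ⊕ Fin d.m) × (Fin n ⊕ Fin d.p ⊕ Fin d.m)) := by
    rintro ⟨i, j⟩ ⟨i', j'⟩ hij
    simpa using hij
  have hle : off n ≤ Set.ncard {e : (Fin n ⊕ Fin d.p ⊕ Fin d.m) × (Fin n ⊕ Fin d.p ⊕ Fin d.m) |
      systemEdge Abar (actuatorPattern d.act) (sensorPattern d.sen) e.1 e.2} := by
    rw [h.off_eq, ← Finset.card_image_of_injective _ hinj, ← Set.ncard_coe_finset]
    refine Set.ncard_le_ncard ?_ (Set.toFinite _)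
    intro e he
    obtain ⟨x, hx, rfl⟩ := Finset.mem_image.1 (Finset.mem_coe.1 he)
    simpa [systemEdge] using hx
  unfold Design.graphSize
  simp only [Fintype.card_sum, Fintype.card_fin]
  omega

/-! ### Computing the paired lists -/

theorem not_assignsTo_scanProgram {H N T C M Fl q : ℕ} (hq : q < 2 ∨ 9 < q) :
    ¬ (scanProgram H N T C M Fl).AssignsTo q := by
  simp only [scanProgram, scanStep, searchStep, visitProgram, Program.AssignsTo,
    false_or]
  omega

theorem not_storesTo_scanProgram {H N T C M Fl b : ℕ} (hb : b < 9 ∨ 14 < b) (h1 : b ≠ M)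
    (h2 : b ≠ M + 1) : ¬ (scanProgram H N T C M Fl).StoresTo b := by
  simp only [scanProgram, scanStep, searchStep, visitProgram, Program.StoresTo,
    false_or, or_false]
  omega

theorem SearchInv.eq_zero {n : ℕ} {adj : ℕ → List ℕ} {next tgt : ℕ → ℕ} {E : ℕ} {fl : ℕ → ℕ}
    {Proc : ℕ → Prop} {root : ℕ} {pend : ℕ → Prop} {mark cur stk : ℕ → ℕ} {sp r : ℕ}
    {ma ms ua us : ℕ → ℕ} {rem : ℕ → List ℕ}
    (h : SearchInv n adj next tgt E fl Proc root pend mark cur stk sp r ma ms ua us rem)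
    (hfl : fl = fun _ => 0) : r = 0 ∧ ua = (fun _ => 0) ∧ us = fun _ => 0 := by
  have hr := h.r_eq_zero fun v => congrFun hfl v
  refine ⟨hr, funext fun v => ?_, funext fun v => ?_⟩
  · by_contra hv
    obtain ⟨j, hj, -⟩ := (h.ua_iff v).1 hv
    omega
  · by_contra hv
    obtain ⟨j, hj, -⟩ := (h.us_iff v).1 hv
    omega

/-- List representatives of the source components in the array `M + 3`, and their number in
register `3`, by two scans. -/
def sourceProgram (H N T M : ℕ) : Program :=
  .seq (.assign 2 (.reg 0)) <|
  .seq (scanProgram H N T 8 M 16) <|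
  .seq (.assign 2 (.reg 3)) <|
  scanProgram H N T (M + 1) (M + 2) 16

theorem not_assignsTo_sourceProgram {H N T M q : ℕ} (hq : q < 2 ∨ 9 < q) :
    ¬ (sourceProgram H N T M).AssignsTo q := by
  simp only [sourceProgram, Program.AssignsTo, not_or]
  exact ⟨by omega, not_assignsTo_scanProgram hq, by omega, not_assignsTo_scanProgram hq⟩

theorem not_storesTo_sourceProgram {H N T M b : ℕ} (hb : b < 9 ∨ 14 < b) (h : b < M ∨ M + 3 < b) :
    ¬ (sourceProgram H N T M).StoresTo b := by
  simp only [sourceProgram, Program.StoresTo, not_or]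
  exact ⟨not_false, not_storesTo_scanProgram hb (by omega) (by omega), not_false,
    not_storesTo_scanProgram hb (by omega) (by omega)⟩

theorem sourceProgram_spec {H N T M n E : ℕ} {adj : ℕ → List ℕ} {s : Memory}
    (hH : H < 9) (hN : N < 9) (hT : T < 9) (hM : 16 < M) (hadj : ∀ u, ∀ w ∈ adj u, w < n)
    (hn : s.reg 0 = n) (h8 : ∀ v < n, s.arr 8 v = v)
    (hl : Linked (s.arr H) (s.arr N) (s.arr T) E adj) (hM0 : s.arr M = fun _ => 0)
    (hM2 : s.arr (M + 2) = fun _ => 0) (h13 : s.arr 13 = fun _ => 0) (h14 : s.arr 14 = fun _ => 0)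
    (h16 : s.arr 16 = fun _ => 0) (hr : s.reg 4 = 0) :
    Ends (sourceProgram H N T M) s fun t s' =>
      t ≤ 160 * weight n (fun _ => 0) adj + 300 * n + 30 ∧
      SourceList n adj (s'.arr (M + 3)) (s'.reg 3) ∧ s'.reg 4 = 0 ∧ s'.arr 13 = (fun _ => 0) ∧
      s'.arr 14 = fun _ => 0 := by
  have ha1 : ScanArrays H N T 8 M 16 := ⟨hH, hN, hT, by omega, hM, by omega, by omega⟩
  have ha2 : ScanArrays H N T (M + 1) (M + 2) 16 :=
    ⟨hH, hN, hT, by omega, by omega, by omega, by omega⟩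
  simp only [sourceProgram, ends_seq, ends_assign, Expr.eval, Expr.cost]
  have hscan1 := scanProgram_spec (n := n) (E := E) (adj := adj)
    (s := ⟨Function.update s.reg 2 (s.reg 0), s.arr⟩) ha1 hadj
    (by intro j hj; simp only [Function.update_self, hn] at hj; simpa only [h8 j hj] using hj)
    hl hM0 h13 h14 (by simpa using hr)
  refine hscan1.frame.mono ?_
  rintro t₁ s₁ ⟨⟨rem₁, ht₁, hz₁, hI₁⟩, hfa₁, -⟩
  simp only [Function.update_self, hn] at ht₁ hI₁
  obtain ⟨hr₁, hua₁, hus₁⟩ := hI₁.inv.2.eq_zero (hI₁.flag.trans h16)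
  have hroots₁ := hI₁.roots fun v => congrFun h16 v
  rw [hz₁] at hroots₁
  have hscan2 := scanProgram_spec (n := n) (E := E) (adj := adj)
    (s := ⟨Function.update s₁.reg 2 (s₁.reg 3), s₁.arr⟩) ha2 hadj
    (by
      intro j hj
      simp only [Function.update_self] at hj
      obtain ⟨v, -, hv, h1, -⟩ := hroots₁.mem j hj
      rw [h1, h8 v hv]
      exact hv)
    hI₁.inv.1 ((hfa₁ _ (not_storesTo_scanProgram (by omega) (by omega) (by omega))).trans hM2)
    hua₁ hus₁ (by simpa using hr₁)
  refine hscan2.mono ?_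
  rintro t₂ s₂ ⟨rem₂, ht₂, hz₂, hI₂⟩
  simp only [Function.update_self] at ht₂ hI₂
  have h16' : s₁.arr 16 = fun _ => 0 :=
    (hfa₁ _ (not_storesTo_scanProgram (by omega) (by omega) (by omega))).trans h16
  obtain ⟨hr₂, hua₂, hus₂⟩ := hI₂.inv.2.eq_zero (hI₂.flag.trans h16')
  have hroots₂ := hI₂.roots fun v => congrFun h16' v
  rw [hz₂] at hroots₂
  have hle := hroots₁.le
  exact ⟨by omega, hroots₁.sourceList h8 hroots₂, hr₂, hua₂, hus₂⟩

/-- The pairs found by a search from the sources with flags at the sinks. -/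
theorem SearchInv.pairedLists {n : ℕ} {adj radj : ℕ → List ℕ} {next tgt : ℕ → ℕ} {E : ℕ}
    {fl : ℕ → ℕ} {Proc : ℕ → Prop} {root : ℕ} {pend : ℕ → Prop} {mark cur stk : ℕ → ℕ} {r : ℕ}
    {ma ms ua us : ℕ → ℕ} {rem : ℕ → List ℕ} {ρ σ A S : ℕ → ℕ} {p m p' m' : ℕ}
    (h : SearchInv n adj next tgt E fl Proc root pend mark cur stk 0 r ma ms ua us rem)
    (hrev : IsReverse adj radj) (hρ : SourceList n adj ρ p) (hσ : SourceList n radj σ m)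
    (hmark : ∀ a < p, mark (ρ a) ≠ 0) (hfl : ∀ l < m, fl (σ l) ≠ 0)
    (hA : SourceList n adj A p') (hS : SourceList n radj S m') (hp : r ≤ p') (hm : r ≤ m')
    (hma : ∀ l < r, A l = ma l) (hms : ∀ l < r, S l = ms l) :
    PairedLists n adj radj A S p' m' r := by
  refine ⟨hA, hS, hp, hm, fun l hl => ?_, fun a ha => ?_, fun c hc => ?_⟩
  · rw [hma l hl, hms l hl]
    exact (h.pair l hl).2.2.2.2
  · obtain ⟨b, hb, hba⟩ := hρ.cover (A a) (hA.lt a ha)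
    obtain ⟨l, hl, hbl⟩ := h.exists_reach_sink hrev hσ hfl (hmark b hb)
    exact ⟨l, hl, hms l hl ▸ (hA.source a ha _ (hρ.lt b hb) hba).trans hbl⟩
  · obtain ⟨d, hd, hdc⟩ := hσ.cover (S c) (hS.lt c hc)
    have hcd := hrev.reach_iff.1 (hS.source c hc _ (hσ.lt d hd) hdc)
    obtain ⟨b, hb, hbd⟩ := hρ.cover (σ d) (hσ.lt d hd)
    obtain ⟨l, hl, hld⟩ := h.exists_root_reach (hmark b hb) hbd (hfl d hd)
    exact ⟨l, hl, hma l hl ▸ hld.trans hcd⟩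

/-- Compute the lists of sources and sinks of a block in the arrays `11` and `12`, with the matched
ones first. The numbers of sources, sinks and pairs are stored in the registers `10`, `11`, `4`. -/
def pairProgram : Program :=
  .seq (sourceProgram 2 3 4 20) <|
  .seq (.assign 10 (.reg 3)) <|
  .seq (sourceProgram 5 6 7 24) <|
  .seq (.assign 11 (.reg 3)) <|
  .seq (flagProgram 27 15 11) <|
  .seq (.assign 2 (.reg 10)) <|
  .seq (scanProgram 2 3 4 23 28 15) <|
  .seq (.assign 12 (.reg 4)) <|
  .seq (appendProgram 23 13 11 10 12) <|
  .seq (.assign 13 (.reg 4)) <|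
  .seq (appendProgram 27 14 12 11 13) <|
  .seq (.assign 10 (.reg 12)) <|
  .assign 11 (.reg 13)

theorem pairProgram_spec {n E W : ℕ} {adj radj : ℕ → List ℕ} {s : Memory}
    (hadj : ∀ u, ∀ w ∈ adj u, w < n) (hradj : ∀ u, ∀ w ∈ radj u, w < n)
    (hrev : IsReverse adj radj) (hW : weight n (fun _ => 0) adj = W)
    (hW' : weight n (fun _ => 0) radj = W) (hn : s.reg 0 = n) (hr : s.reg 4 = 0)
    (hl : Linked (s.arr 2) (s.arr 3) (s.arr 4) E adj)
    (hl' : Linked (s.arr 5) (s.arr 6) (s.arr 7) E radj) (h8 : ∀ v < n, s.arr 8 v = v)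
    (h0 : ∀ b, 12 < b → s.arr b = fun _ => 0) :
    Ends pairProgram s fun t s' => t ≤ 400 * W + 1000 * n + 200 ∧
      PairedLists n adj radj (s'.arr 11) (s'.arr 12) (s'.reg 10) (s'.reg 11) (s'.reg 4) := by
  simp only [pairProgram, ends_seq, ends_assign, Expr.eval, Expr.cost]
  -- the sources
  refine (sourceProgram_spec (M := 20) (by omega) (by omega) (by omega) (by omega) hadj hn h8 hl
    (h0 _ (by omega)) (h0 _ (by omega)) (h0 _ (by omega)) (h0 _ (by omega)) (h0 _ (by omega))
    hr).frame.mono ?_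
  rintro t₁ s₁ ⟨⟨ht₁, hρ, hr₁, hua₁, hus₁⟩, hfa₁, hfr₁⟩
  have a₁ : ∀ b, b < 9 ∨ 14 < b → b < 20 ∨ 23 < b → s₁.arr b = s.arr b := fun b h h' =>
    hfa₁ b (not_storesTo_sourceProgram h h')
  have z₁ : ∀ b, 14 < b → b < 20 ∨ 23 < b → s₁.arr b = fun _ => 0 := fun b h h' =>
    (a₁ b (Or.inr h) h').trans (h0 b (by omega))
  have g₁ : s₁.reg 0 = n := (hfr₁ 0 (not_assignsTo_sourceProgram (by omega))).trans hn
  -- the sinks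
  refine (sourceProgram_spec (M := 24) (n := n) (E := E) (adj := radj)
    (s := ⟨Function.update s₁.reg 10 (s₁.reg 3), s₁.arr⟩)
    (by omega) (by omega) (by omega) (by omega) hradj (by simpa using g₁)
    (by simpa only [a₁ 8 (by omega) (by omega)] using h8)
    (by simpa only [a₁ 5 (by omega) (by omega), a₁ 6 (by omega) (by omega),
      a₁ 7 (by omega) (by omega)] using hl')
    (z₁ _ (by omega) (by omega)) (z₁ _ (by omega) (by omega)) hua₁ hus₁
    (z₁ _ (by omega) (by omega)) (by simpa using hr₁)).frame.mono ?_
  rintro t₂ s₂ ⟨⟨ht₂, hσ, hr₂, hua₂, hus₂⟩, hfa₂, hfr₂⟩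
  have a₂ : ∀ b, b < 9 ∨ 14 < b → b < 24 ∨ 27 < b → s₂.arr b = s₁.arr b := fun b h h' =>
    hfa₂ b (not_storesTo_sourceProgram h h')
  have g₂ : s₂.reg 10 = s₁.reg 3 :=
    (hfr₂ 10 (not_assignsTo_sourceProgram (by omega))).trans
      (Function.update_self 10 (s₁.reg 3) s₁.reg)
  -- flags at the sinks
  refine (flagProgram_spec (X := 27) (F := 15) (N := 11)
    (s := ⟨Function.update s₂.reg 11 (s₂.reg 3), s₂.arr⟩) (by omega) (by omega)
    ((a₂ 15 (by omega) (by omega)).trans (z₁ _ (by omega) (by omega)))).mono ?_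
  rintro t₃ s₃ ⟨ht₃, a₃, g₃, hfl⟩
  simp only [Function.update_self] at ht₃ hfl
  have g₃' : ∀ q, q ≠ 2 → q ≠ 11 → s₃.reg q = s₂.reg q := fun q h h' =>
    (g₃ q h).trans (Function.update_of_ne h' _ _)
  have g₃11 : s₃.reg 11 = s₂.reg 3 := (g₃ 11 (by omega)).trans
    (Function.update_self 11 (s₂.reg 3) s₂.reg)
  have b₃ : ∀ b, b < 9 → s₃.arr b = s.arr b := fun b hb => by
    rw [a₃ b (by omega)]
    exact (a₂ b (by omega) (by omega)).trans (a₁ b (by omega) (by omega))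
  have X₃ : s₃.arr 23 = s₁.arr 23 := (a₃ 23 (by omega)).trans (a₂ 23 (by omega) (by omega))
  have Y₃ : s₃.arr 27 = s₂.arr 27 := a₃ 27 (by omega)
  have e₃ : s₃.reg 10 = s₁.reg 3 := (g₃' 10 (by omega) (by omega)).trans g₂
  simp only [Nat.reduceAdd] at hρ hσ
  -- the search for pairs
  refine (scanProgram_spec (H := 2) (N := 3) (T := 4) (C := 23) (M := 28) (Fl := 15) (n := n)
    (E := E) (adj := adj) (s := ⟨Function.update s₃.reg 2 (s₃.reg 10), s₃.arr⟩)
    ⟨by omega, by omega, by omega, by omega, by omega, by omega, by omega⟩ hadj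
    (by
      intro j hj
      simp only [Function.update_self, e₃] at hj
      simpa only [X₃] using hρ.lt j hj)
    (by simpa only [b₃ 2 (by omega), b₃ 3 (by omega), b₃ 4 (by omega)] using hl)
    (by
      rw [a₃ 28 (by omega)]
      exact (a₂ 28 (by omega) (by omega)).trans (z₁ _ (by omega) (by omega)))
    ((a₃ 13 (by omega)).trans hua₂) ((a₃ 14 (by omega)).trans hus₂)
    (by simpa [g₃' 4 (by omega) (by omega)] using hr₂)).frame.mono ?_
  rintro t₄ s₄ ⟨⟨rem, ht₄, hz₄, hI⟩, hfa₄, hfr₄⟩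
  simp only [Function.update_self, e₃, X₃] at ht₄ hI
  have hsearch := hI.inv.2
  have hmark := hI.marked
  rw [hI.flag, hI.sp, hz₄] at hsearch
  rw [hz₄] at hmark
  have g₄ : ∀ q, 9 < q → s₄.reg q = s₃.reg q := fun q hq =>
    (hfr₄ q (not_assignsTo_scanProgram (by omega))).trans (Function.update_of_ne (by omega) _ _)
  have X₄ : s₄.arr 23 = s₁.arr 23 :=
    (hfa₄ 23 (not_storesTo_scanProgram (by omega) (by omega) (by omega))).trans X₃
  have Y₄ : s₄.arr 27 = s₂.arr 27 :=
    (hfa₄ 27 (not_storesTo_scanProgram (by omega) (by omega) (by omega))).trans Y₃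
  have e₄ : s₄.reg 10 = s₁.reg 3 := (g₄ 10 (by omega)).trans e₃
  have f₄ : s₄.reg 11 = s₂.reg 3 := (g₄ 11 (by omega)).trans g₃11
  -- the unmatched sources
  refine (appendProgram_spec (X := 23) (U := 13) (D := 11) (N := 10) (pos := 12) (n := n)
    (adj := adj) (s := ⟨Function.update s₄.reg 12 (s₄.reg 4), s₄.arr⟩) (by omega) (by omega)
    (by omega) (by omega) (by omega) (by simpa [X₄, e₄] using hρ)
    (by
      intro a ha
      simp only [Function.update_self] at ha
      obtain ⟨b, -, hb, hba⟩ := (hsearch.pair a ha).1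
      exact ⟨b, by simpa [e₄] using hb, by simpa [X₄] using hba⟩)
    (by simpa using hsearch.ua_iff) (by simpa using hsearch.ma_inj)).mono ?_
  rintro t₅ s₅ ⟨ht₅, a₅, g₅, hA, hle₅, hagree₅⟩
  have e₅ : s₅.reg 11 = s₂.reg 3 := by
    rw [g₅ 11 (by omega) (by omega)]
    simpa using f₄
  have r₅ : s₅.reg 4 = s₄.reg 4 := by
    rw [g₅ 4 (by omega) (by omega)]
    simp
  have Y₅ : s₅.arr 27 = s₂.arr 27 := (a₅ 27 (by omega)).trans Y₄
  have D₅ : s₅.arr 12 = s₄.arr 12 := a₅ 12 (by omega)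
  have U₅ : s₅.arr 14 = s₄.arr 14 := a₅ 14 (by omega)
  simp (disch := omega) only [Function.update_self, Function.update_of_ne, e₄] at ht₅ hle₅ hagree₅
  -- the unmatched sinks
  refine (appendProgram_spec (X := 27) (U := 14) (D := 12) (N := 11) (pos := 13) (n := n)
    (adj := radj) (s := ⟨Function.update s₅.reg 13 (s₅.reg 4), s₅.arr⟩) (by omega) (by omega)
    (by omega) (by omega) (by omega) (by simpa [Y₅, e₅] using hσ)
    (by
      intro a ha
      simp only [Function.update_self, r₅] at ha
      obtain ⟨b, hb, hba⟩ := (hfl _).1 (hsearch.pair a ha).2.2.2.1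
      exact ⟨b, by simpa [e₅] using hb, by simpa [Y₅, D₅] using hba⟩)
    (by simpa [U₅, D₅, r₅] using hsearch.us_iff)
    (by simpa [D₅, r₅] using hsearch.ms_inj)).mono ?_
  rintro t₆ s₆ ⟨ht₆, a₆, g₆, hS, hle₆, hagree₆⟩
  have e₆ : s₆.reg 12 = s₅.reg 12 := by
    rw [g₆ 12 (by omega) (by omega)]
    simp
  have r₆ : s₆.reg 4 = s₄.reg 4 := by
    rw [g₆ 4 (by omega) (by omega)]
    simpa using r₅
  have D₆ : s₆.arr 11 = s₅.arr 11 := a₆ 11 (by omega)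
  simp (disch := omega) only [Function.update_self, Function.update_of_ne, e₅, r₅, D₅]
    at ht₆ hle₆ hagree₆
  have hρle := hρ.le
  have hσle := hσ.le
  simp (disch := omega) only [Function.update_self, Function.update_of_ne, e₆, r₆, D₆]
  refine ⟨by omega, ?_⟩
  exact hsearch.pairedLists hrev hρ hσ (fun a ha => hmark a (Nat.zero_le a) ha)
    (fun l hl => (hfl _).2 ⟨l, hl, rfl⟩) hA hS hle₅ hle₆ hagree₅ hagree₆

/-! ### The complete program -/

/-- Write the `k + 1` copies of the block given by the arrays `11`, `12` and the registers `4`,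
`10`, `11` into the output. Register `20` is never assigned, so that it contains `0`. -/
def outputProgram : Program :=
  .seq (.branch (.reg 10) (.reg 11) (.assign 12 (.reg 11)) (.assign 12 (.reg 10))) <|
  .seq linkProgram <|
  .seq multiplyProgram <|
  .seq (fillProgram 0 11 10 20 14) <|
  .seq (fillProgram 1 12 11 20 15) <|
  .seq (fillProgram 2 17 12 11 16) <|
  .seq (fillProgram 3 18 12 10 16) <|
  .seq (.assign 0 (.reg 14)) <|
  .seq (.assign 1 (.reg 15)) <|
  .assign 2 (.reg 16)

theorem outputProgram_spec {s : Memory} {k p m : ℕ} (hk : s.reg 1 = k) (h10 : s.reg 10 = p)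
    (h11 : s.reg 11 = m) (hp : 0 < p) (hm : 0 < m) (h14 : s.reg 14 = 0) (h15 : s.reg 15 = 0)
    (h16 : s.reg 16 = 0) (h20 : s.reg 20 = 0) :
    Ends outputProgram s fun t s' => t ≤ 200 * ((k + 1) * (p + m + 1)) + 100 ∧
      s'.reg 0 = (k + 1) * p ∧ s'.reg 1 = (k + 1) * m ∧ s'.reg 2 = (k + 1) * max p m ∧
      (∀ l < (k + 1) * p, s'.arr 0 l = s.arr 11 (l % p)) ∧
      (∀ l < (k + 1) * m, s'.arr 1 l = s.arr 12 (l % m)) ∧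
      ∀ l < (k + 1) * max p m,
        s'.arr 2 l = linkSensor m (l % max p m) + m * (l / max p m) ∧
        s'.arr 3 l = linkActuator (s.reg 4) p (l % max p m) + p * (l / max p m) := by
  have hmax : Ends (.branch (.reg 10) (.reg 11) (.assign 12 (.reg 11)) (.assign 12 (.reg 10))) s
      fun t s' => t ≤ 10 ∧ s' = ⟨Function.update s.reg 12 (max p m), s.arr⟩ := by
    simp only [ends_branch, ends_assign, Expr.eval, Expr.cost, h10, h11]
    refine ⟨fun h => ⟨by omega, ?_⟩, fun h => ⟨by omega, ?_⟩⟩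
    · rw [max_eq_right h.le]
    · rw [max_eq_left (by omega)]
  set q := max p m with hq
  have hq0 : 0 < q := lt_max_of_lt_left hp
  have hqle : q ≤ p + m := max_le (by omega) (by omega)
  simp only [outputProgram, ends_seq, ends_assign]
  refine hmax.mono ?_
  rintro t₁ s₁ ⟨ht₁, rfl⟩
  refine (linkProgram_spec _).mono ?_
  rintro t₂ s₂ ⟨ht₂, a₂, g₂, hlink⟩
  simp (disch := omega) only [Function.update_self, Function.update_of_ne, h10, h11]
    at ht₂ hlink
  have g₂' : ∀ r, r ≠ 2 → r ≠ 12 → s₂.reg r = s.reg r := fun r h h' =>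
    (g₂ r h).trans (Function.update_of_ne h' _ _)
  have q₂ : s₂.reg 12 = q := (g₂ 12 (by omega)).trans (Function.update_self 12 q s.reg)
  have e₂ : s₂.reg 10 = p := (g₂' 10 (by omega) (by omega)).trans h10
  have f₂ : s₂.reg 11 = m := (g₂' 11 (by omega) (by omega)).trans h11
  have k₂ : s₂.reg 1 = k := (g₂' 1 (by omega) (by omega)).trans hk
  refine (multiplyProgram_spec ((g₂' 14 (by omega) (by omega)).trans h14)
    ((g₂' 15 (by omega) (by omega)).trans h15) ((g₂' 16 (by omega) (by omega)).trans h16)).mono ?_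
  rintro t₃ s₃ ⟨ht₃, a₃, g₃, P₃, M₃, Q₃⟩
  rw [k₂] at ht₃
  rw [k₂, e₂] at P₃
  rw [k₂, f₂] at M₃
  rw [k₂, q₂] at Q₃
  have c₃ : s₃.reg 10 = p ∧ s₃.reg 11 = m ∧ s₃.reg 12 = q ∧ s₃.reg 20 = 0 := by
    refine ⟨?_, ?_, ?_, ?_⟩
    · rw [g₃ 10 (by omega) (by omega) (by omega) (by omega) (by omega), e₂]
    · rw [g₃ 11 (by omega) (by omega) (by omega) (by omega) (by omega), f₂]
    · rw [g₃ 12 (by omega) (by omega) (by omega) (by omega) (by omega), q₂]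
    · rw [g₃ 20 (by omega) (by omega) (by omega) (by omega) (by omega),
        g₂' 20 (by omega) (by omega), h20]
  obtain ⟨e₃, f₃, q₃, z₃⟩ := c₃
  refine (fillProgram_spec (by omega) (by omega) (by omega) (by omega) (by omega)).mono ?_
  rintro t₄ s₄ ⟨ht₄, a₄, g₄, hfill₀⟩
  refine (fillProgram_spec (by omega) (by omega) (by omega) (by omega)
    (by rw [g₄ 11 (by omega)]; omega)).mono ?_
  rintro t₅ s₅ ⟨ht₅, a₅, g₅, hfill₁⟩
  refine (fillProgram_spec (by omega) (by omega) (by omega) (by omega)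
    (by rw [g₅ 12 (by omega), g₄ 12 (by omega)]; omega)).mono ?_
  rintro t₆ s₆ ⟨ht₆, a₆, g₆, hfill₂⟩
  refine (fillProgram_spec (by omega) (by omega) (by omega) (by omega)
    (by rw [g₆ 12 (by omega), g₅ 12 (by omega), g₄ 12 (by omega)]; omega)).mono ?_
  rintro t₇ s₇ ⟨ht₇, a₇, g₇, hfill₃⟩
  simp (disch := omega) only [g₄, g₅, g₆, e₃, f₃, q₃, z₃, P₃, M₃, Q₃]
    at ht₄ ht₅ ht₆ ht₇ hfill₀ hfill₁ hfill₂ hfill₃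
  simp (disch := omega) only [Expr.eval, Expr.cost, Function.update_self, Function.update_of_ne,
    g₄, g₅, g₆, g₇, P₃, M₃, Q₃]
  have hQ : (k + 1) * q ≤ (k + 1) * (p + m) := Nat.mul_le_mul_left _ hqle
  have hPM : (k + 1) * (p + m) = (k + 1) * p + (k + 1) * m := by ring
  have hPM1 : (k + 1) * (p + m + 1) = (k + 1) * p + (k + 1) * m + (k + 1) := by ring
  have hq1 : q ≤ (k + 1) * q := Nat.le_mul_of_pos_left _ (by omega)
  refine ⟨by omega, trivial, trivial, trivial, ?_, ?_, ?_⟩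
  · intro l hl
    rw [a₇ 0 (by omega), a₆ 0 (by omega), a₅ 0 (by omega), hfill₀ l hl, a₃, a₂ 11 (by omega)
      (by omega)]
    ring
  · intro l hl
    rw [a₇ 1 (by omega), a₆ 1 (by omega), hfill₁ l hl, a₄ 12 (by omega), a₃, a₂ 12 (by omega)
      (by omega)]
    ring
  · intro l hl
    have hmod : l % q < q := Nat.mod_lt _ hq0
    rw [a₇ 2 (by omega), hfill₂ l hl, hfill₃ l hl, a₅ 17 (by omega), a₄ 17 (by omega), a₃,
      a₆ 18 (by omega), a₅ 18 (by omega), a₄ 18 (by omega), a₃, (hlink _ hmod).1, (hlink _ hmod).2]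
    exact ⟨rfl, rfl⟩

/-- The program of the theorem: if there are no state variables, then the empty design is
output. -/
def codesignProgram : Program :=
  .branch (.const 0) (.reg 0) (.seq buildProgram (.seq pairProgram outputProgram))
    (.assign 1 (.const 0))

theorem codesignProgram_spec {n k : ℕ} {Abar : Matrix (Fin n) (Fin n) Bool} {off tgt : ℕ → ℕ}
    (hn : 0 < n) (hoff : IsAdjacency Abar off tgt) :
    Ends codesignProgram (inputMemory n k off tgt) fun t s' => ∃ adj radj A S p m r,
      IsAdjLists Abar adj ∧ IsReverse adj radj ∧ PairedLists n adj radj A S p m r ∧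
      t ≤ 2000 * (n + off n + (k + 1) * (p + m + 1)) ∧
      s'.reg 0 = (k + 1) * p ∧ s'.reg 1 = (k + 1) * m ∧ s'.reg 2 = (k + 1) * max p m ∧
      (∀ l < (k + 1) * p, s'.arr 0 l = A (l % p)) ∧
      (∀ l < (k + 1) * m, s'.arr 1 l = S (l % m)) ∧
      ∀ l < (k + 1) * max p m,
        s'.arr 2 l = linkSensor m (l % max p m) + m * (l / max p m) ∧
        s'.arr 3 l = linkActuator r p (l % max p m) + p * (l / max p m) := by
  rw [codesignProgram, ends_branch]
  refine ⟨fun _ => ?_, fun h => absurd hn h⟩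
  rw [ends_seq]
  refine (buildProgram_spec hoff rfl rfl rfl rfl rfl rfl).frame.mono ?_
  rintro t₁ s₁ ⟨⟨ht₁, adj, radj, hadj, hrev, hl, hl', hW, hW', h8⟩, a₁, g₁⟩
  have ha₁ : ∀ b, 12 < b → s₁.arr b = fun _ => 0 := by
    intro b hb
    rw [a₁ b (by simp only [buildProgram, forProgram, pushProgram, Program.StoresTo,
      false_or, or_false]; omega)]
    simp only [inputMemory]
    rw [if_neg (by omega), if_neg (by omega)]
  have hg₁ : ∀ q, q ≠ 2 → q ≠ 5 → q ≠ 6 →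
      s₁.reg q = if q = 0 then n else if q = 1 then k else 0 := by
    intro q h2 h5 h6
    rw [g₁ q (by simp [buildProgram, forProgram, pushProgram, Program.AssignsTo, *])]
    rfl
  rw [ends_seq]
  refine (pairProgram_spec hadj.lt (hadj.reverse hrev).lt hrev hW hW'
    (hg₁ 0 (by omega) (by omega) (by omega)) (hg₁ 4 (by omega) (by omega) (by omega)) hl hl' h8
    ha₁).frame.mono ?_
  rintro t₂ s₂ ⟨⟨ht₂, hpair⟩, -, g₂⟩
  have hg₂ : ∀ q, q = 1 ∨ 13 < q → s₂.reg q = if q = 1 then k else 0 := by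
    intro q hq
    rw [g₂ q, hg₁ q (by omega) (by omega) (by omega), if_neg (by omega)]
    simp only [pairProgram, flagProgram, appendProgram, forProgram, Program.AssignsTo, not_or,
      not_false_iff, true_and]
    refine ⟨not_assignsTo_sourceProgram (by omega), by omega,
      not_assignsTo_sourceProgram (by omega), by omega, by omega, by omega,
      not_assignsTo_scanProgram (by omega), ?_⟩
    omega
  have hr := hpair.pos hn
  have hrp := hpair.le_p
  have hrm := hpair.le_m
  refine (outputProgram_spec (k := k) (hg₂ 1 (by omega)) rfl rfl (by omega) (by omega)
    (hg₂ 14 (by omega)) (hg₂ 15 (by omega)) (hg₂ 16 (by omega)) (hg₂ 20 (by omega))).mono ?_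
  rintro t₃ s₃ ⟨ht₃, hout⟩
  have hpos : 0 < (k + 1) * (s₂.reg 10 + s₂.reg 11 + 1) := by positivity
  refine ⟨adj, radj, _, _, _, _, _, hadj, hrev, hpair, ?_, hout⟩
  simp only [Expr.cost]
  omega

/-- Without state variables the empty design is a solution. -/
theorem exists_design_of_isEmpty {k : ℕ} {off tgt : ℕ → ℕ} (Abar : Matrix (Fin 0) (Fin 0) Bool)
    (hA : StatePerfectMatching Abar) :
    ∃ (p m : ℕ) (ι : Fin ((k + 1) * p) → Fin 0) (γ : Fin ((k + 1) * m) → Fin 0)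
      (L : Fin (k + 1) → Finset (Fin m × Fin p)) (t : ℕ) (s : Memory),
      (∀ i, IsMinActuators Abar (block ι i)) ∧ (∀ i, IsMinSensors Abar (block γ i)) ∧
      (∀ i, IsSparsestPattern Abar (block ι i) (block γ i) (L i)) ∧
      Run codesignProgram (inputMemory 0 k off tgt) t s ∧ Outputs s (unionDesign ι γ L) ∧
      t ≤ 5 := by
  have hmin : ∀ (B : Matrix (Fin 0) (Fin 0) Bool) (ι : Fin 0 → Fin 0),
      StatePerfectMatching B → IsMinActuators B ι := fun B ι hB =>
    IsSourceTransversal.isMinActuators (S := ∅) hB ⟨fun i => i.elim0, by simp, by simp⟩ (by simp)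
      (Nat.zero_le _)
  have hι : ∀ (ι : Fin ((k + 1) * 0) → Fin 0) i, IsMinActuators Abar (block ι i) :=
    fun ι i => hmin Abar _ hA
  have hγ : ∀ (γ : Fin ((k + 1) * 0) → Fin 0) i, IsMinSensors Abar (block γ i) :=
    fun γ i => isMinSensors_iff.2 (hmin _ _ hA.transpose)
  have hcard : (unionDesign (n := 0) (k := k) (p := 0) (m := 0) Fin.elim0 Fin.elim0
      fun _ => ∅).links.card = 0 :=
    card_links_unionDesign _ _ (q := 0) fun _ => rfl
  refine ⟨0, 0, Fin.elim0, Fin.elim0, fun _ => ∅, _, _, hι _, hγ _, fun i => ?_,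
    .branchFalse (by simp [Expr.eval, inputMemory]) (.assign _ _ _), ?_, ?_⟩
  · exact isSparsestPattern_of_strongly_connected hA (hι _ i) (hγ _ i) (fun i => i.elim0)
      (fun c => c.elim0) (by simp)
  · refine ⟨?_, ?_, ?_, fun a => a.elim0, fun c => c.elim0, ?_⟩
    · rfl
    · rfl
    · exact hcard.symm
    · rw [Finset.card_eq_zero.1 hcard]
      rfl
  · simp [Expr.cost]

/-- The number of steps is at most `2000` times `n + off n + (k + 1) * (p + m + 1)`, which is at
most twice `(k + 1) * graphSize` because there is a vertex. -/
theorem exists_design_of_pos {n k : ℕ} {Abar : Matrix (Fin n) (Fin n) Bool} {off tgt : ℕ → ℕ}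
    (hn : 0 < n) (hA : StatePerfectMatching Abar) (hoff : IsAdjacency Abar off tgt) :
    ∃ (p m : ℕ) (ι : Fin ((k + 1) * p) → Fin n) (γ : Fin ((k + 1) * m) → Fin n)
      (L : Fin (k + 1) → Finset (Fin m × Fin p)) (t : ℕ) (s : Memory),
      (∀ i, IsMinActuators Abar (block ι i)) ∧ (∀ i, IsMinSensors Abar (block γ i)) ∧
      (∀ i, IsSparsestPattern Abar (block ι i) (block γ i) (L i)) ∧
      Run codesignProgram (inputMemory n k off tgt) t s ∧ Outputs s (unionDesign ι γ L) ∧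
      t ≤ 4000 * ((k + 1) * (unionDesign ι γ L).graphSize Abar) := by
  obtain ⟨t, s, hrun, adj, radj, A, S, p, m, r, hadj, hrev, hpair, ht, h0, h1, h2, hA0, hS1, hL⟩ :=
    codesignProgram_spec (k := k) hn hoff
  have hr := hpair.pos hn
  have hrp := hpair.le_p
  have hrm := hpair.le_m
  have hp : 0 < p := by omega
  have hm : 0 < m := by omega
  let ι : Fin ((k + 1) * p) → Fin n := fun a =>
    ⟨A (a % p), hpair.sources.lt _ (Nat.mod_lt _ hp)⟩
  let γ : Fin ((k + 1) * m) → Fin n := fun c =>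
    ⟨S (c % m), hpair.sinks.lt _ (Nat.mod_lt _ hm)⟩
  have hι : ∀ i a, (block ι i a : ℕ) = A a := by
    intro i a
    simp [block, ι, finProdFinEquiv, Nat.mod_eq_of_lt a.2]
  have hγ : ∀ i c, (block γ i c : ℕ) = S c := by
    intro i c
    simp [block, γ, finProdFinEquiv, Nat.mod_eq_of_lt c.2]
  refine ⟨p, m, ι, γ, fun _ => blockLinks p m r, t, s,
    fun i => hpair.sources.isMinActuators hA hadj (hι i),
    fun i => isMinSensors_iff.2
      (hpair.sinks.isMinActuators hA.transpose (hadj.reverse hrev) (hγ i)),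
    fun i => hpair.isSparsestPattern hA hadj hrev hr (hι i) (hγ i), hrun, ?_, ?_⟩
  · refine ⟨h0, h1, ?_, fun a => hA0 a a.2, fun c => hS1 c c.2, ?_⟩
    · rw [h2, card_links_unionDesign _ _ fun _ => card_blockLinks hr hrp hrm]
    · rw [← image_links_unionDesign ι γ hr hrp hrm, h2]
      refine Finset.image_congr fun o ho => ?_
      obtain ⟨h3, h4⟩ := hL o (Finset.mem_range.1 (Finset.mem_coe.1 ho))
      rw [h3, h4]
  · have hG := hoff.le_graphSize (unionDesign ι γ fun _ => blockLinks p m r)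
    set G := (unionDesign ι γ fun _ => blockLinks p m r).graphSize Abar
    have hG' : n + (k + 1) * p + (k + 1) * m + off n ≤ G := hG
    have h3 : G ≤ (k + 1) * G := Nat.le_mul_of_pos_left _ (Nat.succ_pos k)
    have h4 : k + 1 ≤ (k + 1) * G := Nat.le_mul_of_pos_right _ (by omega)
    have h5 : (k + 1) * (p + m + 1) = (k + 1) * p + (k + 1) * m + (k + 1) := by ring
    omega

end ResilientCoDesign

theorem theorem4 :
    (∀ (n k p m : ℕ) (Abar : Matrix (Fin n) (Fin n) Bool)
      (ι : Fin ((k + 1) * p) → Fin n) (γ : Fin ((k + 1) * m) → Fin n),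
      StatePerfectMatching Abar →
      (∀ i, IsMinActuators Abar (block ι i)) →
      (∀ i, IsMinSensors Abar (block γ i)) →
      (∀ i, ∃ L, IsPairingOutcome Abar (block ι i) (block γ i) L) ∧
      (∀ L : Fin (k + 1) → Finset (Fin m × Fin p),
        (∀ i, IsPairingOutcome Abar (block ι i) (block γ i) (L i)) →
        (∀ i, IsSparsestPattern Abar (block ι i) (block γ i) (L i)) ∧
          IsOptimal Abar k (unionDesign ι γ L)) ∧
      (∀ L : Fin (k + 1) → Finset (Fin m × Fin p),
        (∀ i, IsSparsestPattern Abar (block ι i) (block γ i) (L i)) →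
        IsOptimal Abar k (unionDesign ι γ L))) ∧
    (∃ (P : Program) (κ : ℕ), ∀ (n k : ℕ) (Abar : Matrix (Fin n) (Fin n) Bool)
      (off tgt : ℕ → ℕ),
      StatePerfectMatching Abar → IsAdjacency Abar off tgt →
      ∃ (p m : ℕ) (ι : Fin ((k + 1) * p) → Fin n) (γ : Fin ((k + 1) * m) → Fin n)
        (L : Fin (k + 1) → Finset (Fin m × Fin p)) (t : ℕ) (s : Memory),
        (∀ i, IsMinActuators Abar (block ι i)) ∧
        (∀ i, IsMinSensors Abar (block γ i)) ∧
        (∀ i, IsSparsestPattern Abar (block ι i) (block γ i) (L i)) ∧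
        IsOptimal Abar k (unionDesign ι γ L) ∧
        Run P (inputMemory n k off tgt) t s ∧ Outputs s (unionDesign ι γ L) ∧
        (t : ℝ) ≤ κ * (1 + (k + 1) *
          max ((unionDesign ι γ L).graphSize Abar : ℝ)
            ((((k + 1) * p : ℕ) + ((k + 1) * m : ℕ) : ℝ) ^ (5 / 2 : ℝ)))) := by
  refine ⟨fun n k p m Abar ι γ hA hι hγ => ⟨fun i => ?_, fun L hL => ?_, fun L hL => ?_⟩,
    codesignProgram, 4000, fun n k Abar off tgt hA hoff => ?_⟩
  · exact exists_isPairingOutcome (hι i).1.reachable (hγ i).reachable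
  · have hsp : ∀ i, IsSparsestPattern Abar (block ι i) (block γ i) (L i) := fun i =>
      (hL i).isSparsestPattern hA (hι i) (hγ i)
    exact ⟨hsp, isOptimal_unionDesign_of_isSparsestPattern hA hι hγ hsp⟩
  · exact isOptimal_unionDesign_of_isSparsestPattern hA hι hγ hL
  · have key : ∃ (p m : ℕ) (ι : Fin ((k + 1) * p) → Fin n) (γ : Fin ((k + 1) * m) → Fin n)
        (L : Fin (k + 1) → Finset (Fin m × Fin p)) (t : ℕ) (s : Memory),
        (∀ i, IsMinActuators Abar (block ι i)) ∧ (∀ i, IsMinSensors Abar (block γ i)) ∧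
        (∀ i, IsSparsestPattern Abar (block ι i) (block γ i) (L i)) ∧
        Run codesignProgram (inputMemory n k off tgt) t s ∧ Outputs s (unionDesign ι γ L) ∧
        t ≤ 4000 * (1 + (k + 1) * (unionDesign ι γ L).graphSize Abar) := by
      rcases Nat.eq_zero_or_pos n with rfl | hn
      · obtain ⟨p, m, ι, γ, L, t, s, h1, h2, h3, h4, h5, h6⟩ :=
          exists_design_of_isEmpty (k := k) (off := off) (tgt := tgt) Abar hA
        exact ⟨p, m, ι, γ, L, t, s, h1, h2, h3, h4, h5, by omega⟩
      · obtain ⟨p, m, ι, γ, L, t, s, h1, h2, h3, h4, h5, h6⟩ :=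
          exists_design_of_pos (k := k) hn hA hoff
        exact ⟨p, m, ι, γ, L, t, s, h1, h2, h3, h4, h5, by omega⟩
    obtain ⟨p, m, ι, γ, L, t, s, h1, h2, h3, h4, h5, h6⟩ := key
    refine ⟨p, m, ι, γ, L, t, s, h1, h2, h3,
      isOptimal_unionDesign_of_isSparsestPattern hA h1 h2 h3, h4, h5, ?_⟩
    have h7 : (t : ℝ) ≤ 4000 * (1 + (k + 1) * ((unionDesign ι γ L).graphSize Abar : ℝ)) := by
      exact_mod_cast h6
    refine h7.trans ?_
    push_cast
    gcongr
    exact le_max_left _ _
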